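/- **Setting.** Let $H$ be a real Hilbert space with an orthonormal basis indexed by $\mathbb N$ (infinite-dimensional and separable), and write $f\otimes g=\langle g,\cdot\rangle f$ for $f,g\in H$. Let $(X_i,\varepsilon_i)_{i\ge 1}$ be i.i.d. random elements of $H\times H$ and let $Y_i=SX_i+\varepsilon_i$, where $S$ is a Hilbert–Schmidt operator on $H$. Assume: * $\mathbb E\|X_1\|^2<\infty$, $\mathbb E X_1=0$, and $\Gamma=\mathbb E[X_1\otimes X_1]$ has eigenvalues $\lambda_1\ge\lambda_2\ge\dots>0$ with eigenvectors $(e_j)_{j\ge1}$ forming an orthonormal basis of $H$ (so $\Gamma$ is injective). The sequence $(\lambda_j)$ is interpolated by a positive continuous function on $[0,\infty)$ that is convex for large arguments. * The variables $\xi_j=\langle X_1,e_j\rangle/\sqrt{\lambda_j}$, $j\ge1$, are independent, and for some constant $b>0$, $\mathbb E|\xi_j|^\ell\le\frac{\ell!}{2}b^{\ell-2}\,\mathbb E|\xi_j|^2<\infty$ for all $j\ge1$ and $\ell\ge2$. * $\mathbb E\|\varepsilon_1\|^2<\infty$, $\mathbb E(\varepsilon_1\mid X_1)=0$, the conditional covariance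 of the noise is constant, i.e. $\mathbb E(\langle\varepsilon_1,y\rangle^2\mid X_1)=\mathbb E\langle\varepsilon_1,y\rangle^2$ a.s. for every $y\in H$, and $\varepsilon_1$ is not almost surely $0$. * $(k_n)$ is a sequence of integers with $k_n\to\infty$ and $(k_n\log k_n)^2/n\to0$. Let $\Gamma_n=\frac1n\sum_{i=1}^nX_i\otimes X_i$ and $\Delta_n=\frac1n\sum_{i=1}^nY_i\otimes X_i$. Let $(\widehat\lambda_j,\widehat e_j)_{1\le j\le k_n}$ be the first $k_n$ eigenelements of $\Gamma_n$ (eigenvalues sorted in decreasing order, orthonormal eigenvectors chosen as measurable functions of $X_1,\dots,X_n$). Let $\Gamma_n^\dagger=\sum_{j=1}^{k_n}\widehat\lambda_j^{-1}\,\widehat e_j\otimes\widehat e_j$ (terms with $\widehat\lambda_j=0$ omitted), and let $\widehat S_n=\Delta_n\Gamma_n^\dagger$. **Theorem.** The estimator $\widehat S_n$ cannot converge in distribution to a non-degenerate limit, under any normalization, for the Hilbert–Schmidt norm or even for the operator norm. Precisely, let $(\alpha_n)$ be any sequence of real numbers, and let convergence in distribution be understood either in the space of Hilbert–Schmidt operators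 with the Hilbert–Schmidt norm or in the space of bounded operators with the operator norm. 1. $\alpha_n(\widehat S_n-S)$ does not converge in distribution to any random operator $Z$ that is not almost surely $0$. 2. For any sequence $(C_n)$ of non-random operators in that space, $\alpha_n(\widehat S_n-C_n)$ does not converge in distribution to any random operator $Z$ that is not almost surely equal to a constant operator. -/

import Mathlib

set_option linter.unusedSectionVars false

open MeasureTheory ProbabilityTheory Filter Topology
open scoped InnerProductSpace ENNReal

noncomputable section

namespace FunctionalRegression

section HilbertSchmidt

variable (H : Type*) [NormedAddCommGroup H] [InnerProductSpace ℝ H] [CompleteSpace H]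

/-- The index set of a chosen Hilbert basis of `H`. -/
def BasisIndex : Set H := (exists_hilbertBasis ℝ H).choose

/-- A chosen Hilbert basis of `H`. The Hilbert-Schmidt property and the Hilbert-Schmidt norm below
are computed in it; they do not depend on it, see `isHilbertSchmidt_iff` and `norm_sq_eq_tsum`. -/
def chosenBasis : HilbertBasis (BasisIndex H) ℝ H := (exists_hilbertBasis ℝ H).choose_spec.choose

variable {H}

/-- `T` is a Hilbert-Schmidt operator: `∑ i, ‖T b_i‖ ^ 2 < ∞` for a Hilbert basis `b`. -/
def IsHilbertSchmidt (T : H →L[ℝ] H) : Prop :=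
  Summable fun i => ‖T (chosenBasis H i)‖ ^ 2

lemma isHilbertSchmidt_iff_memℓp (T : H →L[ℝ] H) :
    IsHilbertSchmidt T ↔ Memℓp (fun i => T (chosenBasis H i)) 2 := by
  rw [memℓp_gen_iff (by norm_num)]
  simp [IsHilbertSchmidt]

variable (H) in
/-- The subspace of the Hilbert-Schmidt operators. -/
def hilbertSchmidtSubmodule : Submodule ℝ (H →L[ℝ] H) where
  carrier := {T | IsHilbertSchmidt T}
  add_mem' {S T} hS hT := by
    simp only [Set.mem_ofPred_eq, isHilbertSchmidt_iff_memℓp] at *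
    exact hS.add hT
  zero_mem' := by simp [IsHilbertSchmidt]
  smul_mem' c T hT := by
    simp only [Set.mem_ofPred_eq, isHilbertSchmidt_iff_memℓp] at *
    exact hT.const_smul c

variable (H) in
/-- The space of Hilbert-Schmidt operators on `H`. It is a separate type, so that it carries the
Hilbert-Schmidt norm and its topology, and not those of the operator norm. -/
def HilbertSchmidt : Type _ := {T : H →L[ℝ] H // IsHilbertSchmidt T}

namespace HilbertSchmidt

/-- The underlying bounded operator. -/
def toOp (T : HilbertSchmidt H) : H →L[ℝ] H := T.1

instance : AddCommGroup (HilbertSchmidt H) :=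
  inferInstanceAs (AddCommGroup (hilbertSchmidtSubmodule H))

instance : Module ℝ (HilbertSchmidt H) :=
  inferInstanceAs (Module ℝ (hilbertSchmidtSubmodule H))

/-- `T ↦ (T b_i)_i` into the `ℓ²`-sum of copies of `H`; its norm is the Hilbert-Schmidt norm. -/
def toLp : HilbertSchmidt H →ₗ[ℝ] lp (fun _ : BasisIndex H => H) 2 where
  toFun T := ⟨fun i => T.1 (chosenBasis H i), (isHilbertSchmidt_iff_memℓp T.1).1 T.2⟩
  map_add' _ _ := rfl
  map_smul' _ _ := rfl

lemma toLp_injective : Function.Injective (toLp (H := H)) := by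
  intro S T h
  apply Subtype.ext
  refine ContinuousLinearMap.ext_on (s := Set.range (chosenBasis H)) ?_ ?_
  · have := (chosenBasis H).dense_span
    rwa [Submodule.dense_iff_topologicalClosure_eq_top]
  · rintro _ ⟨i, rfl⟩
    exact congrArg (fun f : lp (fun _ : BasisIndex H => H) 2 => f i) h

/-- The Hilbert-Schmidt norm `‖T‖ = (∑ i, ‖T b_i‖ ^ 2) ^ (1 / 2)`. -/
instance : NormedAddCommGroup (HilbertSchmidt H) :=
  NormedAddCommGroup.induced _ _ (toLp (H := H)) toLp_injective

instance : NormedSpace ℝ (HilbertSchmidt H) :=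
  NormedSpace.induced ℝ _ _ (toLp (H := H))

instance : MeasurableSpace (HilbertSchmidt H) := borel _

instance : BorelSpace (HilbertSchmidt H) := ⟨rfl⟩

lemma norm_sq_eq (T : HilbertSchmidt H) : ‖T‖ ^ 2 = ∑' i, ‖T.toOp (chosenBasis H i)‖ ^ 2 := by
  have h := lp.norm_rpow_eq_tsum (p := 2) (by norm_num) (toLp T)
  simp only [ENNReal.toReal_ofNat, Real.rpow_ofNat] at h
  exact h

end HilbertSchmidt

lemma enorm_sq_eq_ofReal {E : Type*} [NormedAddCommGroup E] (y : E) :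
    ‖y‖ₑ ^ 2 = ENNReal.ofReal (‖y‖ ^ 2) := by
  rw [← ofReal_norm, ENNReal.ofReal_pow (norm_nonneg _)]

lemma parseval_enorm {κ : Type*} (c : HilbertBasis κ ℝ H) (x : H) :
    ‖x‖ₑ ^ 2 = ∑' j, ‖⟪c j, x⟫_ℝ‖ₑ ^ 2 := by
  have h : HasSum (fun j => ‖⟪c j, x⟫_ℝ‖ ^ 2) (‖x‖ ^ 2) := by
    have h1 := c.hasSum_inner_mul_inner x x
    rw [real_inner_self_eq_norm_sq] at h1
    have h2 : (fun j => ‖⟪c j, x⟫_ℝ‖ ^ 2) = fun j => ⟪x, c j⟫_ℝ * ⟪c j, x⟫_ℝ := by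
      funext j
      rw [real_inner_comm (c j) x, Real.norm_eq_abs, sq_abs, sq]
    rw [h2]
    exact h1
  simp only [enorm_sq_eq_ofReal]
  rw [← h.tsum_eq, ENNReal.ofReal_tsum_of_nonneg (fun _ => by positivity) h.summable]

lemma tsum_enorm_sq_adjoint {ι κ : Type*} (b : HilbertBasis ι ℝ H) (c : HilbertBasis κ ℝ H)
    (T : H →L[ℝ] H) :
    ∑' i, ‖T (b i)‖ₑ ^ 2 = ∑' j, ‖(ContinuousLinearMap.adjoint T) (c j)‖ₑ ^ 2 := by
  simp only [fun i => parseval_enorm c (T (b i)),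
    fun j => parseval_enorm b ((ContinuousLinearMap.adjoint T) (c j))]
  rw [ENNReal.tsum_comm]
  refine tsum_congr fun j => tsum_congr fun i => ?_
  rw [ContinuousLinearMap.adjoint_inner_right, real_inner_comm]

lemma tsum_enorm_sq_basis {ι κ : Type*} (b : HilbertBasis ι ℝ H) (c : HilbertBasis κ ℝ H)
    (T : H →L[ℝ] H) : ∑' i, ‖T (b i)‖ₑ ^ 2 = ∑' j, ‖T (c j)‖ₑ ^ 2 := by
  rw [tsum_enorm_sq_adjoint b c, ← tsum_enorm_sq_adjoint c c]

lemma summable_norm_sq_iff {ι : Type*} (b : HilbertBasis ι ℝ H) (T : H →L[ℝ] H) :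
    (Summable fun i => ‖T (b i)‖ ^ 2) ↔ ∑' i, ‖T (b i)‖ₑ ^ 2 ≠ ∞ := by
  simp only [enorm_sq_eq_ofReal]
  refine ⟨fun h => ?_, fun h => ?_⟩
  · rw [← ENNReal.ofReal_tsum_of_nonneg (fun _ => by positivity) h]
    exact ENNReal.ofReal_ne_top
  · have h1 := ENNReal.summable_toReal h
    simpa [ENNReal.toReal_ofReal, sq_nonneg] using h1

/-- The Hilbert-Schmidt property does not depend on the basis. -/
lemma isHilbertSchmidt_iff {ι : Type*} (b : HilbertBasis ι ℝ H) (T : H →L[ℝ] H) :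
    IsHilbertSchmidt T ↔ Summable fun i => ‖T (b i)‖ ^ 2 := by
  unfold IsHilbertSchmidt
  rw [summable_norm_sq_iff, summable_norm_sq_iff, tsum_enorm_sq_basis (chosenBasis H) b]

/-- The Hilbert-Schmidt norm does not depend on the basis. -/
lemma HilbertSchmidt.norm_sq_eq_tsum {ι : Type*} (b : HilbertBasis ι ℝ H)
    (T : HilbertSchmidt H) : ‖T‖ ^ 2 = ∑' i, ‖T.toOp (b i)‖ ^ 2 := by
  rw [HilbertSchmidt.norm_sq_eq]
  have h0 : ∑' i, ‖T.toOp (chosenBasis H i)‖ ^ 2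
      = (∑' i, ‖T.toOp (chosenBasis H i)‖ₑ ^ 2).toReal := by
    rw [ENNReal.tsum_toReal_eq (fun i => by simp)]
    exact tsum_congr fun i => by simp
  have h1 : ∑' i, ‖T.toOp (b i)‖ ^ 2 = (∑' i, ‖T.toOp (b i)‖ₑ ^ 2).toReal := by
    rw [ENNReal.tsum_toReal_eq (fun i => by simp)]
    exact tsum_congr fun i => by simp
  rw [h0, h1, tsum_enorm_sq_basis (chosenBasis H) b]

end HilbertSchmidt

section Model

variable {H : Type*} [NormedAddCommGroup H] [InnerProductSpace ℝ H]

/-- `f ⊗ g = ⟨g, ·⟩ f`. -/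
abbrev tensor (f g : H) : H →L[ℝ] H := InnerProductSpace.rankOne ℝ f g

/-- The covariance operator `E[X ⊗ X]` of a (centered) random element `X` of `H`. -/
def covOp [CompleteSpace H] {Ω : Type*} [MeasurableSpace Ω] (P : Measure Ω) (X : Ω → H) :
    H →L[ℝ] H :=
  ∫ ω, tensor (X ω) (X ω) ∂P

/-- The empirical covariance operator `(1 / n) ∑ x_i ⊗ x_i` of `x_1, …, x_n`. -/
def empCov {n : ℕ} (x : Fin n → H) : H →L[ℝ] H :=
  (n : ℝ)⁻¹ • ∑ i, tensor (x i) (x i)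

/-- The empirical cross-covariance operator `(1 / n) ∑ y_i ⊗ x_i`. -/
def empCross {n : ℕ} (y x : Fin n → H) : H →L[ℝ] H :=
  (n : ℝ)⁻¹ • ∑ i, tensor (y i) (x i)

/-- `(μ_j, v_j)`, `j < k`, are the first `k` eigenelements of the compact positive self-adjoint
operator `T`: an orthonormal family of eigenvectors, whose eigenvalues are sorted in decreasing
order, and no eigenvalue of `T` on the orthogonal complement of the family exceeds any `μ_j`. -/
structure IsLeadingEigensystem (T : H →L[ℝ] H) {k : ℕ} (μ : Fin k → ℝ) (v : Fin k → H) :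
    Prop where
  orthonormal : Orthonormal ℝ v
  eigen : ∀ j, T (v j) = μ j • v j
  antitone : Antitone μ
  leading : ∀ x, (∀ i, ⟪v i, x⟫_ℝ = 0) → ∀ j, ⟪T x, x⟫_ℝ ≤ μ j * ‖x‖ ^ 2

/-- The spectral cut regularized inverse `∑_{j ≤ k} μ_j⁻¹ (v_j ⊗ v_j)`; a zero eigenvalue
contributes nothing. -/
def spectralCutInverse {k : ℕ} (μ : Fin k → ℝ) (v : Fin k → H) : H →L[ℝ] H :=
  ∑ j, (μ j)⁻¹ • tensor (v j) (v j)

/-- The estimator `Δ_n Γ_n^†` computed from the data `(y_i, x_i)` and from the first `k`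
eigenelements `(μ_j, v_j)` of the empirical covariance operator. -/
def estimator {n k : ℕ} (y x : Fin n → H) (μ : Fin k → ℝ) (v : Fin k → H) : H →L[ℝ] H :=
  empCross y x ∘L spectralCutInverse μ v

lemma isHilbertSchmidt_tensor [CompleteSpace H] (f g : H) : IsHilbertSchmidt (tensor f g) := by
  have h := (chosenBasis H).summable_inner_mul_inner g g
  refine (h.mul_right (‖f‖ ^ 2)).congr fun i => ?_
  rw [InnerProductSpace.rankOne_apply, norm_smul, mul_pow, Real.norm_eq_abs, sq_abs,
    real_inner_comm g, sq (inner ℝ _ _)]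

lemma isHilbertSchmidt_estimator [CompleteSpace H] {n k : ℕ} (y x : Fin n → H)
    (μ : Fin k → ℝ) (v : Fin k → H) : IsHilbertSchmidt (estimator y x μ v) := by
  have h : estimator y x μ v = ∑ j, (μ j)⁻¹ • tensor (empCross y x (v j)) (v j) := by
    ext z
    simp [estimator, spectralCutInverse]
  rw [h]
  exact (hilbertSchmidtSubmodule H).sum_mem fun j _ =>
    (hilbertSchmidtSubmodule H).smul_mem _ (isHilbertSchmidt_tensor _ _)

/-- The estimator as an element of the space of Hilbert-Schmidt operators. -/
def estimatorHS [CompleteSpace H] {n k : ℕ} (y x : Fin n → H) (μ : Fin k → ℝ) (v : Fin k → H) :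
    HilbertSchmidt H :=
  ⟨estimator y x μ v, isHilbertSchmidt_estimator y x μ v⟩

/-- The sequence `λ_1, λ_2, …` (here `lam 0, lam 1, …`) is interpolated by a positive continuous
function on `[0, ∞)` that is convex for large arguments. -/
def EventuallyConvex (lam : ℕ → ℝ) : Prop :=
  ∃ f : ℝ → ℝ, ContinuousOn f (Set.Ici 0) ∧ (∀ t, 0 ≤ t → 0 < f t) ∧
    (∀ j : ℕ, f ((j : ℝ) + 1) = lam j) ∧ ∃ t₀ : ℝ, ConvexOn ℝ (Set.Ici t₀) f

/-- Bernstein's moment condition, with one constant `b` for the whole sequence: for all `j` and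
all `l ≥ 2`, `E|ξ_j|^l ≤ (l! / 2) b^(l-2) E|ξ_j|²`, all these moments being finite. -/
def BernsteinMoments {Ω : Type*} [MeasurableSpace Ω] (P : Measure Ω) (ξ : ℕ → Ω → ℝ) : Prop :=
  ∃ b : ℝ, 0 < b ∧ ∀ j l : ℕ, 2 ≤ l →
    Integrable (fun ω => |ξ j ω| ^ l) P ∧
    ∫ ω, |ξ j ω| ^ l ∂P ≤ (l.factorial : ℝ) / 2 * b ^ (l - 2) * ∫ ω, |ξ j ω| ^ 2 ∂P

end Model

end FunctionalRegression

end

/-!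
Write `T = Γ_n` for the empirical covariance operator and `T†` for its spectral cut inverse, with
`k` retained eigenvalues. With `Y = S X + ε`, the estimator is
`Ŝ z = S (T T† z) + n⁻¹ ∑ ⟨x_i, T† z⟩ ε_i`. Two facts about it are incompatible with a non-degenerate limit.

**The error at each eigenvector is `O_P(1 / √n)`**
(`IsRegressionSample.boundedInProbability_error`). The bias at `e_j` is governed by
`e_j - T T† e_j`. The part of `T e_j` orthogonal to `e_j` is of size `1 / √n`, and the cut-off eigenvalue is at
most the trace divided by `k`, hence well below `λ_j`; this bounds the bias. For the noise it
suffices that `⟨T† e_j, e_j⟩` stays bounded. This comes from removing the direction `e_j` from the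
sample (`IsLeadingEigensystem.inner_spectralCutInverse_mul_le`): the coefficients `⟨x_i, e_j⟩` are
independent of the reduced sample, so the vector they form in `ℝⁿ` has only a small projection, of
relative squared size `k / n`, onto the `k` leading left singular vectors of the reduced sample. No
spacing of the eigenvalues is involved.

**The operator norm error is not `O_P(1 / √n)`, for any deterministic centering**
(`IsRegressionSample.not_boundedInProbability_norm`). Since `T† T` is the identity up to the cut,
`√n (Ŝ - C_n) T e_j`, tested against a fixed `y`, is a sum of three terms: a function of the
covariates alone, the normalized sum `n^{-1/2} ∑ ⟨x_i, e_j⟩ ⟨ε_i, y⟩`, of size `√λ_j`, and a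
negligible remainder. The second is asymptotically Gaussian and uncorrelated with every bounded
function of the covariates, so the first term cannot cancel it (`exists_le_measure_abs_add`). As
`‖T e_j‖` is of size `λ_j`, the operator norm of `√n (Ŝ - C_n)` exceeds a multiple of `1 / √λ_j`
with a probability bounded below independently of `j`, and `λ_j → 0`.

Let now `α_n (Ŝ - C_n)` converge in distribution. Convergence entails tightness, so the second fact
excludes that `|α_n| / √n` stays away from `0`. Along a subsequence `α_n / √n → 0`, and by the
first fact the matrix coefficients of `α_n (Ŝ - S)` tend to `0` in probability. The coefficients of
the limit are then limits in distribution of the deterministic coefficients of `α_n (S - C_n)`,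
hence almost surely constant, and zero if `C_n = S`. For the Hilbert-Schmidt norm it is enough that
the inclusion into the bounded operators is continuous and injective.
-/

namespace FunctionalRegression

/-! ### The empirical covariance operator and its leading eigenelements -/

section Spectral

variable {H : Type*} [NormedAddCommGroup H] [InnerProductSpace ℝ H] {n k : ℕ}

lemma empCov_apply (x : Fin n → H) (z : H) :
    empCov x z = (n : ℝ)⁻¹ • ∑ i, ⟪x i, z⟫_ℝ • x i := by
  simp [empCov]

lemma inner_empCov (x : Fin n → H) (z w : H) :
    ⟪empCov x z, w⟫_ℝ = (n : ℝ)⁻¹ * ∑ i, ⟪x i, z⟫_ℝ * ⟪x i, w⟫_ℝ := by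
  simp [empCov_apply, real_inner_smul_left, sum_inner]

lemma inner_empCov_comm (x : Fin n → H) (z w : H) :
    ⟪empCov x z, w⟫_ℝ = ⟪z, empCov x w⟫_ℝ := by
  rw [real_inner_comm _ z, inner_empCov, inner_empCov]
  simp only [mul_comm]

lemma inner_empCov_self (x : Fin n → H) (z : H) :
    ⟪empCov x z, z⟫_ℝ = (n : ℝ)⁻¹ * ∑ i, ⟪x i, z⟫_ℝ ^ 2 := by
  simp [inner_empCov, sq]

lemma spectralCutInverse_apply (μ : Fin k → ℝ) (v : Fin k → H) (z : H) :
    spectralCutInverse μ v z = ∑ j, ((μ j)⁻¹ * ⟪v j, z⟫_ℝ) • v j := by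
  simp [spectralCutInverse, smul_smul]

/-- With responses `s x_i + ε_i`, the estimator is the sum of `s T T†` and of a noise term that is
linear in the `ε_i`. -/
lemma estimator_apply (s : H →L[ℝ] H) (x ε : Fin n → H) (μ : Fin k → ℝ) (v : Fin k → H) (z : H) :
    estimator (fun i => s (x i) + ε i) x μ v z =
      s (empCov x (spectralCutInverse μ v z)) +
        (n : ℝ)⁻¹ • ∑ i, ⟪x i, spectralCutInverse μ v z⟫_ℝ • ε i := by
  simp [estimator, empCross, empCov_apply, map_sum, smul_add, Finset.sum_add_distrib]

namespace IsLeadingEigensystem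

variable {x : Fin n → H} {μ : Fin k → ℝ} {v : Fin k → H}

lemma eigenvalue_eq (h : IsLeadingEigensystem (empCov x) μ v) (j : Fin k) :
    μ j = (n : ℝ)⁻¹ * ∑ i, ⟪x i, v j⟫_ℝ ^ 2 := by
  rw [← inner_empCov_self, h.eigen, real_inner_smul_left, real_inner_self_eq_norm_sq,
    h.orthonormal.1]
  simp

lemma eigenvalue_nonneg (h : IsLeadingEigensystem (empCov x) μ v) (j : Fin k) : 0 ≤ μ j := by
  rw [h.eigenvalue_eq]; positivity

/-- The smallest of the `k` leading eigenvalues is at most `1 / k` times the trace. -/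
lemma mul_eigenvalue_le (h : IsLeadingEigensystem (empCov x) μ v) {l : Fin k}
    (hl : ∀ j, μ l ≤ μ j) : k * μ l ≤ (n : ℝ)⁻¹ * ∑ i, ‖x i‖ ^ 2 := by
  have h1 : (k : ℝ) * μ l ≤ ∑ j, μ j := by
    simpa using Finset.card_nsmul_le_sum Finset.univ μ (μ l) (fun j _ => hl j)
  refine h1.trans ?_
  simp_rw [h.eigenvalue_eq, ← Finset.mul_sum]
  rw [Finset.sum_comm]
  gcongr with i
  have := h.orthonormal.sum_inner_products_le (x i) (s := Finset.univ)
  simpa [real_inner_comm] using this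

lemma inner_spectralCutInverse (h : IsLeadingEigensystem (empCov x) μ v) (j : Fin k) (z : H) :
    ⟪v j, spectralCutInverse μ v z⟫_ℝ = (μ j)⁻¹ * ⟪v j, z⟫_ℝ := by
  rw [spectralCutInverse_apply, h.orthonormal.inner_right_fintype]

lemma empCov_spectralCutInverse (h : IsLeadingEigensystem (empCov x) μ v) (z : H) :
    empCov x (spectralCutInverse μ v z) = ∑ j, ((μ j)⁻¹ * μ j * ⟪v j, z⟫_ℝ) • v j := by
  rw [spectralCutInverse_apply, map_sum]
  refine Finset.sum_congr rfl fun j _ => ?_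
  rw [map_smul, h.eigen, smul_smul]
  ring_nf

/-- `T†` and `T` commute. -/
lemma spectralCutInverse_empCov (h : IsLeadingEigensystem (empCov x) μ v) (z : H) :
    spectralCutInverse μ v (empCov x z) = empCov x (spectralCutInverse μ v z) := by
  rw [h.empCov_spectralCutInverse, spectralCutInverse_apply]
  refine Finset.sum_congr rfl fun j _ => ?_
  rw [← inner_empCov_comm, h.eigen, real_inner_smul_left]
  ring_nf

lemma inner_empCov_spectralCutInverse (h : IsLeadingEigensystem (empCov x) μ v) (j : Fin k)
    (z : H) :
    ⟪v j, empCov x (spectralCutInverse μ v z)⟫_ℝ = (μ j)⁻¹ * μ j * ⟪v j, z⟫_ℝ := by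
  rw [h.empCov_spectralCutInverse, h.orthonormal.inner_right_fintype]

lemma inner_spectralCutInverse_self (h : IsLeadingEigensystem (empCov x) μ v) (z : H) :
    ⟪empCov x (spectralCutInverse μ v z), spectralCutInverse μ v z⟫_ℝ =
      ⟪spectralCutInverse μ v z, z⟫_ℝ := by
  rw [h.empCov_spectralCutInverse, sum_inner, spectralCutInverse_apply, sum_inner]
  refine Finset.sum_congr rfl fun j _ => ?_
  rw [real_inner_smul_left, real_inner_smul_left, ← spectralCutInverse_apply,
    h.inner_spectralCutInverse]
  rcases eq_or_ne (μ j) 0 with h0 | h0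
  · simp [h0]
  · field_simp

/-- On the range of `T†` the operator `T` is bounded below by its smallest leading eigenvalue. -/
lemma eigenvalue_mul_norm_sq_le (h : IsLeadingEigensystem (empCov x) μ v) {l : Fin k}
    (hl : ∀ j, μ l ≤ μ j) (z : H) :
    μ l * ‖spectralCutInverse μ v z‖ ^ 2 ≤
      ⟪empCov x (spectralCutInverse μ v z), spectralCutInverse μ v z⟫_ℝ := by
  have h1 : ‖spectralCutInverse μ v z‖ ^ 2 = ∑ j, ((μ j)⁻¹ * ⟪v j, z⟫_ℝ) ^ 2 := by
    rw [← real_inner_self_eq_norm_sq]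
    conv_lhs => rw [spectralCutInverse_apply, h.orthonormal.inner_sum]
    simp [sq]
  rw [h1, h.empCov_spectralCutInverse, sum_inner, Finset.mul_sum]
  refine Finset.sum_le_sum fun j _ => ?_
  rw [real_inner_smul_left, h.inner_spectralCutInverse]
  have h2 : (μ j)⁻¹ * μ j * ⟪v j, z⟫_ℝ * ((μ j)⁻¹ * ⟪v j, z⟫_ℝ) =
      μ j * ((μ j)⁻¹ * ⟪v j, z⟫_ℝ) ^ 2 := by ring
  rw [h2]
  exact mul_le_mul_of_nonneg_right (hl j) (sq_nonneg _)

/-- The Rayleigh quotient is at most the smallest leading eigenvalue on vectors orthogonal to the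
eigenvectors of the larger ones. -/
lemma inner_empCov_self_le (h : IsLeadingEigensystem (empCov x) μ v) {l : Fin k} {z : H}
    (hz : ∀ j, μ j ≠ μ l → ⟪v j, z⟫_ℝ = 0) : ⟪empCov x z, z⟫_ℝ ≤ μ l * ‖z‖ ^ 2 := by
  set p := ∑ j, ⟪v j, z⟫_ℝ • v j with hp
  set r := z - p with hr
  have hzpr : z = p + r := by simp [hr]
  have hvr : ∀ j, ⟪v j, r⟫_ℝ = 0 := fun j => by
    rw [hr, inner_sub_right, hp, h.orthonormal.inner_right_fintype, sub_self]
  have hTp : empCov x p = μ l • p := by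
    rw [hp, map_sum, Finset.smul_sum]
    refine Finset.sum_congr rfl fun j _ => ?_
    rw [map_smul, h.eigen, smul_comm]
    by_cases hj : μ j = μ l
    · rw [hj]
    · simp [hz j hj]
  have hpr : ⟪p, r⟫_ℝ = 0 := by
    rw [hp, sum_inner]
    exact Finset.sum_eq_zero fun j _ => by rw [real_inner_smul_left, hvr, mul_zero]
  have hn : ‖z‖ ^ 2 = ‖p‖ ^ 2 + ‖r‖ ^ 2 := by
    rw [hzpr, norm_add_sq_real, hpr]; ring
  have hTrp : ⟪empCov x r, p⟫_ℝ = 0 := by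
    rw [inner_empCov_comm, hTp, real_inner_smul_right, real_inner_comm, hpr, mul_zero]
  have h1 : ⟪empCov x z, z⟫_ℝ = μ l * ‖p‖ ^ 2 + ⟪empCov x r, r⟫_ℝ := by
    rw [hzpr, map_add, inner_add_left, inner_add_right, inner_add_right, hTp, hTrp,
      real_inner_smul_left, real_inner_smul_left, hpr, real_inner_self_eq_norm_sq]
    ring
  rw [h1, hn, mul_add]
  gcongr
  exact h.leading r hvr l

/-- The residual `z - T T† z` is orthogonal to the eigenvectors that are inverted, so that `T` is
small on it. -/
lemma inner_empCov_residual_le (h : IsLeadingEigensystem (empCov x) μ v) {l : Fin k}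
    (hl : ∀ j, μ l ≤ μ j) (z : H) :
    ⟪empCov x (z - empCov x (spectralCutInverse μ v z)),
      z - empCov x (spectralCutInverse μ v z)⟫_ℝ ≤
        μ l * ‖z - empCov x (spectralCutInverse μ v z)‖ ^ 2 := by
  refine h.inner_empCov_self_le fun j hj => ?_
  rw [inner_sub_right, h.inner_empCov_spectralCutInverse]
  rcases eq_or_ne (μ j) 0 with h0 | h0
  · exact absurd (le_antisymm (h0 ▸ h.eigenvalue_nonneg l) (hl j)) (fun h' => hj h')
  · simp [h0]

/-- `T T†` is an orthogonal projection. -/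
lemma inner_residual (h : IsLeadingEigensystem (empCov x) μ v) (z : H) :
    ⟪empCov x (spectralCutInverse μ v z), z - empCov x (spectralCutInverse μ v z)⟫_ℝ = 0 := by
  conv_lhs => rw [h.empCov_spectralCutInverse z, sum_inner]
  refine Finset.sum_eq_zero fun j _ => ?_
  rw [real_inner_smul_left, ← h.empCov_spectralCutInverse, inner_sub_right,
    h.inner_empCov_spectralCutInverse]
  rcases eq_or_ne (μ j) 0 with h0 | h0
  · simp [h0]
  · simp [h0]

lemma inner_empCov_residual (h : IsLeadingEigensystem (empCov x) μ v) (z : H) :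
    ⟪empCov x (empCov x (spectralCutInverse μ v z)),
      z - empCov x (spectralCutInverse μ v z)⟫_ℝ = 0 := by
  conv_lhs => rw [h.empCov_spectralCutInverse z, map_sum, sum_inner]
  refine Finset.sum_eq_zero fun j _ => ?_
  rw [map_smul, h.eigen, real_inner_smul_left, real_inner_smul_left,
    ← h.empCov_spectralCutInverse, inner_sub_right,
    h.inner_empCov_spectralCutInverse]
  rcases eq_or_ne (μ j) 0 with h0 | h0
  · simp [h0]
  · simp [h0]

lemma norm_sq_residual (h : IsLeadingEigensystem (empCov x) μ v) (z : H) :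
    ‖z - empCov x (spectralCutInverse μ v z)‖ ^ 2 =
      ⟪z, z - empCov x (spectralCutInverse μ v z)⟫_ℝ := by
  rw [← real_inner_self_eq_norm_sq]
  conv_lhs => rw [inner_sub_left, h.inner_residual, sub_zero]

lemma norm_residual_le (h : IsLeadingEigensystem (empCov x) μ v) (z : H) :
    ‖z - empCov x (spectralCutInverse μ v z)‖ ≤ ‖z‖ := by
  have h1 := h.norm_sq_residual z
  have h2 := real_inner_le_norm z (z - empCov x (spectralCutInverse μ v z))
  by_contra hc
  push Not at hc
  nlinarith [norm_nonneg z]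

/-- If `T e = c e + q`, the residual of `e` is small as soon as `q` is small and the cut-off
eigenvalue is well below `c`. -/
lemma mul_norm_residual_le (h : IsLeadingEigensystem (empCov x) μ v) {l : Fin k}
    (hl : ∀ j, μ l ≤ μ j) {z q : H} {c : ℝ} (hq : empCov x z = c • z + q) :
    (c - μ l) * ‖z - empCov x (spectralCutInverse μ v z)‖ ≤ ‖q‖ := by
  set w := z - empCov x (spectralCutInverse μ v z) with hw
  have h1 : ⟪empCov x w, w⟫_ℝ = c * ‖w‖ ^ 2 + ⟪q, w⟫_ℝ := by
    conv_lhs => rw [hw, map_sub, inner_sub_left, h.inner_empCov_residual, sub_zero, ← hw, hq,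
      inner_add_left, real_inner_smul_left]
    rw [hw, h.norm_sq_residual]
  have h2 := h.inner_empCov_residual_le hl z
  rw [← hw, h1] at h2
  have h3 := neg_le_of_abs_le (abs_real_inner_le_norm q w)
  rcases (norm_nonneg w).eq_or_lt with h0 | h0
  · rw [← h0]; simp
  · by_contra hc
    push Not at hc
    nlinarith

end IsLeadingEigensystem

end Spectral

/-! ### Removing one direction from the sample -/

section LeaveOneOut

variable {H : Type*} [NormedAddCommGroup H] [InnerProductSpace ℝ H] {n k : ℕ}

/-- The sample `x` with its component along `e` removed; meant for unit vectors `e`. -/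
def removeDirection (e : H) (x : Fin n → H) : Fin n → H := fun i => x i - ⟪x i, e⟫_ℝ • e

lemma inner_removeDirection_self {e : H} (he : ‖e‖ = 1) (x : Fin n → H) (i : Fin n) :
    ⟪removeDirection e x i, e⟫_ℝ = 0 := by
  simp [removeDirection, inner_sub_left, real_inner_smul_left, he]

lemma inner_removeDirection (e : H) (x : Fin n → H) (i : Fin n) (z : H) :
    ⟪removeDirection e x i, z⟫_ℝ = ⟪x i, z⟫_ℝ - ⟪x i, e⟫_ℝ * ⟪e, z⟫_ℝ := by
  simp [removeDirection, inner_sub_left, real_inner_smul_left]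

lemma norm_removeDirection_le {e : H} (he : ‖e‖ = 1) (x : Fin n → H) (i : Fin n) :
    ‖removeDirection e x i‖ ≤ ‖x i‖ := by
  have h1 : ‖removeDirection e x i‖ ^ 2 = ‖x i‖ ^ 2 - ⟪x i, e⟫_ℝ ^ 2 := by
    rw [← real_inner_self_eq_norm_sq, inner_removeDirection, real_inner_comm _ (x i),
      real_inner_comm _ e, inner_removeDirection_self he, inner_removeDirection,
      real_inner_self_eq_norm_sq, real_inner_comm (x i) e]
    ring
  refine le_of_sq_le_sq ?_ (norm_nonneg _)
  nlinarith [sq_nonneg ⟪x i, e⟫_ℝ]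

lemma empCov_eq_add_removeDirection {e : H} (x : Fin n → H) :
    empCov x e = ((n : ℝ)⁻¹ * ∑ i, ⟪x i, e⟫_ℝ ^ 2) • e +
      (n : ℝ)⁻¹ • ∑ i, ⟪x i, e⟫_ℝ • removeDirection e x i := by
  simp only [empCov_apply, removeDirection, smul_sub, smul_smul, Finset.sum_sub_distrib,
    ← Finset.sum_smul, ← sq]
  module

/-- Removing a direction from the sample does not increase the `k`-th eigenvalue of the empirical
covariance operator: this is the min-max principle. -/
lemma IsLeadingEigensystem.removeDirection_eigenvalue_le {e : H} (he : ‖e‖ = 1) {x : Fin n → H}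
    {μ μ' : Fin k → ℝ} {v v' : Fin k → H} (h : IsLeadingEigensystem (empCov x) μ v)
    (h' : IsLeadingEigensystem (empCov (removeDirection e x)) μ' v') {l : Fin k}
    (hl' : ∀ j, μ' l ≤ μ' j) : μ' l ≤ μ l := by
  rcases (h'.eigenvalue_nonneg l).eq_or_lt with h0 | h0
  · rw [← h0]; exact h.eigenvalue_nonneg l
  -- a nonzero vector of the span of `v'` orthogonal to all `v j` with `j ≠ l`
  let φ : (Fin k → ℝ) →ₗ[ℝ] ({j : Fin k // j ≠ l} → ℝ) :=
    LinearMap.pi fun j => ∑ i, ⟪v j, v' i⟫_ℝ • LinearMap.proj i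
  have hφ : LinearMap.ker φ ≠ ⊥ := by
    apply LinearMap.ker_ne_bot_of_finrank_lt
    simp only [Module.finrank_fintype_fun_eq_card]
    exact Fintype.card_subtype_lt (x := l) (by simp)
  obtain ⟨c, hc, hc0⟩ := (Submodule.ne_bot_iff _).1 hφ
  set z := ∑ i, c i • v' i with hz
  have hvz : ∀ j, j ≠ l → ⟪v j, z⟫_ℝ = 0 := fun j hj => by
    have := congrFun (LinearMap.mem_ker.1 hc) ⟨j, hj⟩
    rw [hz, inner_sum]
    simpa [φ, real_inner_smul_right, mul_comm] using this
  have hve : ∀ i, ⟪v' i, e⟫_ℝ = 0 := fun i => by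
    have h1 : ⟪empCov (removeDirection e x) (v' i), e⟫_ℝ = 0 := by
      simp [inner_empCov, inner_removeDirection_self he]
    rw [h'.eigen, real_inner_smul_left] at h1
    exact (mul_eq_zero.1 h1).resolve_left (h0.trans_le (hl' i)).ne'
  have hze : ⟪e, z⟫_ℝ = 0 := by
    rw [hz, inner_sum]
    exact Finset.sum_eq_zero fun i _ => by
      rw [real_inner_smul_right, real_inner_comm, hve, mul_zero]
  have hTz : ⟪empCov x z, z⟫_ℝ = ⟪empCov (removeDirection e x) z, z⟫_ℝ := by
    simp [inner_empCov_self, inner_removeDirection, hze]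
  have hnz : ‖z‖ ^ 2 = ∑ i, c i ^ 2 := by
    rw [← real_inner_self_eq_norm_sq, hz, h'.orthonormal.inner_sum]
    simp [sq]
  have hpos : 0 < ‖z‖ ^ 2 := by
    obtain ⟨i, hi⟩ := Function.ne_iff.1 hc0
    rw [hnz]
    exact Finset.sum_pos' (fun i _ => sq_nonneg _) ⟨i, Finset.mem_univ _, by
      have : c i ≠ 0 := hi
      positivity⟩
  have hlow : μ' l * ‖z‖ ^ 2 ≤ ⟪empCov (removeDirection e x) z, z⟫_ℝ := by
    have h1 : empCov (removeDirection e x) z = ∑ i, (μ' i * c i) • v' i := by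
      rw [hz, map_sum]
      exact Finset.sum_congr rfl fun i _ => by rw [map_smul, h'.eigen, smul_smul, mul_comm]
    rw [h1, hz, h'.orthonormal.inner_sum, ← hz, hnz, Finset.mul_sum]
    refine Finset.sum_le_sum fun i _ => ?_
    simp only [conj_trivial]
    rw [mul_assoc, ← sq]
    exact mul_le_mul_of_nonneg_right (hl' i) (sq_nonneg _)
  have hup : ⟪empCov x z, z⟫_ℝ ≤ μ l * ‖z‖ ^ 2 :=
    h.inner_empCov_self_le fun j hj => hvz j fun hjl => hj (by rw [hjl])
  rw [hTz] at hup
  exact le_of_mul_le_mul_right (hlow.trans hup) hpos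

/-- The coefficient sequences `(⟨x_i, v_l⟩ / √(n μ_l))_i`: the left singular vectors of the sample,
orthonormal in `ℝⁿ` apart from those with `μ_l = 0`, which vanish. -/
noncomputable def leftSingular (x : Fin n → H) (μ : Fin k → ℝ) (v : Fin k → H)
    (l : Fin k) (i : Fin n) : ℝ :=
  (√(n * μ l))⁻¹ * ⟪x i, v l⟫_ℝ

lemma IsLeadingEigensystem.sum_leftSingular_mul {x : Fin n → H} {μ : Fin k → ℝ} {v : Fin k → H}
    (h : IsLeadingEigensystem (empCov x) μ v) (hn : n ≠ 0) (l m : Fin k) (hlm : l ≠ m) :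
    ∑ i, leftSingular x μ v l i * leftSingular x μ v m i = 0 := by
  have h1 : ⟪empCov x (v l), v m⟫_ℝ = 0 := by
    rw [h.eigen, real_inner_smul_left, h.orthonormal.2 hlm, mul_zero]
  rw [inner_empCov] at h1
  have h2 := (mul_eq_zero.1 h1).resolve_left (by positivity)
  calc ∑ i, leftSingular x μ v l i * leftSingular x μ v m i
      = (√(n * μ l))⁻¹ * (√(n * μ m))⁻¹ * ∑ i, ⟪x i, v l⟫_ℝ * ⟪x i, v m⟫_ℝ := by
        rw [Finset.mul_sum]
        exact Finset.sum_congr rfl fun i _ => by unfold leftSingular; ring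
    _ = 0 := by rw [h2, mul_zero]

lemma IsLeadingEigensystem.sum_inner_sq {x : Fin n → H} {μ : Fin k → ℝ} {v : Fin k → H}
    (h : IsLeadingEigensystem (empCov x) μ v) (hn : n ≠ 0) (l : Fin k) :
    ∑ i, ⟪x i, v l⟫_ℝ ^ 2 = n * μ l := by
  rw [h.eigenvalue_eq]
  field_simp

lemma IsLeadingEigensystem.sum_leftSingular_sq {x : Fin n → H} {μ : Fin k → ℝ} {v : Fin k → H}
    (h : IsLeadingEigensystem (empCov x) μ v) (hn : n ≠ 0) (l : Fin k) (hl : μ l ≠ 0) :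
    ∑ i, leftSingular x μ v l i ^ 2 = 1 := by
  simp only [leftSingular, mul_pow, ← Finset.mul_sum, h.sum_inner_sq hn]
  have h0 := h.eigenvalue_nonneg l
  rw [inv_pow, Real.sq_sqrt (by positivity)]
  field_simp

lemma IsLeadingEigensystem.sum_leftSingular_sq_le {x : Fin n → H} {μ : Fin k → ℝ} {v : Fin k → H}
    (h : IsLeadingEigensystem (empCov x) μ v) (hn : n ≠ 0) (l : Fin k) :
    ∑ i, leftSingular x μ v l i ^ 2 ≤ 1 := by
  rcases eq_or_ne (μ l) 0 with hl | hl
  · simp [leftSingular, hl]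
  · exact (h.sum_leftSingular_sq hn l hl).le

lemma IsLeadingEigensystem.inner_eq_leftSingular {x : Fin n → H} {μ : Fin k → ℝ} {v : Fin k → H}
    (h : IsLeadingEigensystem (empCov x) μ v) (hn : n ≠ 0) (l : Fin k) (i : Fin n) :
    ⟪x i, v l⟫_ℝ = √(n * μ l) * leftSingular x μ v l i := by
  rcases eq_or_ne (μ l) 0 with hl | hl
  · have h1 := h.sum_inner_sq hn l
    rw [hl, mul_zero, Finset.sum_eq_zero_iff_of_nonneg fun _ _ => sq_nonneg _] at h1
    simpa [hl] using h1 i (Finset.mem_univ _)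
  · have h0 : 0 < μ l := lt_of_le_of_ne (h.eigenvalue_nonneg l) hl.symm
    have : √(n * μ l) ≠ 0 := by positivity
    rw [leftSingular, mul_inv_cancel_left₀ this]

/-- The leave-one-direction-out bound. The coefficient vector `a = (⟨x_i, e⟩)_i` is compared with
the left singular vectors of the sample from which the direction `e` has been removed. If `a` has
a large component orthogonal to them, then `⟨T† e, e⟩` is bounded, however small the cut-off
eigenvalue may be. -/
lemma IsLeadingEigensystem.inner_spectralCutInverse_mul_le {e : H} (he : ‖e‖ = 1)
    {x : Fin n → H} (hn : n ≠ 0) {μ μ' : Fin k → ℝ} {v v' : Fin k → H}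
    (h : IsLeadingEigensystem (empCov x) μ v)
    (h' : IsLeadingEigensystem (empCov (removeDirection e x)) μ' v') {l : Fin k}
    (hl : ∀ j, μ l ≤ μ j) (hl' : ∀ j, μ' l ≤ μ' j) :
    ⟪spectralCutInverse μ v e, e⟫_ℝ * (∑ i, ⟪x i, e⟫_ℝ ^ 2 -
      ∑ m, (∑ i, ⟪x i, e⟫_ℝ * leftSingular (removeDirection e x) μ' v' m i) ^ 2) ≤ 4 * n := by
  set x' := removeDirection e x with hx'
  set y := spectralCutInverse μ v e with hy
  let a : EuclideanSpace ℝ (Fin n) := WithLp.toLp 2 fun i => ⟪x i, e⟫_ℝ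
  let b : EuclideanSpace ℝ (Fin n) := WithLp.toLp 2 fun i => ⟪x i, y⟫_ℝ
  let U : Fin k → EuclideanSpace ℝ (Fin n) := fun m => WithLp.toLp 2 (leftSingular x' μ' v' m)
  let a₂ := a - ∑ m, ⟪U m, a⟫_ℝ • U m
  set r := y - ∑ m, ⟪v' m, y⟫_ℝ • v' m with hr
  let c : EuclideanSpace ℝ (Fin n) := WithLp.toLp 2 fun i => ⟪x' i, r⟫_ℝ
  have hinner : ∀ f g : Fin n → ℝ,
      ⟪(WithLp.toLp 2 f : EuclideanSpace ℝ (Fin n)), WithLp.toLp 2 g⟫_ℝ = ∑ i, f i * g i :=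
    fun f g => by simp [PiLp.inner_apply, mul_comm]
  have hUU : ∀ m m', m ≠ m' → ⟪U m, U m'⟫_ℝ = 0 := fun m m' hm => by
    rw [hinner]; exact h'.sum_leftSingular_mul hn m m' hm
  have hU : ∀ m, U m = 0 ∨ ⟪U m, U m⟫_ℝ = 1 := fun m => by
    rcases eq_or_ne (μ' m) 0 with h0 | h0
    · left
      ext i
      simp [U, leftSingular, h0]
    · right
      rw [hinner, ← h'.sum_leftSingular_sq hn m h0]
      simp only [sq]
  have hUa₂ : ∀ m, ⟪a₂, U m⟫_ℝ = 0 := fun m => by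
    have h1 : ⟪∑ m', ⟪U m', a⟫_ℝ • U m', U m⟫_ℝ = ⟪U m, a⟫_ℝ * ⟪U m, U m⟫_ℝ := by
      rw [sum_inner, Finset.sum_eq_single m]
      · rw [real_inner_smul_left]
      · intro m' _ hm
        rw [real_inner_smul_left, hUU m' m hm, mul_zero]
      · simp
    rw [inner_sub_left, h1]
    rcases hU m with h0 | h0
    · simp [h0]
    · rw [h0, real_inner_comm]; ring
  have ha₂a : ⟪a₂, a⟫_ℝ = ‖a₂‖ ^ 2 := by
    have : a = a₂ + ∑ m, ⟪U m, a⟫_ℝ • U m := by simp [a₂]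
    conv_lhs => rw [this]
    rw [inner_add_right, inner_sum, real_inner_self_eq_norm_sq]
    simp [real_inner_smul_right, hUa₂]
  have hD : ‖a₂‖ ^ 2 = ∑ i, ⟪x i, e⟫_ℝ ^ 2 -
      ∑ m, (∑ i, ⟪x i, e⟫_ℝ * leftSingular x' μ' v' m i) ^ 2 := by
    rw [← ha₂a, inner_sub_left, sum_inner, hinner]
    congr 1
    · simp only [sq]
    · refine Finset.sum_congr rfl fun m _ => ?_
      rw [real_inner_smul_left, ← sq, real_inner_comm, hinner]
  have hb : ‖b‖ ^ 2 = n * ⟪y, e⟫_ℝ := by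
    rw [← h.inner_spectralCutInverse_self e, ← hy, inner_empCov_self, ← real_inner_self_eq_norm_sq,
      hinner]
    field_simp
  -- `‖c‖` is controlled by the eigenvalue of the reduced sample, hence by `‖b‖`
  have hcb : ‖c‖ ≤ ‖b‖ := by
    have hvr : ∀ m, ⟪v' m, r⟫_ℝ = 0 := fun m => by
      rw [hr, inner_sub_right, h'.orthonormal.inner_right_fintype, sub_self]
    have hry : ‖r‖ ^ 2 ≤ ‖y‖ ^ 2 := by
      have h1 : ⟪∑ m, ⟪v' m, y⟫_ℝ • v' m, r⟫_ℝ = 0 := by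
        rw [sum_inner]
        exact Finset.sum_eq_zero fun m _ => by rw [real_inner_smul_left, hvr, mul_zero]
      have h2 : y = (∑ m, ⟪v' m, y⟫_ℝ • v' m) + r := by simp [hr]
      conv_rhs => rw [h2, norm_add_sq_real, h1]
      nlinarith [sq_nonneg ‖∑ m, ⟪v' m, y⟫_ℝ • v' m‖]
    have h1 : ‖c‖ ^ 2 = n * ⟪empCov x' r, r⟫_ℝ := by
      rw [inner_empCov_self, ← real_inner_self_eq_norm_sq, hinner]
      field_simp
    have h2 : ‖b‖ ^ 2 = n * ⟪empCov x y, y⟫_ℝ := by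
      rw [hb, hy, h.inner_spectralCutInverse_self e]
    refine le_of_sq_le_sq ?_ (norm_nonneg _)
    rw [h1, h2]
    gcongr
    calc ⟪empCov x' r, r⟫_ℝ ≤ μ' l * ‖r‖ ^ 2 := h'.leading r hvr l
      _ ≤ μ l * ‖y‖ ^ 2 := by
        have := h.removeDirection_eigenvalue_le he h' hl'
        have := h.eigenvalue_nonneg l
        gcongr
      _ ≤ _ := h.eigenvalue_mul_norm_sq_le hl e
  -- `b` splits along `y = ⟨e, y⟩ e + (y - ⟨e, y⟩ e)`, the second part being seen by `x'` only
  have hba : b = ⟪e, y⟫_ℝ • a + (c + ∑ m, (⟪v' m, y⟫_ℝ * √(n * μ' m)) • U m) := by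
    ext i
    have h1 : ⟪x' i, y⟫_ℝ = ⟪x' i, r⟫_ℝ + ∑ m, ⟪v' m, y⟫_ℝ * ⟪x' i, v' m⟫_ℝ := by
      rw [hr, inner_sub_right, inner_sum]
      simp [real_inner_smul_right]
    have h2 : ⟪x i, y⟫_ℝ = ⟪e, y⟫_ℝ * ⟪x i, e⟫_ℝ + ⟪x' i, y⟫_ℝ := by
      rw [hx', inner_removeDirection]; ring
    simp only [b, a, c, U, PiLp.add_apply, PiLp.smul_apply, smul_eq_mul, WithLp.ofLp_sum,
      Finset.sum_apply, h2, h1]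
    congr 2
    refine Finset.sum_congr rfl fun m _ => ?_
    rw [h'.inner_eq_leftSingular hn]
    simp [mul_assoc]
  -- `a₂` is orthogonal to the `U m`, so that testing `hba` against it isolates `⟨e, y⟩`
  have hkey : ⟪e, y⟫_ℝ * ‖a₂‖ ^ 2 = ⟪a₂, b⟫_ℝ - ⟪a₂, c⟫_ℝ := by
    rw [hba, inner_add_right, inner_add_right, inner_sum, real_inner_smul_right, ha₂a]
    simp [real_inner_smul_right, hUa₂]
  have h1 := (abs_le.1 (abs_real_inner_le_norm a₂ b)).2
  have h2 := (abs_le.1 (abs_real_inner_le_norm a₂ c)).1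
  have h3 : ‖a₂‖ * ‖c‖ ≤ ‖a₂‖ * ‖b‖ := by gcongr
  rw [← hD]
  have hn' : (0 : ℝ) < n := by positivity
  have h4 : (‖a₂‖ * ‖b‖) ^ 2 ≤ 2 * n * (‖a₂‖ * ‖b‖) := by
    have : (‖a₂‖ * ‖b‖) ^ 2 = n * (⟪e, y⟫_ℝ * ‖a₂‖ ^ 2) := by
      rw [mul_pow, hb, real_inner_comm]; ring
    rw [this]
    nlinarith
  have h5 : ‖a₂‖ * ‖b‖ ≤ 2 * n := by
    by_contra hc
    push Not at hc
    nlinarith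
  have h6 : (n : ℝ) * (⟪y, e⟫_ℝ * ‖a₂‖ ^ 2) ≤ n * (4 * n) := by
    have : (n : ℝ) * (⟪y, e⟫_ℝ * ‖a₂‖ ^ 2) = (‖a₂‖ * ‖b‖) ^ 2 := by
      rw [mul_pow, hb]; ring
    rw [this]
    nlinarith [mul_nonneg (norm_nonneg a₂) (norm_nonneg b)]
  exact le_of_mul_le_mul_left h6 hn'

end LeaveOneOut

/-! ### Second moments of random linear combinations -/

section Moments

variable {Ω : Type*} [MeasurableSpace Ω] {P : Measure Ω} [IsProbabilityMeasure P]

/-- Redrawing one coordinate of an i.i.d. family from the common law does not change the law of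
the family. -/
lemma measurePreserving_update {ι α : Type*} [Fintype ι] [DecidableEq ι] [MeasurableSpace α]
    (ν : Measure α) [IsProbabilityMeasure ν] (i : ι) :
    MeasurePreserving (fun p : α × (ι → α) => Function.update p.2 i p.1)
      (ν.prod (Measure.pi fun _ => ν)) (Measure.pi fun _ => ν) := by
  have hm : Measurable (fun p : α × (ι → α) => Function.update p.2 i p.1) := by
    refine measurable_pi_lambda _ fun l => ?_
    by_cases hl : l = i
    · subst hl; simpa using measurable_fst
    · simp only [Function.update_of_ne hl]
      exact (measurable_pi_apply l).comp measurable_snd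
  refine ⟨hm, (Measure.pi_eq fun s hs => ?_).symm⟩
  rw [Measure.map_apply hm (.univ_pi hs)]
  have : (fun p : α × (ι → α) => Function.update p.2 i p.1) ⁻¹' (Set.univ.pi s) =
      s i ×ˢ Set.univ.pi (Function.update s i Set.univ) := by
    ext p
    simp only [Set.mem_preimage, Set.mem_univ_pi, Set.mem_prod]
    constructor
    · intro h
      refine ⟨by simpa using h i, fun l => ?_⟩
      by_cases hl : l = i
      · subst hl; simp
      · simpa [Function.update_of_ne hl] using h l
    · rintro ⟨h1, h2⟩ l
      by_cases hl : l = i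
      · subst hl; simpa using h1
      · simpa [Function.update_of_ne hl] using h2 l
  rw [this, Measure.prod_prod, Measure.pi_pi,
    ← Finset.mul_prod_erase _ (fun l => ν (s l)) (Finset.mem_univ i),
    ← Finset.mul_prod_erase _ (fun l => ν (Function.update s i Set.univ l)) (Finset.mem_univ i)]
  simp only [Function.update_self, measure_univ, one_mul]
  congr 1
  refine Finset.prod_congr rfl fun l hl => ?_
  rw [Function.update_of_ne (Finset.ne_of_mem_erase hl)]

/-- The second moment of a linear combination with random coefficients `A i` that are centered and
uncorrelated, and independent of the vectors `B i` that they multiply. -/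
lemma lintegral_norm_sum_smul_sq {n : ℕ} {β E : Type*} [MeasurableSpace β]
    [NormedAddCommGroup E] [InnerProductSpace ℝ E] [MeasurableSpace E] [BorelSpace E]
    [SecondCountableTopology E] {A : Ω → Fin n → ℝ} {X : Ω → β} (hA : Measurable A)
    (hX : Measurable X) (hAX : IndepFun A X P) (hA2 : ∀ i, MemLp (fun ω => A ω i) 2 P) {c : ℝ}
    (hcov : ∀ i m, ∫ ω, A ω i * A ω m ∂P = if i = m then c else 0)
    {B : β → Fin n → E} (hB : Measurable B) :
    ∫⁻ ω, ENNReal.ofReal (‖∑ i, A ω i • B (X ω) i‖ ^ 2) ∂P =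
      ∫⁻ ω, ENNReal.ofReal (c * ∑ i, ‖B (X ω) i‖ ^ 2) ∂P := by
  have hfix : ∀ b : Fin n → E, ∫⁻ ω, ENNReal.ofReal (‖∑ i, A ω i • b i‖ ^ 2) ∂P =
      ENNReal.ofReal (c * ∑ i, ‖b i‖ ^ 2) := by
    intro b
    have hexp : ∀ ω, ‖∑ i, A ω i • b i‖ ^ 2 = ∑ i, ∑ m, (A ω i * A ω m) * ⟪b i, b m⟫_ℝ := by
      intro ω
      rw [← real_inner_self_eq_norm_sq, sum_inner]
      refine Finset.sum_congr rfl fun i _ => ?_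
      rw [inner_sum]
      refine Finset.sum_congr rfl fun m _ => ?_
      rw [real_inner_smul_left, real_inner_smul_right]
      ring
    have hint : ∀ i m, Integrable (fun ω => (A ω i * A ω m) * ⟪b i, b m⟫_ℝ) P :=
      fun i m => ((hA2 i).integrable_mul (hA2 m)).mul_const _
    rw [← ofReal_integral_eq_lintegral_ofReal]
    · congr 1
      simp_rw [hexp]
      rw [integral_finsetSum _ fun i _ => integrable_finsetSum _ fun m _ => hint i m,
        Finset.mul_sum]
      refine Finset.sum_congr rfl fun i _ => ?_
      rw [integral_finsetSum _ fun m _ => hint i m]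
      simp_rw [integral_mul_const, hcov]
      simp
    · simp_rw [hexp]
      exact integrable_finsetSum _ fun i _ => integrable_finsetSum _ fun m _ => hint i m
    · exact Eventually.of_forall fun ω => by positivity
  have hmeas : Measurable fun p : (Fin n → ℝ) × β =>
      ENNReal.ofReal (‖∑ i, p.1 i • B p.2 i‖ ^ 2) := by
    have hB' : ∀ i, Measurable fun x => B x i := fun i => (measurable_pi_apply i).comp hB
    have : Measurable fun p : (Fin n → ℝ) × β => ∑ i, p.1 i • B p.2 i :=
      Finset.measurable_sum _ fun i _ =>
        ((measurable_pi_apply i).comp measurable_fst).smul ((hB' i).comp measurable_snd)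
    exact (this.norm.pow_const 2).ennreal_ofReal
  have hmeas' : Measurable fun x : β => ENNReal.ofReal (c * ∑ i, ‖B x i‖ ^ 2) := by
    have hB' : ∀ i, Measurable fun x => B x i := fun i => (measurable_pi_apply i).comp hB
    exact ((Finset.measurable_sum _ fun i _ => (hB' i).norm.pow_const 2).const_mul c).ennreal_ofReal
  have hlaw := (indepFun_iff_map_prod_eq_prod_map_map hA.aemeasurable hX.aemeasurable).1 hAX
  have : IsProbabilityMeasure (P.map A) := Measure.isProbabilityMeasure_map hA.aemeasurable
  have : IsProbabilityMeasure (P.map X) := Measure.isProbabilityMeasure_map hX.aemeasurable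
  calc ∫⁻ ω, ENNReal.ofReal (‖∑ i, A ω i • B (X ω) i‖ ^ 2) ∂P
      = ∫⁻ p, ENNReal.ofReal (‖∑ i, p.1 i • B p.2 i‖ ^ 2) ∂(P.map fun ω => (A ω, X ω)) := by
        rw [lintegral_map hmeas (hA.prodMk hX)]
    _ = ∫⁻ x, ∫⁻ a, ENNReal.ofReal (‖∑ i, a i • B x i‖ ^ 2) ∂(P.map A) ∂(P.map X) := by
        rw [hlaw, lintegral_prod_symm _ hmeas.aemeasurable]
    _ = ∫⁻ x, ENNReal.ofReal (c * ∑ i, ‖B x i‖ ^ 2) ∂(P.map X) := by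
        refine lintegral_congr fun x => ?_
        have hx : Measurable fun a : Fin n → ℝ => ∑ i, a i • B x i :=
          Finset.measurable_sum _ fun i _ => (measurable_pi_apply i).smul_const _
        exact (lintegral_map (hx.norm.pow_const 2).ennreal_ofReal hA).trans (hfix _)
    _ = _ := by rw [lintegral_map hmeas' hX]

end Moments

/-! ### Conditionally centered, homoscedastic noise -/

section Noise

variable {H : Type*} [NormedAddCommGroup H] [InnerProductSpace ℝ H] [CompleteSpace H]
  [MeasurableSpace H] [BorelSpace H] [SecondCountableTopology H]
  {Ω : Type*} [MeasurableSpace Ω] {P : Measure Ω} [IsProbabilityMeasure P]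

/-- A conditionally centered noise is uncorrelated with the functions of the covariate. There is
no integrability hypothesis: the integral of a function that is not integrable is `0`. -/
lemma integral_mul_inner_noise {X ε : Ω → H} (hX : Measurable X) (hε : MemLp ε 2 P)
    (hε0 : P[ε | MeasurableSpace.comap X inferInstance] =ᵐ[P] 0) (y : H) {g : H → ℝ}
    (hg : Measurable g) : ∫ ω, g (X ω) * ⟪ε ω, y⟫_ℝ ∂P = 0 := by
  have hm : MeasurableSpace.comap X inferInstance ≤ (inferInstance : MeasurableSpace Ω) :=
    hX.comap_le
  have hεi : Integrable ε P := hε.integrable (by norm_num)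
  have hηi : Integrable (fun ω => ⟪ε ω, y⟫_ℝ) P := hεi.inner_const y
  have hη0 : (0 : Ω → ℝ) =ᵐ[P]
      P[fun ω => ⟪ε ω, y⟫_ℝ | MeasurableSpace.comap X inferInstance] := by
    refine ae_eq_condExp_of_forall_setIntegral_eq hm hηi
      (fun s _ _ => (integrable_zero Ω ℝ P).integrableOn) (fun s hs _ => ?_)
      (stronglyMeasurable_const (b := (0 : ℝ))).aestronglyMeasurable
    have h1 : ∫ ω in s, ε ω ∂P = 0 := by
      rw [← setIntegral_condExp hm hεi hs, integral_eq_zero_of_ae]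
      exact ae_restrict_of_ae hε0
    have h2 : ∫ ω in s, ⟪ε ω, y⟫_ℝ ∂P = ⟪y, ∫ ω in s, ε ω ∂P⟫_ℝ := by
      rw [← integral_inner hεi.integrableOn]
      simp_rw [real_inner_comm y]
    rw [h2, h1]
    simp
  by_cases hi : Integrable (fun ω => g (X ω) * ⟪ε ω, y⟫_ℝ) P
  · have hgm : StronglyMeasurable[MeasurableSpace.comap X inferInstance] (fun ω => g (X ω)) :=
      (hg.comp (comap_measurable X)).stronglyMeasurable
    have h1 := condExp_mul_of_stronglyMeasurable_left (μ := P) hgm hi hηi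
    rw [← integral_condExp hm, integral_eq_zero_of_ae]
    refine h1.trans ?_
    filter_upwards [hη0] with ω hω
    simp [← hω]
  · exact integral_undef hi

/-- A homoscedastic noise: integrating a function of the covariate against the squared noise is
integrating it against the variance of the noise. -/
lemma lintegral_mul_inner_noise_sq {X ε : Ω → H} (hX : Measurable X) (hεm : Measurable ε)
    (hε : MemLp ε 2 P) (y : H)
    (hεvar : P[fun ω => ⟪ε ω, y⟫_ℝ ^ 2 | MeasurableSpace.comap X inferInstance] =ᵐ[P]
      fun _ => ∫ ω, ⟪ε ω, y⟫_ℝ ^ 2 ∂P) {g : H → ℝ≥0∞} (hg : Measurable g) :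
    ∫⁻ ω, g (X ω) * ENNReal.ofReal (⟪ε ω, y⟫_ℝ ^ 2) ∂P =
      ENNReal.ofReal (∫ ω, ⟪ε ω, y⟫_ℝ ^ 2 ∂P) * ∫⁻ ω, g (X ω) ∂P := by
  have hm : MeasurableSpace.comap X inferInstance ≤ (inferInstance : MeasurableSpace Ω) :=
    hX.comap_le
  have hηi : Integrable (fun ω => ⟪ε ω, y⟫_ℝ ^ 2) P := (hε.inner_const y).integrable_sq
  have hηm : Measurable fun ω => ENNReal.ofReal (⟪ε ω, y⟫_ℝ ^ 2) :=
    ((hεm.inner_const (c := y)).pow_const 2).ennreal_ofReal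
  have hmeas : (P.withDensity fun ω => ENNReal.ofReal (⟪ε ω, y⟫_ℝ ^ 2)).map X =
      ENNReal.ofReal (∫ ω, ⟪ε ω, y⟫_ℝ ^ 2 ∂P) • P.map X := by
    ext s hs
    have h1 : ∫ ω in X ⁻¹' s, ⟪ε ω, y⟫_ℝ ^ 2 ∂P =
        (∫ ω, ⟪ε ω, y⟫_ℝ ^ 2 ∂P) * P.real (X ⁻¹' s) := by
      rw [← setIntegral_condExp hm hηi ⟨s, hs, rfl⟩,
        setIntegral_congr_ae (hX hs) (hεvar.mono fun ω hω _ => hω)]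
      simp [mul_comm]
    rw [Measure.map_apply hX hs, withDensity_apply _ (hX hs), Measure.smul_apply,
      Measure.map_apply hX hs, smul_eq_mul,
      ← ofReal_integral_eq_lintegral_ofReal hηi.integrableOn
        (Eventually.of_forall fun ω => sq_nonneg _), h1,
      ENNReal.ofReal_mul (integral_nonneg fun ω => sq_nonneg _), ofReal_measureReal]
  have hgX : Measurable fun ω => g (X ω) := hg.comp hX
  rw [← lintegral_map hg hX, ← smul_eq_mul, ← lintegral_smul_measure, ← hmeas,
    lintegral_map hg hX, lintegral_withDensity_eq_lintegral_mul _ hηm hgX]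
  refine lintegral_congr fun ω => ?_
  simp [mul_comm]

end Noise

section ProductNoise

variable {α β : Type*} [MeasurableSpace α] [MeasurableSpace β] {ν : Measure α}
  [IsProbabilityMeasure ν] {X : α → β} {ζ : α → ℝ} {n : ℕ}

lemma measurable_sample (hX : Measurable X) :
    Measurable fun (u : Fin n → α) (l : Fin n) => X (u l) :=
  measurable_pi_lambda _ fun l => hX.comp (measurable_pi_apply l)

/-- In an i.i.d. sample, a noise that is uncorrelated with the functions of its own covariate is
uncorrelated with the functions of all covariates and of the other noises. -/
lemma integral_pi_mul_noise (hX : Measurable X) (hζ : Measurable ζ)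
    (h1 : ∀ g : β → ℝ, Measurable g → ∫ a, g (X a) * ζ a ∂ν = 0) (i : Fin n)
    {F : (Fin n → β) → ℝ} (hF : Measurable F) {G : (Fin n → α) → ℝ} (hG : Measurable G)
    (hGi : ∀ u a, G (Function.update u i a) = G u) :
    ∫ u, G u * F (fun l => X (u l)) * ζ (u i) ∂(Measure.pi fun _ : Fin n => ν) = 0 := by
  have hfm : Measurable fun u : Fin n → α => G u * F (fun l => X (u l)) * ζ (u i) :=
    (hG.mul (hF.comp (measurable_sample hX))).mul (hζ.comp (measurable_pi_apply i))
  by_cases hi : Integrable (fun u : Fin n → α => G u * F (fun l => X (u l)) * ζ (u i))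
    (Measure.pi fun _ : Fin n => ν)
  · have hmp := measurePreserving_update ν i
    have hi' : Integrable (fun p : α × (Fin n → α) => G (Function.update p.2 i p.1) *
        F (fun l => X (Function.update p.2 i p.1 l)) * ζ (Function.update p.2 i p.1 i))
        (ν.prod (Measure.pi fun _ => ν)) := hmp.integrable_comp_of_integrable hi
    rw [← hmp.map_eq, integral_map hmp.measurable.aemeasurable hfm.aestronglyMeasurable,
      integral_prod_symm _ hi']
    refine integral_eq_zero_of_ae (Eventually.of_forall fun v => ?_)
    have h2 : ∀ a : α, (fun l => X (Function.update v i a l)) =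
        Function.update (fun l => X (v l)) i (X a) := fun a => by
      ext l
      by_cases hl : l = i
      · subst hl; simp
      · simp [Function.update_of_ne hl]
    simp only [h2, hGi, Function.update_self, mul_assoc, integral_const_mul, Pi.zero_apply]
    rw [h1 (fun b => F (Function.update (fun l => X (v l)) i b))
      (hF.comp (measurable_update _)), mul_zero]
  · exact integral_undef hi

lemma lintegral_pi_mul_noise_sq (hX : Measurable X) (hζ : Measurable ζ) {c : ℝ}
    (h2 : ∀ g : β → ℝ≥0∞, Measurable g →
      ∫⁻ a, g (X a) * ENNReal.ofReal (ζ a ^ 2) ∂ν = ENNReal.ofReal c * ∫⁻ a, g (X a) ∂ν)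
    (i : Fin n) {F : (Fin n → β) → ℝ≥0∞} (hF : Measurable F) :
    ∫⁻ u, F (fun l => X (u l)) * ENNReal.ofReal (ζ (u i) ^ 2) ∂(Measure.pi fun _ : Fin n => ν) =
      ENNReal.ofReal c * ∫⁻ u, F (fun l => X (u l)) ∂(Measure.pi fun _ : Fin n => ν) := by
  have hF1 : Measurable fun u : Fin n → α => F (fun l => X (u l)) :=
    hF.comp (measurable_sample hX)
  have hfm : Measurable fun u : Fin n → α =>
      F (fun l => X (u l)) * ENNReal.ofReal (ζ (u i) ^ 2) :=
    hF1.mul ((hζ.comp (measurable_pi_apply i)).pow_const 2).ennreal_ofReal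
  have hmp := measurePreserving_update (ι := Fin n) ν i
  have key : ∀ v : Fin n → α, ∀ a : α, (fun l => X (Function.update v i a l)) =
      Function.update (fun l => X (v l)) i (X a) := fun v a => by
    ext l
    by_cases hl : l = i
    · subst hl; simp
    · simp [Function.update_of_ne hl]
  have hfm' : Measurable fun p : α × (Fin n → α) =>
      F (fun l => X (Function.update p.2 i p.1 l)) *
        ENNReal.ofReal (ζ (Function.update p.2 i p.1 i) ^ 2) := hfm.comp hmp.measurable
  have hF1' : Measurable fun p : α × (Fin n → α) =>
      F (fun l => X (Function.update p.2 i p.1 l)) := hF1.comp hmp.measurable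
  rw [← hmp.map_eq, lintegral_map hfm hmp.measurable, lintegral_map hF1 hmp.measurable,
    lintegral_prod_symm _ hfm'.aemeasurable, lintegral_prod_symm _ hF1'.aemeasurable,
    ← lintegral_const_mul _ hF1'.lintegral_prod_left']
  refine lintegral_congr fun v => ?_
  simp only [key, Function.update_self]
  exact h2 (fun b => F (Function.update (fun l => X (v l)) i b)) (hF.comp (measurable_update _))

/-- The second moment of a linear combination of the noises whose coefficients are functions of the
covariates. -/
lemma integral_pi_sum_mul_noise_sq (hX : Measurable X) (hζ : Measurable ζ) {c : ℝ} (hc : 0 ≤ c)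
    (h1 : ∀ g : β → ℝ, Measurable g → ∫ a, g (X a) * ζ a ∂ν = 0)
    (h2 : ∀ g : β → ℝ≥0∞, Measurable g →
      ∫⁻ a, g (X a) * ENNReal.ofReal (ζ a ^ 2) ∂ν = ENNReal.ofReal c * ∫⁻ a, g (X a) ∂ν)
    {F : Fin n → (Fin n → β) → ℝ} (hF : ∀ i, Measurable (F i))
    (hF2 : ∀ i, MemLp (fun u => F i fun l => X (u l)) 2 (Measure.pi fun _ : Fin n => ν)) :
    MemLp (fun u => ∑ i, F i (fun l => X (u l)) * ζ (u i)) 2 (Measure.pi fun _ : Fin n => ν) ∧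
    ∫ u, (∑ i, F i (fun l => X (u l)) * ζ (u i)) ^ 2 ∂(Measure.pi fun _ : Fin n => ν) =
      c * ∑ i, ∫ u, F i (fun l => X (u l)) ^ 2 ∂(Measure.pi fun _ : Fin n => ν) := by
  have hm : ∀ i, Measurable fun u : Fin n → α => F i (fun l => X (u l)) * ζ (u i) :=
    fun i => ((hF i).comp (measurable_sample hX)).mul (hζ.comp (measurable_pi_apply i))
  have hlin : ∀ i, ∫⁻ u, ENNReal.ofReal ((F i (fun l => X (u l)) * ζ (u i)) ^ 2)
      ∂(Measure.pi fun _ : Fin n => ν) = ENNReal.ofReal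
        (c * ∫ u, F i (fun l => X (u l)) ^ 2 ∂(Measure.pi fun _ : Fin n => ν)) := fun i => by
    rw [ENNReal.ofReal_mul hc, ofReal_integral_eq_lintegral_ofReal (hF2 i).integrable_sq
      (Eventually.of_forall fun _ => sq_nonneg _),
      ← lintegral_pi_mul_noise_sq hX hζ h2 i
        (F := fun x => ENNReal.ofReal (F i x ^ 2)) ((hF i).pow_const 2).ennreal_ofReal]
    refine lintegral_congr fun u => ?_
    rw [mul_pow, ENNReal.ofReal_mul (sq_nonneg _)]
  have hint : ∀ i, Integrable (fun u : Fin n → α => (F i (fun l => X (u l)) * ζ (u i)) ^ 2)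
      (Measure.pi fun _ : Fin n => ν) := fun i => by
    refine ⟨((hm i).pow_const 2).aestronglyMeasurable, ?_⟩
    rw [hasFiniteIntegral_iff_ofReal (Eventually.of_forall fun _ => sq_nonneg _), hlin]
    exact ENNReal.ofReal_lt_top
  have hL : ∀ i, MemLp (fun u : Fin n → α => F i (fun l => X (u l)) * ζ (u i)) 2
      (Measure.pi fun _ : Fin n => ν) := fun i =>
    (memLp_two_iff_integrable_sq (hm i).aestronglyMeasurable).2 (hint i)
  have hsq : ∀ i, ∫ u, (F i (fun l => X (u l)) * ζ (u i)) ^ 2 ∂(Measure.pi fun _ : Fin n => ν) =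
      c * ∫ u, F i (fun l => X (u l)) ^ 2 ∂(Measure.pi fun _ : Fin n => ν) := fun i => by
    have h3 := hlin i
    rw [← ofReal_integral_eq_lintegral_ofReal (hint i)
      (Eventually.of_forall fun _ => sq_nonneg _)] at h3
    exact (ENNReal.ofReal_eq_ofReal_iff (integral_nonneg fun _ => sq_nonneg _)
      (mul_nonneg hc (integral_nonneg fun _ => sq_nonneg _))).1 h3
  have hcross : ∀ i m, i ≠ m → ∫ u, (F i (fun l => X (u l)) * ζ (u i)) *
      (F m (fun l => X (u l)) * ζ (u m)) ∂(Measure.pi fun _ : Fin n => ν) = 0 := by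
    intro i m him
    have h3 := integral_pi_mul_noise hX hζ h1 i (F := fun x => F i x * F m x)
      ((hF i).mul (hF m)) (G := fun u => ζ (u m)) (hζ.comp (measurable_pi_apply m))
      (fun u a => by rw [Function.update_of_ne him.symm])
    rw [← h3]
    refine integral_congr_ae (Eventually.of_forall fun u => ?_)
    ring
  have hprod : ∀ i m, Integrable (fun u : Fin n → α => F i (fun l => X (u l)) * ζ (u i) *
      (F m (fun l => X (u l)) * ζ (u m))) (Measure.pi fun _ : Fin n => ν) :=
    fun i m => (hL i).integrable_mul (hL m)
  refine ⟨memLp_finsetSum _ fun i _ => hL i, ?_⟩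
  simp_rw [sq (∑ i, _), Finset.sum_mul_sum]
  rw [integral_finsetSum _ fun i _ => integrable_finsetSum _ fun m _ =>
    hprod i m, Finset.mul_sum]
  refine Finset.sum_congr rfl fun i _ => ?_
  rw [integral_finsetSum _ fun m _ => hprod i m, Finset.sum_eq_single i]
  · rw [← hsq]
    simp only [sq]
  · intro m _ hm'
    exact hcross i m hm'.symm
  · simp

end ProductNoise

/-! ### Independence of the coefficients and of the remainder -/

section Independence

variable {Ω : Type*} [MeasurableSpace Ω] {P : Measure Ω} [IsProbabilityMeasure P]

/-- If the pairs `(f i, g i)` are independent and within each pair the components are independent,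
then the families `f` and `g` are independent. -/
lemma indepFun_pi_of_iIndepFun_prodMk {ι α β : Type*} [Fintype ι] [MeasurableSpace α]
    [MeasurableSpace β] {f : ι → Ω → α} {g : ι → Ω → β} (hf : ∀ i, Measurable (f i))
    (hg : ∀ i, Measurable (g i)) (h : iIndepFun (fun i ω => (f i ω, g i ω)) P)
    (hfg : ∀ i, IndepFun (f i) (g i) P) :
    IndepFun (fun ω i => f i ω) (fun ω i => g i ω) P := by
  have hfm : Measurable fun ω i => f i ω := measurable_pi_lambda _ hf
  have hgm : Measurable fun ω i => g i ω := measurable_pi_lambda _ hg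
  have hpf : ∀ i, IsProbabilityMeasure (P.map (f i)) := fun i =>
    Measure.isProbabilityMeasure_map (hf i).aemeasurable
  have hpg : ∀ i, IsProbabilityMeasure (P.map (g i)) := fun i =>
    Measure.isProbabilityMeasure_map (hg i).aemeasurable
  have h1 := (iIndepFun_iff_map_fun_eq_pi_map fun i => (hf i).aemeasurable).1
    (h.comp (fun _ => Prod.fst) fun _ => measurable_fst)
  have h2 := (iIndepFun_iff_map_fun_eq_pi_map fun i => (hg i).aemeasurable).1
    (h.comp (fun _ => Prod.snd) fun _ => measurable_snd)
  have h3 := (iIndepFun_iff_map_fun_eq_pi_map fun i => ((hf i).prodMk (hg i)).aemeasurable).1 h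
  rw [indepFun_iff_map_prod_eq_prod_map_map hfm.aemeasurable hgm.aemeasurable, h1, h2,
    ← (measurePreserving_arrowProdEquivProdArrow α β ι (fun i => P.map (f i))
      (fun i => P.map (g i))).map_eq]
  have h4 : (fun i => (P.map (f i)).prod (P.map (g i))) =
      fun i => P.map fun ω => (f i ω, g i ω) := by
    ext1 i
    exact ((indepFun_iff_map_prod_eq_prod_map_map (hf i).aemeasurable
      (hg i).aemeasurable).1 (hfg i)).symm
  rw [h4, ← h3, Measure.map_map (MeasurableEquiv.measurable _)
    (measurable_pi_lambda _ fun i => (hf i).prodMk (hg i))]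
  rfl

end Independence

/-! ### The regression sample -/

section Sample

variable {H : Type*} [NormedAddCommGroup H] [InnerProductSpace ℝ H] [CompleteSpace H]

lemma secondCountableTopology_of_hilbertBasis (e : HilbertBasis ℕ ℝ H) :
    SecondCountableTopology H := by
  have h1 : TopologicalSpace.IsSeparable (Set.range e) :=
    (Set.countable_range e).isSeparable
  have h2 : TopologicalSpace.IsSeparable (Submodule.span ℝ (Set.range e) : Set H) := h1.span
  have h3 : TopologicalSpace.IsSeparable (Set.univ : Set H) := by
    have := h2.closure
    rwa [← Submodule.topologicalClosure_coe, e.dense_span, Submodule.top_coe] at this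
  have : TopologicalSpace.SeparableSpace H := TopologicalSpace.isSeparable_univ_iff.1 h3
  exact UniformSpace.secondCountable_of_separable H

variable [MeasurableSpace H] [BorelSpace H] {Ω : Type*} [MeasurableSpace Ω]

/-- The standing assumptions on the covariates `X i` and the noises `ε i` that the argument uses:
an i.i.d. sample, a centered square integrable covariate whose coefficients in the eigenbasis `e`
of its covariance operator are independent, and a square integrable, conditionally centered,
homoscedastic noise. -/
structure IsRegressionSample (P : Measure Ω) (X ε : ℕ → Ω → H) (lam : ℕ → ℝ)
    (e : HilbertBasis ℕ ℝ H) : Prop where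
  measurable_X : ∀ i, Measurable (X i)
  measurable_ε : ∀ i, Measurable (ε i)
  indep : iIndepFun (fun i ω => (X i ω, ε i ω)) P
  ident : ∀ i, IdentDistrib (fun ω => (X i ω, ε i ω)) (fun ω => (X 0 ω, ε 0 ω)) P P
  memLp_X : MemLp (X 0) 2 P
  integral_X : ∫ ω, X 0 ω ∂P = 0
  eigen : ∀ j, covOp P (X 0) (e j) = lam j • e j
  lam_pos : ∀ j, 0 < lam j
  indep_coord : iIndepFun (fun (j : ℕ) ω => ⟪X 0 ω, e j⟫_ℝ / √(lam j)) P
  memLp_ε : MemLp (ε 0) 2 P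
  condExp_ε : P[ε 0 | MeasurableSpace.comap (X 0) inferInstance] =ᵐ[P] 0
  condExp_ε_sq : ∀ y : H,
    P[fun ω => ⟪ε 0 ω, y⟫_ℝ ^ 2 | MeasurableSpace.comap (X 0) inferInstance]
      =ᵐ[P] fun _ => ∫ ω, ⟪ε 0 ω, y⟫_ℝ ^ 2 ∂P

namespace IsRegressionSample

variable {P : Measure Ω} [IsProbabilityMeasure P] {X ε : ℕ → Ω → H} {lam : ℕ → ℝ}
  {e : HilbertBasis ℕ ℝ H}

lemma identDistrib_X (h : IsRegressionSample P X ε lam e) (i : ℕ) :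
    IdentDistrib (X i) (X 0) P P := (h.ident i).comp measurable_fst

lemma iIndepFun_X (h : IsRegressionSample P X ε lam e) : iIndepFun X P :=
  h.indep.comp (fun _ => Prod.fst) fun _ => measurable_fst

lemma integral_coord (h : IsRegressionSample P X ε lam e) (j : ℕ) :
    ∫ ω, ⟪X 0 ω, e j⟫_ℝ ∂P = 0 := by
  have h1 := integral_inner (𝕜 := ℝ) (h.memLp_X.integrable (by norm_num)) (e j)
  simp_rw [real_inner_comm (e j)]
  rw [h1, h.integral_X, inner_zero_right]

lemma integral_coord_sq (h : IsRegressionSample P X ε lam e) (j : ℕ) :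
    ∫ ω, ⟪X 0 ω, e j⟫_ℝ ^ 2 ∂P = lam j := by
  have hint : Integrable (fun ω => tensor (X 0 ω) (X 0 ω)) P := by
    have := secondCountableTopology_of_hilbertBasis e
    have hc : Continuous fun x : H => tensor x x :=
      (InnerProductSpace.rankOne ℝ (E := H) (F := H)).continuous.clm_apply continuous_id
    refine (h.memLp_X.integrable_norm_pow (p := 2) (by norm_num)).mono'
      (hc.comp_aestronglyMeasurable (h.measurable_X 0).aestronglyMeasurable) ?_
    refine Eventually.of_forall fun ω => ?_
    simp [sq]
  have h1 : ⟪covOp P (X 0) (e j), e j⟫_ℝ = lam j := by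
    rw [h.eigen, real_inner_smul_left, real_inner_self_eq_norm_sq, e.orthonormal.1]
    simp
  have h2 : covOp P (X 0) (e j) = ∫ ω, tensor (X 0 ω) (X 0 ω) (e j) ∂P := by
    rw [covOp, ContinuousLinearMap.integral_apply hint]
  have h3 : Integrable (fun ω => tensor (X 0 ω) (X 0 ω) (e j)) P :=
    ContinuousLinearMap.integrable_comp (ContinuousLinearMap.apply ℝ H (e j)) hint
  rw [← h1, h2, real_inner_comm, ← integral_inner h3]
  refine integral_congr_ae (Eventually.of_forall fun ω => ?_)
  simp [real_inner_smul_right, real_inner_comm, sq]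

lemma memLp_coord (h : IsRegressionSample P X ε lam e) (i j : ℕ) :
    MemLp (fun ω => ⟪X i ω, e j⟫_ℝ) 2 P :=
  ((h.identDistrib_X i).memLp_iff.2 h.memLp_X).inner_const (e j)

/-- The `j`-th coefficient of the covariate is independent of the remainder of the covariate. -/
lemma indepFun_coord_remainder (h : IsRegressionSample P X ε lam e) (j : ℕ) :
    IndepFun (fun ω => ⟪X 0 ω, e j⟫_ℝ) (fun ω => X 0 ω - ⟪X 0 ω, e j⟫_ℝ • e j) P := by
  have := secondCountableTopology_of_hilbertBasis e
  have hcoord : iIndepFun (fun (l : ℕ) ω => ⟪X 0 ω, e l⟫_ℝ) P := by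
    have h1 := h.indep_coord.comp (fun l t => √(lam l) * t) fun l => measurable_const_mul _
    convert h1 using 2 with l
    ext ω
    have : √(lam l) ≠ 0 := (Real.sqrt_pos.2 (h.lam_pos l)).ne'
    simp only [Function.comp_apply]
    field_simp
  have hcm : ∀ l, Measurable fun ω => ⟪X 0 ω, e l⟫_ℝ :=
    fun l => (h.measurable_X 0).inner_const
  rw [iIndepFun_iff_iIndep] at hcoord
  have h2 := indep_iSup_of_disjoint (fun l => (hcm l).comap_le) hcoord
    (S := {j}) (T := {j}ᶜ) (by simp)
  rw [IndepFun_iff_Indep]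
  refine indep_of_indep_of_le_left (indep_of_indep_of_le_right h2 ?_) ?_
  · rw [← measurable_iff_comap_le]
    -- the remainder is the limit of the partial sums of its expansion
    have hlim : Tendsto (fun N ω => ∑ l ∈ Finset.range N,
        (if l = j then 0 else ⟪X 0 ω, e l⟫_ℝ) • e l) atTop
        (𝓝 fun ω => X 0 ω - ⟪X 0 ω, e j⟫_ℝ • e j) := by
      rw [tendsto_pi_nhds]
      intro ω
      have h3 := (e.hasSum_repr (X 0 ω - ⟪X 0 ω, e j⟫_ℝ • e j)).tendsto_sum_nat
      refine h3.congr fun N => Finset.sum_congr rfl fun l _ => ?_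
      rw [e.repr_apply_apply, inner_sub_right, real_inner_smul_right]
      by_cases hl : l = j
      · subst hl
        simp [real_inner_comm, e.orthonormal.1]
      · simp [hl, e.orthonormal.2 hl, real_inner_comm]
    refine @measurable_of_tendsto_metrizable Ω H (_) _ _ _ _ _ _ (fun N => ?_) hlim
    refine Finset.measurable_sum _ fun l _ => ?_
    refine Measurable.smul_const ?_ _
    by_cases hl : l = j
    · simpa only [hl, if_true] using measurable_const
    · simp only [hl, if_false]
      refine Measurable.mono (comap_measurable (fun ω => ⟪X 0 ω, e l⟫_ℝ)) ?_ le_rfl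
      exact le_iSup₂_of_le l hl le_rfl
  · exact le_iSup₂_of_le j rfl le_rfl

lemma measurable_removeDirection (z : H) {n : ℕ} [SecondCountableTopology H] :
    Measurable fun x : Fin n → H => removeDirection z x := by
  refine measurable_pi_lambda _ fun i => ?_
  have hi : Measurable fun x : Fin n → H => x i := measurable_pi_apply i
  exact hi.sub ((hi.inner_const).smul_const z)

/-- The `j`-th coefficients of the sample are independent of the sample from which the `j`-th
direction has been removed. -/
lemma indepFun_coord_removeDirection (h : IsRegressionSample P X ε lam e) (j n : ℕ) :
    IndepFun (fun ω (i : Fin n) => ⟪X i ω, e j⟫_ℝ)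
      (fun ω => removeDirection (e j) fun i : Fin n => X i ω) P := by
  have := secondCountableTopology_of_hilbertBasis e
  have hf : Measurable fun x : H => ⟪x, e j⟫_ℝ := measurable_id.inner_const
  have hg : Measurable fun x : H => x - ⟪x, e j⟫_ℝ • e j := measurable_id.sub (hf.smul_const _)
  have h1 : iIndepFun (fun (i : Fin n) ω =>
      (⟪X i ω, e j⟫_ℝ, X i ω - ⟪X i ω, e j⟫_ℝ • e j)) P :=
    (h.iIndepFun_X.precomp Fin.val_injective).comp
      (fun _ x => (⟪x, e j⟫_ℝ, x - ⟪x, e j⟫_ℝ • e j)) fun _ => hf.prodMk hg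
  refine indepFun_pi_of_iIndepFun_prodMk (fun i => hf.comp (h.measurable_X i))
    (fun i => hg.comp (h.measurable_X i)) h1 fun i => ?_
  have h2 := h.indepFun_coord_remainder j
  have hfX : ∀ l, Measurable fun ω => ⟪X l ω, e j⟫_ℝ := fun l => hf.comp (h.measurable_X l)
  have hgX : ∀ l, Measurable fun ω => X l ω - ⟪X l ω, e j⟫_ℝ • e j :=
    fun l => hg.comp (h.measurable_X l)
  change IndepFun (fun ω => ⟪X i ω, e j⟫_ℝ) (fun ω => X i ω - ⟪X i ω, e j⟫_ℝ • e j) P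
  rw [indepFun_iff_map_prod_eq_prod_map_map (hfX _).aemeasurable (hgX _).aemeasurable] at h2 ⊢
  have h3 := ((h.identDistrib_X i).comp (hf.prodMk hg)).map_eq
  have h4 := ((h.identDistrib_X i).comp hf).map_eq
  have h5 := ((h.identDistrib_X i).comp hg).map_eq
  simp only [Function.comp_def] at h3 h4 h5 h2 ⊢
  rw [h3, h2, h4, h5]

lemma integral_coord_mul_coord (h : IsRegressionSample P X ε lam e) (j : ℕ) (i m : ℕ) :
    ∫ ω, ⟪X i ω, e j⟫_ℝ * ⟪X m ω, e j⟫_ℝ ∂P = if i = m then lam j else 0 := by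
  have hf : Measurable fun x : H => ⟪x, e j⟫_ℝ := by
    have := secondCountableTopology_of_hilbertBasis e
    exact measurable_id.inner_const
  have hf2 : Measurable fun x : H => ⟪x, e j⟫_ℝ ^ 2 := hf.pow_const 2
  split_ifs with him
  · subst him
    rw [← h.integral_coord_sq j]
    simp_rw [← sq]
    exact ((h.identDistrib_X i).comp hf2).integral_eq
  · have h1 : IndepFun (fun ω => ⟪X i ω, e j⟫_ℝ) (fun ω => ⟪X m ω, e j⟫_ℝ) P :=
      (h.iIndepFun_X.indepFun him).comp hf hf
    have h2 := h1.integral_fun_mul_eq_mul_integral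
      (hf.comp (h.measurable_X i)).aestronglyMeasurable
      (hf.comp (h.measurable_X m)).aestronglyMeasurable
    have h3 : ∫ ω, ⟪X i ω, e j⟫_ℝ ∂P = 0 := by
      rw [← h.integral_coord j]
      exact ((h.identDistrib_X i).comp hf).integral_eq
    rw [h2, h3, zero_mul]

/-- Law of large numbers for the squared `j`-th coefficients. -/
lemma tendsto_measure_sum_coord_sq (h : IsRegressionSample P X ε lam e) (j : ℕ) {δ : ℝ}
    (hδ : 0 < δ) :
    Tendsto (fun n : ℕ => P {ω | δ ≤ |(n : ℝ)⁻¹ * ∑ i : Fin n, ⟪X i ω, e j⟫_ℝ ^ 2 - lam j|}) atTop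
      (𝓝 0) := by
  have hf2 : Measurable fun x : H => ⟪x, e j⟫_ℝ ^ 2 := by
    have := secondCountableTopology_of_hilbertBasis e
    exact (measurable_id.inner_const).pow_const 2
  have h1 := strong_law_ae_real (μ := P) (fun i ω => ⟪X i ω, e j⟫_ℝ ^ 2)
    (h.memLp_coord 0 j).integrable_sq
    (fun i m him => (h.iIndepFun_X.indepFun him).comp hf2 hf2)
    (fun i => (h.identDistrib_X i).comp hf2)
  rw [h.integral_coord_sq] at h1
  have h2 := tendstoInMeasure_of_tendsto_ae (fun n => by
    exact ((Finset.measurable_sum (Finset.range n) fun i _ =>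
      hf2.comp (h.measurable_X i)).div_const (n : ℝ)).aestronglyMeasurable) h1
  rw [tendstoInMeasure_iff_dist] at h2
  refine (h2 δ hδ).congr fun n => ?_
  congr 1
  ext ω
  simp only [Set.mem_ofPred_eq, Real.dist_eq]
  rw [Finset.sum_range, div_eq_inv_mul]

lemma summable_lam (h : IsRegressionSample P X ε lam e) : Summable lam := by
  refine summable_of_sum_le (c := ∫ ω, ‖X 0 ω‖ ^ 2 ∂P) (fun j => (h.lam_pos j).le) fun s => ?_
  simp_rw [← h.integral_coord_sq]
  rw [← integral_finsetSum _ fun j _ => (h.memLp_coord 0 j).integrable_sq]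
  refine integral_mono (integrable_finsetSum _ fun j _ => (h.memLp_coord 0 j).integrable_sq)
    (h.memLp_X.integrable_norm_pow (by norm_num)) fun ω => ?_
  have := e.orthonormal.sum_inner_products_le (X 0 ω) (s := s)
  simpa [real_inner_comm] using this

lemma lintegral_sum_norm_sq (h : IsRegressionSample P X ε lam e) (n : ℕ) :
    ∫⁻ ω, ENNReal.ofReal (∑ i : Fin n, ‖X i ω‖ ^ 2) ∂P =
      ENNReal.ofReal (n * ∫ ω, ‖X 0 ω‖ ^ 2 ∂P) := by
  have hsq : Measurable fun x : H => ‖x‖ ^ 2 := measurable_norm.pow_const 2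
  have hi : ∀ i, Integrable (fun ω => ‖X i ω‖ ^ 2) P := fun i =>
    ((h.identDistrib_X i).memLp_iff.2 h.memLp_X).integrable_norm_pow (by norm_num)
  rw [← ofReal_integral_eq_lintegral_ofReal (integrable_finsetSum _ fun i _ => hi _)
    (Eventually.of_forall fun ω => by positivity), integral_finsetSum _ fun i _ => hi _]
  have h1 : ∀ i, ∫ ω, ‖X i ω‖ ^ 2 ∂P = ∫ ω, ‖X 0 ω‖ ^ 2 ∂P :=
    fun i => ((h.identDistrib_X i).comp hsq).integral_eq
  simp [h1]

/-- The mean of `‖∑ i, ⟨X_i, e_j⟩ B_i‖²` for vectors `B_i` that are functions of the sample with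
the direction `e_j` removed. -/
lemma lintegral_norm_sum_coord_smul (h : IsRegressionSample P X ε lam e) (j n : ℕ) {E : Type*}
    [NormedAddCommGroup E] [InnerProductSpace ℝ E] [MeasurableSpace E] [BorelSpace E]
    [SecondCountableTopology E] {B : (Fin n → H) → Fin n → E} (hB : Measurable B) :
    ∫⁻ ω, ENNReal.ofReal (‖∑ i : Fin n, ⟪X i ω, e j⟫_ℝ •
        B (removeDirection (e j) fun i => X i ω) i‖ ^ 2) ∂P =
      ∫⁻ ω, ENNReal.ofReal (lam j *
        ∑ i, ‖B (removeDirection (e j) fun i : Fin n => X i ω) i‖ ^ 2) ∂P := by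
  have := secondCountableTopology_of_hilbertBasis e
  refine lintegral_norm_sum_smul_sq (A := fun ω (i : Fin n) => ⟪X i ω, e j⟫_ℝ)
    (measurable_pi_lambda _ fun i => (h.measurable_X i).inner_const)
    ((measurable_removeDirection (e j)).comp (measurable_pi_lambda _ fun i => h.measurable_X i))
    (h.indepFun_coord_removeDirection j n) (fun i => h.memLp_coord i j) (fun i m => ?_) hB
  rw [h.integral_coord_mul_coord]
  simp [Fin.val_inj]

lemma map_sample (h : IsRegressionSample P X ε lam e) (n : ℕ) :
    P.map (fun ω (i : Fin n) => (X i ω, ε i ω)) =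
      Measure.pi fun _ => P.map fun ω => (X 0 ω, ε 0 ω) := by
  have := secondCountableTopology_of_hilbertBasis e
  rw [(iIndepFun_iff_map_fun_eq_pi_map fun i : Fin n =>
    ((h.measurable_X i).prodMk (h.measurable_ε i)).aemeasurable).1
    (h.indep.precomp Fin.val_injective)]
  congr 1
  ext1 i
  exact (h.ident i).map_eq

lemma integral_law_mul_noise (h : IsRegressionSample P X ε lam e) (y : H) {g : H → ℝ}
    (hg : Measurable g) :
    ∫ u, g u.1 * ⟪u.2, y⟫_ℝ ∂(P.map fun ω => (X 0 ω, ε 0 ω)) = 0 := by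
  have := secondCountableTopology_of_hilbertBasis e
  have hζ : Measurable fun u : H × H => ⟪u.2, y⟫_ℝ := measurable_snd.inner_const
  have hm : Measurable fun u : H × H => g u.1 * ⟪u.2, y⟫_ℝ := (hg.comp measurable_fst).mul hζ
  rw [integral_map ((h.measurable_X 0).prodMk (h.measurable_ε 0)).aemeasurable
    hm.aestronglyMeasurable]
  exact integral_mul_inner_noise (h.measurable_X 0) h.memLp_ε h.condExp_ε y hg

lemma lintegral_law_mul_noise_sq (h : IsRegressionSample P X ε lam e) (y : H) {g : H → ℝ≥0∞}
    (hg : Measurable g) :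
    ∫⁻ u, g u.1 * ENNReal.ofReal (⟪u.2, y⟫_ℝ ^ 2) ∂(P.map fun ω => (X 0 ω, ε 0 ω)) =
      ENNReal.ofReal (∫ ω, ⟪ε 0 ω, y⟫_ℝ ^ 2 ∂P) *
        ∫⁻ u, g u.1 ∂(P.map fun ω => (X 0 ω, ε 0 ω)) := by
  have := secondCountableTopology_of_hilbertBasis e
  have hXε := (h.measurable_X 0).prodMk (h.measurable_ε 0)
  have hζ : Measurable fun u : H × H => ⟪u.2, y⟫_ℝ := measurable_snd.inner_const
  have hg1 : Measurable fun u : H × H => g u.1 := hg.comp measurable_fst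
  have hm : Measurable fun u : H × H => g u.1 * ENNReal.ofReal (⟪u.2, y⟫_ℝ ^ 2) :=
    hg1.mul (hζ.pow_const 2).ennreal_ofReal
  rw [lintegral_map hm hXε, lintegral_map hg1 hXε]
  exact lintegral_mul_inner_noise_sq (h.measurable_X 0) (h.measurable_ε 0) h.memLp_ε y
    (h.condExp_ε_sq y) hg

/-- The second moment of a linear combination of the noises in the direction `y`, with coefficients
that are functions of the covariates. -/
lemma integral_sum_mul_noise_sq (h : IsRegressionSample P X ε lam e) (y : H) {n : ℕ}
    {F : Fin n → (Fin n → H) → ℝ} (hF : ∀ i, Measurable (F i))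
    (hF2 : ∀ i, MemLp (fun ω => F i fun l => X l ω) 2 P) :
    MemLp (fun ω => ∑ i, F i (fun l => X l ω) * ⟪ε i ω, y⟫_ℝ) 2 P ∧
    ∫ ω, (∑ i, F i (fun l => X l ω) * ⟪ε i ω, y⟫_ℝ) ^ 2 ∂P =
      (∫ ω, ⟪ε 0 ω, y⟫_ℝ ^ 2 ∂P) * ∑ i, ∫ ω, F i (fun l => X l ω) ^ 2 ∂P := by
  have := secondCountableTopology_of_hilbertBasis e
  have hXε : Measurable fun ω => (X 0 ω, ε 0 ω) := (h.measurable_X 0).prodMk (h.measurable_ε 0)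
  have hU : Measurable fun ω (i : Fin n) => (X i ω, ε i ω) :=
    measurable_pi_lambda _ fun i => (h.measurable_X i).prodMk (h.measurable_ε i)
  have : IsProbabilityMeasure (P.map fun ω => (X 0 ω, ε 0 ω)) :=
    Measure.isProbabilityMeasure_map hXε.aemeasurable
  have hζ : Measurable fun u : H × H => ⟪u.2, y⟫_ℝ := measurable_snd.inner_const
  have hFm : ∀ i, Measurable fun u : Fin n → H × H => F i fun l => (u l).1 :=
    fun i => (hF i).comp (measurable_sample measurable_fst)
  have key := integral_pi_sum_mul_noise_sq (ν := P.map fun ω => (X 0 ω, ε 0 ω)) (X := Prod.fst)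
    (ζ := fun u : H × H => ⟪u.2, y⟫_ℝ) (n := n) measurable_fst hζ
    (c := ∫ ω, ⟪ε 0 ω, y⟫_ℝ ^ 2 ∂P) (integral_nonneg fun ω => sq_nonneg _)
    (fun g hg => h.integral_law_mul_noise y hg)
    (fun g hg => h.lintegral_law_mul_noise_sq y hg)
    hF (fun i => by
      rw [← h.map_sample, memLp_map_measure_iff (hFm i).aestronglyMeasurable hU.aemeasurable]
      exact hF2 i)
  have hsm : Measurable fun u : Fin n → H × H =>
      ∑ i, F i (fun l => (u l).1) * ⟪(u i).2, y⟫_ℝ :=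
    Finset.measurable_sum _ fun i _ => (hFm i).mul (hζ.comp (measurable_pi_apply i))
  rw [← h.map_sample, memLp_map_measure_iff hsm.aestronglyMeasurable hU.aemeasurable,
    integral_map hU.aemeasurable (hsm.pow_const 2).aestronglyMeasurable] at key
  refine ⟨key.1, key.2.trans ?_⟩
  congr 1
  refine Finset.sum_congr rfl fun i _ => ?_
  rw [integral_map hU.aemeasurable ((hFm i).pow_const 2).aestronglyMeasurable]

lemma integral_mul_noise (h : IsRegressionSample P X ε lam e) (y : H) {n : ℕ} (i : Fin n)
    {F : (Fin n → H) → ℝ} (hF : Measurable F) :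
    ∫ ω, F (fun l => X l ω) * ⟪ε i ω, y⟫_ℝ ∂P = 0 := by
  have := secondCountableTopology_of_hilbertBasis e
  have hXε : Measurable fun ω => (X 0 ω, ε 0 ω) := (h.measurable_X 0).prodMk (h.measurable_ε 0)
  have hU : Measurable fun ω (i : Fin n) => (X i ω, ε i ω) :=
    measurable_pi_lambda _ fun i => (h.measurable_X i).prodMk (h.measurable_ε i)
  have : IsProbabilityMeasure (P.map fun ω => (X 0 ω, ε 0 ω)) :=
    Measure.isProbabilityMeasure_map hXε.aemeasurable
  have hζ : Measurable fun u : H × H => ⟪u.2, y⟫_ℝ := measurable_snd.inner_const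
  have hFm : Measurable fun u : Fin n → H × H => F fun l => (u l).1 :=
    hF.comp (measurable_sample measurable_fst)
  have key := integral_pi_mul_noise (ν := P.map fun ω => (X 0 ω, ε 0 ω)) (X := Prod.fst)
    (ζ := fun u : H × H => ⟪u.2, y⟫_ℝ) (n := n) measurable_fst hζ
    (fun g hg => h.integral_law_mul_noise y hg)
    i hF (G := fun _ => 1) measurable_const (fun _ _ => rfl)
  simp only [one_mul] at key
  have hm : Measurable fun u : Fin n → H × H => (F fun l => (u l).1) * ⟪(u i).2, y⟫_ℝ :=
    hFm.mul (hζ.comp (measurable_pi_apply i))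
  rwa [← h.map_sample, integral_map hU.aemeasurable hm.aestronglyMeasurable] at key

end IsRegressionSample

end Sample

/-! ### Boundedness in probability -/

section BoundedInProbability

variable {Ω : Type*} [MeasurableSpace Ω] {P : Measure Ω}

/-- The sequence `f` is bounded in probability: up to events of small probability, and for large
indices, it is bounded by a constant. No measurability is required. -/
def BoundedInProbability (P : Measure Ω) (f : ℕ → Ω → ℝ) : Prop :=
  ∀ p : ℝ≥0∞, 0 < p → ∃ K : ℝ, 0 < K ∧ ∀ᶠ n in atTop, P {ω | K < |f n ω|} ≤ p

/-- Chebyshev's inequality. -/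
lemma measure_lt_abs_le {f : Ω → ℝ} (hf : Measurable f) {C K : ℝ} (hK : 0 < K)
    (hC : ∫⁻ ω, ENNReal.ofReal (f ω ^ 2) ∂P ≤ ENNReal.ofReal C) :
    P {ω | K ≤ |f ω|} ≤ ENNReal.ofReal (C / K ^ 2) := by
  have h1 : {ω | K ≤ |f ω|} ⊆ {ω | ENNReal.ofReal (K ^ 2) ≤ ENNReal.ofReal (f ω ^ 2)} := by
    intro ω hω
    refine ENNReal.ofReal_le_ofReal ?_
    rw [← sq_abs (f ω)]
    exact pow_le_pow_left₀ hK.le hω 2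
  have hK2 : ENNReal.ofReal (K ^ 2) ≠ 0 := by
    rw [Ne, ENNReal.ofReal_eq_zero, not_le]; positivity
  refine (measure_mono h1).trans ((meas_ge_le_lintegral_div
    (hf.pow_const 2).ennreal_ofReal.aemeasurable hK2 ENNReal.ofReal_ne_top).trans ?_)
  rw [ENNReal.ofReal_div_of_pos (by positivity)]
  exact ENNReal.div_le_div_right hC _

lemma exists_ofReal_div_sq_le (C : ℝ) {p : ℝ≥0∞} (hp : 0 < p) :
    ∃ K : ℝ, 0 < K ∧ ENNReal.ofReal (C / K ^ 2) ≤ p := by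
  have h1 : Tendsto (fun K : ℝ => ENNReal.ofReal (C / K ^ 2)) atTop (𝓝 0) := by
    rw [← ENNReal.ofReal_zero]
    exact ENNReal.tendsto_ofReal (tendsto_const_nhds.div_atTop (tendsto_pow_atTop (by norm_num)))
  obtain ⟨K, hK, hK0⟩ := ((h1.eventually_le_const hp).and (eventually_gt_atTop 0)).exists
  exact ⟨K, hK0, hK⟩

/-- A sequence with bounded second moments is bounded in probability. -/
lemma BoundedInProbability.of_lintegral_sq_le {f : ℕ → Ω → ℝ} (hf : ∀ n, Measurable (f n)) {C : ℝ}
    (hC : ∀ᶠ n in atTop, ∫⁻ ω, ENNReal.ofReal (f n ω ^ 2) ∂P ≤ ENNReal.ofReal C) :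
    BoundedInProbability P f := by
  intro p hp
  obtain ⟨K, hK0, hK⟩ := exists_ofReal_div_sq_le C hp
  refine ⟨K, hK0, hC.mono fun n hn => ?_⟩
  exact (measure_mono fun ω (hω : K < _) => hω.le).trans
    ((measure_lt_abs_le (hf n) hK0 hn).trans hK)

/-- Boundedness in probability is inherited by a sequence that is dominated outside of events of
vanishing probability. -/
lemma BoundedInProbability.mono {f g : ℕ → Ω → ℝ} (hg : BoundedInProbability P g) {c : ℝ}
    {B : ℕ → Set Ω} (hB : Tendsto (fun n => P (B n)) atTop (𝓝 0))
    (h : ∀ᶠ n in atTop, ∀ ω, ω ∉ B n → |f n ω| ≤ c * |g n ω|) : BoundedInProbability P f := by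
  intro p hp
  have hp2 : 0 < p / 2 := ENNReal.half_pos hp.ne'
  obtain ⟨K, hK0, hK⟩ := hg (p / 2) hp2
  refine ⟨(|c| + 1) * K, by positivity, ?_⟩
  filter_upwards [hK, hB.eventually_le_const hp2, h] with n h1 h2 h3
  have hsub : {ω | (|c| + 1) * K < |f n ω|} ⊆ {ω | K < |g n ω|} ∪ B n := by
    intro ω hω
    by_contra hcon
    simp only [Set.mem_union, Set.mem_ofPred_eq, not_or, not_lt] at hcon hω
    have h4 := h3 ω hcon.2
    have h5 : c * |g n ω| ≤ |c| * K :=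
      mul_le_mul (le_abs_self c) hcon.1 (abs_nonneg _) (abs_nonneg _)
    nlinarith
  calc P {ω | (|c| + 1) * K < |f n ω|} ≤ P {ω | K < |g n ω|} + P (B n) :=
        (measure_mono hsub).trans (measure_union_le _ _)
    _ ≤ p / 2 + p / 2 := add_le_add h1 h2
    _ = p := ENNReal.add_halves p

lemma BoundedInProbability.add {f g : ℕ → Ω → ℝ} (hf : BoundedInProbability P f)
    (hg : BoundedInProbability P g) : BoundedInProbability P fun n ω => f n ω + g n ω := by
  intro p hp
  have hp2 : 0 < p / 2 := ENNReal.half_pos hp.ne'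
  obtain ⟨K, hK0, hK⟩ := hf (p / 2) hp2
  obtain ⟨K', hK0', hK'⟩ := hg (p / 2) hp2
  refine ⟨K + K', by positivity, ?_⟩
  filter_upwards [hK, hK'] with n h1 h2
  have hsub : {ω | K + K' < |f n ω + g n ω|} ⊆ {ω | K < |f n ω|} ∪ {ω | K' < |g n ω|} := by
    intro ω hω
    by_contra hcon
    simp only [Set.mem_union, Set.mem_ofPred_eq, not_or, not_lt] at hcon hω
    have := abs_add_le (f n ω) (g n ω)
    linarith [hcon.1, hcon.2]
  calc P {ω | K + K' < |f n ω + g n ω|} ≤ P {ω | K < |f n ω|} + P {ω | K' < |g n ω|} :=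
        (measure_mono hsub).trans (measure_union_le _ _)
    _ ≤ p / 2 + p / 2 := add_le_add h1 h2
    _ = p := ENNReal.add_halves p

/-- A sequence bounded in probability becomes negligible when multiplied by scalars tending to
`0`. -/
lemma BoundedInProbability.tendsto_measure_mul {f : ℕ → Ω → ℝ} (hf : BoundedInProbability P f)
    {c : ℕ → ℝ} (φ : ℕ → ℕ) (hφ : Tendsto φ atTop atTop) (hc : Tendsto c atTop (𝓝 0)) {δ : ℝ}
    (hδ : 0 < δ) : Tendsto (fun n => P {ω | δ ≤ |c n * f (φ n) ω|}) atTop (𝓝 0) := by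
  rw [ENNReal.tendsto_nhds_zero]
  intro p hp
  obtain ⟨K, hK0, hK⟩ := hf p hp
  have h1 : ∀ᶠ n in atTop, |c n| < δ / (K + 1) := by
    have := hc.abs
    rw [abs_zero] at this
    exact this.eventually_lt_const (by positivity)
  filter_upwards [hφ.eventually hK, h1] with n h2 h3
  refine (measure_mono fun ω hω => ?_).trans h2
  simp only [Set.mem_ofPred_eq, abs_mul] at hω ⊢
  by_contra hcon
  push Not at hcon
  rw [lt_div_iff₀ (by positivity)] at h3
  have : |c n| * |f (φ n) ω| ≤ |c n| * K := by gcongr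
  nlinarith [abs_nonneg (c n)]

end BoundedInProbability

/-! ### Empirical eigenelements -/

section EmpiricalEigensystem

variable {H : Type*} [NormedAddCommGroup H] [InnerProductSpace ℝ H] [CompleteSpace H]
  [MeasurableSpace H] [BorelSpace H]

/-- Measurable versions of the `k n` leading eigenelements of the empirical covariance operators
of all samples of size `n`, where `k n` tends to infinity more slowly than `n`. -/
structure IsEmpiricalEigensystem (k : ℕ → ℕ) (lamHat : (n : ℕ) → (Fin n → H) → Fin (k n) → ℝ)
    (eHat : (n : ℕ) → (Fin n → H) → Fin (k n) → H) : Prop where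
  tendsto_k : Tendsto k atTop atTop
  tendsto_ratio : Tendsto (fun n : ℕ => (k n : ℝ) / n) atTop (𝓝 0)
  leading : ∀ n x, IsLeadingEigensystem (empCov x) (lamHat n x) (eHat n x)
  measurable_eHat : ∀ n j, Measurable fun x => eHat n x j

namespace IsEmpiricalEigensystem

variable {k : ℕ → ℕ} {lamHat : (n : ℕ) → (Fin n → H) → Fin (k n) → ℝ}
  {eHat : (n : ℕ) → (Fin n → H) → Fin (k n) → H} [SecondCountableTopology H]

lemma measurable_lamHat (hE : IsEmpiricalEigensystem k lamHat eHat) (n : ℕ) (j : Fin (k n)) :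
    Measurable fun x => lamHat n x j := by
  simp_rw [fun x => (hE.leading n x).eigenvalue_eq j]
  refine Measurable.const_mul (Finset.measurable_sum _ fun i _ => Measurable.pow_const ?_ 2) _
  exact (measurable_pi_apply i).inner (hE.measurable_eHat n j)

lemma measurable_spectralCutInverse (hE : IsEmpiricalEigensystem k lamHat eHat) (n : ℕ)
    {z : (Fin n → H) → H} (hz : Measurable z) :
    Measurable fun x => spectralCutInverse (lamHat n x) (eHat n x) (z x) := by
  simp_rw [spectralCutInverse_apply]
  exact Finset.measurable_sum _ fun j _ => ((hE.measurable_lamHat n j).inv.mul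
    ((hE.measurable_eHat n j).inner hz)).smul (hE.measurable_eHat n j)

lemma measurable_empCov (n : ℕ) {z : (Fin n → H) → H} (hz : Measurable z) :
    Measurable fun x : Fin n → H => empCov x (z x) := by
  simp_rw [empCov_apply]
  refine Measurable.const_smul (Finset.measurable_sum _ fun i _ => ?_) _
  have hi : Measurable fun x : Fin n → H => x i := measurable_pi_apply i
  exact (hi.inner hz).smul hi

lemma measurable_leftSingular (hE : IsEmpiricalEigensystem k lamHat eHat) (n : ℕ) (m : Fin (k n))
    (i : Fin n) : Measurable fun x => leftSingular x (lamHat n x) (eHat n x) m i := by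
  unfold leftSingular
  have hi : Measurable fun x : Fin n → H => x i := measurable_pi_apply i
  exact ((hE.measurable_lamHat n m).const_mul _).sqrt.inv.mul (hi.inner (hE.measurable_eHat n m))

lemma exists_smallest (hE : IsEmpiricalEigensystem k lamHat eHat) {n : ℕ} (hk : 0 < k n) :
    ∃ l : Fin (k n), ∀ x j, lamHat n x l ≤ lamHat n x j :=
  ⟨⟨k n - 1, by omega⟩, fun x j => (hE.leading n x).antitone (by
    rw [Fin.le_def]; have := j.2; simp only; omega)⟩

end IsEmpiricalEigensystem

end EmpiricalEigensystem

/-! ### The error at the eigenvectors is of order `1 / √n` -/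

section ErrorAtBasisVectors

variable {H : Type*} [NormedAddCommGroup H] [InnerProductSpace ℝ H] [CompleteSpace H]
  [MeasurableSpace H] [BorelSpace H] {Ω : Type*} [MeasurableSpace Ω]

/-- The first `n` elements of the sequence `X`, evaluated at `ω`. -/
abbrev sample (X : ℕ → Ω → H) (n : ℕ) (ω : Ω) : Fin n → H := fun i => X i ω

variable {P : Measure Ω} [IsProbabilityMeasure P] {X ε : ℕ → Ω → H} {lam : ℕ → ℝ}
  {e : HilbertBasis ℕ ℝ H} {k : ℕ → ℕ} {lamHat : (n : ℕ) → (Fin n → H) → Fin (k n) → ℝ}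
  {eHat : (n : ℕ) → (Fin n → H) → Fin (k n) → H}

namespace IsRegressionSample

lemma measurable_sample (h : IsRegressionSample P X ε lam e) (n : ℕ) :
    Measurable (sample X n) := measurable_pi_lambda _ fun i => h.measurable_X i

/-- The upper bound for the cut-off eigenvalue given by the trace tends to `0` in probability. -/
lemma tendsto_measure_trace (h : IsRegressionSample P X ε lam e) (hk : Tendsto k atTop atTop)
    {δ : ℝ} (hδ : 0 < δ) :
    Tendsto (fun n => P {ω | δ ≤ (k n : ℝ)⁻¹ * ((n : ℝ)⁻¹ * ∑ i, ‖sample X n ω i‖ ^ 2)}) atTop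
      (𝓝 0) := by
  set m := ∫ ω, ‖X 0 ω‖ ^ 2 ∂P with hm
  have hlim : Tendsto (fun n => ENNReal.ofReal ((k n : ℝ)⁻¹ * m / δ)) atTop (𝓝 0) := by
    rw [← ENNReal.ofReal_zero]
    refine ENNReal.tendsto_ofReal ?_
    have h1 : Tendsto (fun n => ((k n : ℝ))⁻¹) atTop (𝓝 0) :=
      tendsto_inv_atTop_zero.comp (tendsto_natCast_atTop_atTop.comp hk)
    simpa using (h1.mul_const m).div_const δ
  refine tendsto_of_tendsto_of_tendsto_of_le_of_le' tendsto_const_nhds hlim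
    (Eventually.of_forall fun _ => zero_le) ?_
  filter_upwards [eventually_gt_atTop 0] with n hn
  have hnn : (0 : ℝ) < n := by exact_mod_cast hn
  have hmeas0 : Measurable fun ω => ∑ i : Fin n, ‖X i ω‖ ^ 2 :=
    Finset.measurable_sum _ fun (i : Fin n) _ => (h.measurable_X i).norm.pow_const 2
  have hmeas : Measurable fun ω =>
      ENNReal.ofReal ((k n : ℝ)⁻¹ * ((n : ℝ)⁻¹ * ∑ i, ‖sample X n ω i‖ ^ 2)) :=
    ((hmeas0.const_mul _).const_mul _).ennreal_ofReal
  have hδ0 : ENNReal.ofReal δ ≠ 0 := by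
    rw [Ne, ENNReal.ofReal_eq_zero, not_le]; exact hδ
  have h1 : {ω | δ ≤ (k n : ℝ)⁻¹ * ((n : ℝ)⁻¹ * ∑ i, ‖sample X n ω i‖ ^ 2)} ⊆
      {ω | ENNReal.ofReal δ ≤
        ENNReal.ofReal ((k n : ℝ)⁻¹ * ((n : ℝ)⁻¹ * ∑ i, ‖sample X n ω i‖ ^ 2))} :=
    fun ω hω => ENNReal.ofReal_le_ofReal hω
  refine (measure_mono h1).trans ?_
  refine (meas_ge_le_lintegral_div hmeas.aemeasurable hδ0 ENNReal.ofReal_ne_top).trans ?_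
  rw [ENNReal.ofReal_div_of_pos hδ]
  refine ENNReal.div_le_div_right (le_of_eq ?_) _
  have h2 : ∀ ω, ENNReal.ofReal ((k n : ℝ)⁻¹ * ((n : ℝ)⁻¹ * ∑ i, ‖sample X n ω i‖ ^ 2)) =
      ENNReal.ofReal ((k n : ℝ)⁻¹ * (n : ℝ)⁻¹) *
        ENNReal.ofReal (∑ i : Fin n, ‖X i ω‖ ^ 2) := fun ω => by
    rw [← ENNReal.ofReal_mul (by positivity), mul_assoc]
  simp_rw [h2]
  rw [lintegral_const_mul' _ _ ENNReal.ofReal_ne_top, h.lintegral_sum_norm_sq,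
    ← ENNReal.ofReal_mul (by positivity), ← hm]
  have h3 : (k n : ℝ)⁻¹ * (n : ℝ)⁻¹ * (n * m) = (k n : ℝ)⁻¹ * m := by
    field_simp
  rw [h3]

/-- The deviation of `Γ_n e_j` from its component along `e_j`, rescaled by `√n`, has a bounded
second moment. -/
lemma lintegral_cross_sq_le (h : IsRegressionSample P X ε lam e) (j n : ℕ) :
    ∫⁻ ω, ENNReal.ofReal ((√n * ‖(n : ℝ)⁻¹ • ∑ i, ⟪sample X n ω i, e j⟫_ℝ •
      removeDirection (e j) (sample X n ω) i‖) ^ 2) ∂P ≤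
        ENNReal.ofReal (lam j * ∫ ω, ‖X 0 ω‖ ^ 2 ∂P) := by
  have := secondCountableTopology_of_hilbertBasis e
  have h1 : ∀ v : H, ENNReal.ofReal ((√n * ‖(n : ℝ)⁻¹ • v‖) ^ 2) =
      ENNReal.ofReal (n : ℝ)⁻¹ * ENNReal.ofReal (‖v‖ ^ 2) := fun v => by
    rw [← ENNReal.ofReal_mul (by positivity), mul_pow, norm_smul, mul_pow,
      Real.sq_sqrt (Nat.cast_nonneg n), Real.norm_of_nonneg (by positivity)]
    congr 1
    rcases eq_or_ne (n : ℝ) 0 with h0 | h0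
    · simp [h0]
    · field_simp
  simp_rw [h1]
  have h2 := h.lintegral_norm_sum_coord_smul j n (B := fun x => x) measurable_id
  rw [lintegral_const_mul' _ _ ENNReal.ofReal_ne_top, h2]
  calc ENNReal.ofReal (n : ℝ)⁻¹ * ∫⁻ ω, ENNReal.ofReal (lam j *
        ∑ i, ‖removeDirection (e j) (sample X n ω) i‖ ^ 2) ∂P
      ≤ ENNReal.ofReal (n : ℝ)⁻¹ * ∫⁻ ω, ENNReal.ofReal (lam j) *
          ENNReal.ofReal (∑ i : Fin n, ‖X i ω‖ ^ 2) ∂P := by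
        gcongr with ω
        rw [← ENNReal.ofReal_mul (h.lam_pos j).le]
        refine ENNReal.ofReal_le_ofReal ?_
        have := (h.lam_pos j).le
        gcongr with i
        exact norm_removeDirection_le (e.orthonormal.1 j) _ i
    _ ≤ _ := by
        rw [lintegral_const_mul' _ _ ENNReal.ofReal_ne_top, h.lintegral_sum_norm_sq,
          ← ENNReal.ofReal_mul (h.lam_pos j).le, ← ENNReal.ofReal_mul (by positivity)]
        refine ENNReal.ofReal_le_ofReal ?_
        rcases eq_or_ne (n : ℝ) 0 with h0 | h0
        · have := (h.lam_pos j).le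
          have : 0 ≤ ∫ ω, ‖X 0 ω‖ ^ 2 ∂P := integral_nonneg fun _ => by positivity
          simp only [h0, inv_zero, zero_mul]
          positivity
        · apply le_of_eq
          field_simp

lemma measurable_cross (h : IsRegressionSample P X ε lam e) (j n : ℕ) :
    Measurable fun ω => ‖(n : ℝ)⁻¹ • ∑ i, ⟪sample X n ω i, e j⟫_ℝ •
      removeDirection (e j) (sample X n ω) i‖ := by
  have := secondCountableTopology_of_hilbertBasis e
  refine Measurable.norm (Measurable.const_smul (Finset.measurable_sum _ fun i _ => ?_) _)
  exact ((h.measurable_X i).inner_const).smul ((measurable_pi_apply i).comp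
    ((measurable_removeDirection (e j)).comp (h.measurable_sample n)))

lemma boundedInProbability_cross (h : IsRegressionSample P X ε lam e) (j : ℕ) :
    BoundedInProbability P fun n ω => √n * ‖(n : ℝ)⁻¹ • ∑ i, ⟪sample X n ω i, e j⟫_ℝ •
      removeDirection (e j) (sample X n ω) i‖ :=
  .of_lintegral_sq_le (fun n => (h.measurable_cross j n).const_mul _)
    (Eventually.of_forall fun n => h.lintegral_cross_sq_le j n)

/-- The bias in the direction `e_j` is of order `1 / √n`. -/
lemma boundedInProbability_residual (h : IsRegressionSample P X ε lam e)
    (hE : IsEmpiricalEigensystem k lamHat eHat) (j : ℕ) :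
    BoundedInProbability P fun n ω => √n * ‖e j - empCov (sample X n ω)
      (spectralCutInverse (lamHat n (sample X n ω)) (eHat n (sample X n ω)) (e j))‖ := by
  have := secondCountableTopology_of_hilbertBasis e
  have hl := h.lam_pos j
  have hB1 := h.tendsto_measure_trace hE.tendsto_k (δ := lam j / 4) (by positivity)
  have hB2 := h.tendsto_measure_sum_coord_sq j (δ := lam j / 4) (by positivity)
  have hB := hB1.add hB2
  rw [add_zero] at hB
  refine (h.boundedInProbability_cross j).mono (c := 2 / lam j)
    (tendsto_of_tendsto_of_tendsto_of_le_of_le tendsto_const_nhds hB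
      (fun _ => zero_le) fun n => measure_union_le _ _) ?_
  filter_upwards [hE.tendsto_k.eventually_gt_atTop 0] with n hk ω hω
  simp only [Set.mem_union, Set.mem_ofPred_eq, not_or, not_le] at hω
  obtain ⟨h1, h2⟩ := hω
  obtain ⟨l, hl'⟩ := hE.exists_smallest hk
  set x := sample X n ω with hx
  set q := (n : ℝ)⁻¹ • ∑ i, ⟪x i, e j⟫_ℝ • removeDirection (e j) x i with hq
  have hL := hE.leading n x
  have h3 := hL.mul_norm_residual_le (hl' x) (empCov_eq_add_removeDirection (e := e j) x)
  rw [← hq] at h3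
  have hμ : lamHat n x l ≤ lam j / 4 := by
    have h4 := hL.mul_eigenvalue_le (hl' x)
    have hk' : (0 : ℝ) < k n := by exact_mod_cast hk
    have h5 : lamHat n x l ≤ (k n : ℝ)⁻¹ * ((n : ℝ)⁻¹ * ∑ i, ‖x i‖ ^ 2) := by
      rw [inv_mul_eq_div, le_div_iff₀ hk', mul_comm]
      exact h4
    exact h5.trans h1.le
  have h2' := (abs_lt.1 h2).1
  have h6 : lam j / 2 * ‖e j - empCov x (spectralCutInverse (lamHat n x) (eHat n x) (e j))‖ ≤
      ‖q‖ := by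
    refine le_trans (mul_le_mul_of_nonneg_right ?_ (norm_nonneg _)) h3
    linarith
  rw [abs_of_nonneg (by positivity), abs_of_nonneg (by positivity)]
  have h7 : ‖e j - empCov x (spectralCutInverse (lamHat n x) (eHat n x) (e j))‖ ≤
      2 / lam j * ‖q‖ := by
    rw [div_mul_eq_mul_div, le_div_iff₀ hl]
    linarith
  calc _ ≤ √n * (2 / lam j * ‖q‖) := by gcongr
    _ = _ := by ring

/-- The projection of the coefficients of the sample along `e_j` onto the `k` left singular vectors
of the sample without this direction is negligible, because these vectors are independent of the
coefficients and `k / n → 0`. -/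
lemma tendsto_measure_leftSingular (h : IsRegressionSample P X ε lam e)
    (hE : IsEmpiricalEigensystem k lamHat eHat) (j : ℕ) {δ : ℝ} (hδ : 0 < δ) :
    Tendsto (fun n : ℕ => P {ω | n * δ ≤ ∑ m, (∑ i, ⟪sample X n ω i, e j⟫_ℝ *
      leftSingular (removeDirection (e j) (sample X n ω))
        (lamHat n (removeDirection (e j) (sample X n ω)))
        (eHat n (removeDirection (e j) (sample X n ω))) m i) ^ 2}) atTop (𝓝 0) := by
  have := secondCountableTopology_of_hilbertBasis e
  have hlim : Tendsto (fun n => ENNReal.ofReal (lam j * ((k n : ℝ) / n) / δ)) atTop (𝓝 0) := by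
    rw [← ENNReal.ofReal_zero]
    refine ENNReal.tendsto_ofReal ?_
    simpa using (hE.tendsto_ratio.const_mul (lam j)).div_const δ
  refine tendsto_of_tendsto_of_tendsto_of_le_of_le' tendsto_const_nhds hlim
    (Eventually.of_forall fun _ => zero_le) ?_
  filter_upwards [eventually_gt_atTop 0] with n hn
  have hnn : (0 : ℝ) < n := by exact_mod_cast hn
  have hnδ : 0 < n * δ := by positivity
  let g : Fin (k n) → Ω → ℝ := fun m ω => (∑ i, ⟪sample X n ω i, e j⟫_ℝ *
      leftSingular (removeDirection (e j) (sample X n ω))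
        (lamHat n (removeDirection (e j) (sample X n ω)))
        (eHat n (removeDirection (e j) (sample X n ω))) m i) ^ 2
  have hxm : Measurable fun ω => removeDirection (e j) (sample X n ω) :=
    (measurable_removeDirection (e j)).comp (h.measurable_sample n)
  have hgm : ∀ m, Measurable (g m) := fun m =>
    (Finset.measurable_sum _ fun (i : Fin n) _ => ((h.measurable_X i).inner_const).mul
      ((hE.measurable_leftSingular n m i).comp hxm)).pow_const 2
  have hg : ∀ m, ∫⁻ ω, ENNReal.ofReal (g m ω) ∂P ≤ ENNReal.ofReal (lam j) := fun m => by
    have h1 := h.lintegral_norm_sum_coord_smul j n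
      (B := fun x i => leftSingular x (lamHat n x) (eHat n x) m i)
      (measurable_pi_lambda _ fun i => hE.measurable_leftSingular n m i)
    simp only [smul_eq_mul, Real.norm_eq_abs, sq_abs] at h1
    refine h1.le.trans ?_
    calc _ ≤ ∫⁻ _, ENNReal.ofReal (lam j) ∂P := by
          refine lintegral_mono fun ω => ENNReal.ofReal_le_ofReal ?_
          have h2 := (hE.leading n (removeDirection (e j) (sample X n ω))).sum_leftSingular_sq_le
            hn.ne' m
          have := mul_le_mul_of_nonneg_left h2 (h.lam_pos j).le
          simpa using this
      _ = _ := by simp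
  have hδ0 : ENNReal.ofReal (n * δ) ≠ 0 := by
    rw [Ne, ENNReal.ofReal_eq_zero, not_le]; exact hnδ
  have hsub : {ω | n * δ ≤ ∑ m, g m ω} ⊆
      {ω | ENNReal.ofReal (n * δ) ≤ ENNReal.ofReal (∑ m, g m ω)} :=
    fun ω hω => ENNReal.ofReal_le_ofReal hω
  refine (measure_mono hsub).trans ((meas_ge_le_lintegral_div
    (Finset.measurable_sum _ fun m _ => hgm m).ennreal_ofReal.aemeasurable hδ0
    ENNReal.ofReal_ne_top).trans ?_)
  have hsum : ∫⁻ ω, ENNReal.ofReal (∑ m, g m ω) ∂P ≤ ENNReal.ofReal (k n * lam j) := by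
    rw [lintegral_congr fun ω => ENNReal.ofReal_sum_of_nonneg (s := Finset.univ)
      (f := fun m => g m ω) (fun m _ => sq_nonneg _),
      lintegral_finsetSum _ fun m _ => (hgm m).ennreal_ofReal]
    refine (Finset.sum_le_sum fun m _ => hg m).trans (le_of_eq ?_)
    rw [Finset.sum_const, ENNReal.ofReal_mul (by positivity)]
    simp
  refine (ENNReal.div_le_div_right hsum _).trans (le_of_eq ?_)
  rw [← ENNReal.ofReal_div_of_pos hnδ]
  congr 1
  field_simp

/-- With probability tending to one, `⟨T† e_j, e_j⟩` is bounded by a constant, by the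
leave-one-direction-out bound. -/
lemma tendsto_measure_inner_spectralCutInverse (h : IsRegressionSample P X ε lam e)
    (hE : IsEmpiricalEigensystem k lamHat eHat) (j : ℕ) :
    Tendsto (fun n : ℕ => P {ω | 16 / lam j <
      ⟪spectralCutInverse (lamHat n (sample X n ω)) (eHat n (sample X n ω)) (e j), e j⟫_ℝ}) atTop
      (𝓝 0) := by
  have := secondCountableTopology_of_hilbertBasis e
  have hl := h.lam_pos j
  have hB := (h.tendsto_measure_sum_coord_sq j (δ := lam j / 4) (by positivity)).add
    (h.tendsto_measure_leftSingular hE j (δ := lam j / 2) (by positivity))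
  rw [add_zero] at hB
  refine tendsto_of_tendsto_of_tendsto_of_le_of_le' tendsto_const_nhds hB
    (Eventually.of_forall fun _ => zero_le) ?_
  filter_upwards [hE.tendsto_k.eventually_gt_atTop 0, eventually_gt_atTop 0] with n hk hn
  refine (measure_mono fun ω hω => ?_).trans (measure_union_le _ _)
  by_contra hcon
  simp only [Set.mem_union, Set.mem_ofPred_eq, not_or, not_le] at hcon hω
  obtain ⟨h1, h2⟩ := hcon
  obtain ⟨l, hl'⟩ := hE.exists_smallest hk
  have hnn : (0 : ℝ) < n := by exact_mod_cast hn
  have h3 := (hE.leading n (sample X n ω)).inner_spectralCutInverse_mul_le (e.orthonormal.1 j)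
    hn.ne' (hE.leading n (removeDirection (e j) (sample X n ω))) (hl' _) (hl' _)
  have h4 : lam j * 3 / 4 * n ≤ ∑ i, ⟪sample X n ω i, e j⟫_ℝ ^ 2 := by
    have h5 := (abs_lt.1 h1).1
    have h6 : lam j * 3 / 4 ≤ (n : ℝ)⁻¹ * ∑ i : Fin n, ⟪X i ω, e j⟫_ℝ ^ 2 := by linarith
    rwa [inv_mul_eq_div, le_div_iff₀ hnn] at h6
  rw [div_lt_iff₀ hl] at hω
  set t := ⟪spectralCutInverse (lamHat n (sample X n ω)) (eHat n (sample X n ω)) (e j), e j⟫_ℝ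
  have ht : 0 < t := by
    by_contra hc
    push Not at hc
    nlinarith
  have h7 : t * (n * lam j / 4) ≤ 4 * n := by
    refine le_trans (mul_le_mul_of_nonneg_left ?_ ht.le) h3
    linarith
  nlinarith

/-- The noise part of the error in the direction `e_j` is of order `1 / √n`. -/
lemma boundedInProbability_noise (h : IsRegressionSample P X ε lam e)
    (hE : IsEmpiricalEigensystem k lamHat eHat) (j : ℕ) (y : H) :
    BoundedInProbability P fun n ω => (√n)⁻¹ * ∑ i, ⟪sample X n ω i, spectralCutInverse
      (lamHat n (sample X n ω)) (eHat n (sample X n ω)) (e j)⟫_ℝ * ⟪ε i ω, y⟫_ℝ := by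
  have := secondCountableTopology_of_hilbertBasis e
  have hl := h.lam_pos j
  let z : (n : ℕ) → (Fin n → H) → H := fun n x => spectralCutInverse (lamHat n x) (eHat n x) (e j)
  have hz : ∀ n, Measurable (z n) := fun n => hE.measurable_spectralCutInverse n measurable_const
  let G : (n : ℕ) → Set (Fin n → H) := fun n => {x | ⟪z n x, e j⟫_ℝ ≤ 16 / lam j}
  have hG : ∀ n, MeasurableSet (G n) := fun n =>
    measurableSet_le ((hz n).inner_const) measurable_const
  let F : (n : ℕ) → Fin n → (Fin n → H) → ℝ := fun n i =>
    (G n).indicator fun x => (√n)⁻¹ * ⟪x i, z n x⟫_ℝ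
  have hF : ∀ n i, Measurable (F n i) := fun n i =>
    (((measurable_pi_apply i).inner (hz n)).const_mul _).indicator (hG n)
  -- the sum of the squared coefficients is `⟨T† e_j, e_j⟩`, truncated
  have hFsq : ∀ n x, ∑ i, F n i x ^ 2 ≤ 16 / lam j := fun n x => by
    by_cases hx : x ∈ G n
    · have h1 : ∑ i, F n i x ^ 2 = ⟪z n x, e j⟫_ℝ := by
        rw [← (hE.leading n x).inner_spectralCutInverse_self, inner_empCov_self, Finset.mul_sum]
        refine Finset.sum_congr rfl fun i _ => ?_
        rw [show F n i x = (√n)⁻¹ * ⟪x i, z n x⟫_ℝ from Set.indicator_of_mem hx _, mul_pow,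
          inv_pow, Real.sq_sqrt (Nat.cast_nonneg n)]
      rw [h1]
      exact hx
    · have h1 : ∀ i, F n i x = 0 := fun i => Set.indicator_of_notMem hx _
      simp only [h1]
      simp
      positivity
  have hFL : ∀ n i, MemLp (fun ω => F n i fun l => X l ω) 2 P := fun n i => by
    refine MemLp.of_bound ((hF n i).comp (h.measurable_sample n)).aestronglyMeasurable
      (√(16 / lam j)) (Eventually.of_forall fun ω => ?_)
    rw [Real.norm_eq_abs]
    refine Real.abs_le_sqrt (le_trans ?_ (hFsq n (sample X n ω)))
    exact Finset.single_le_sum (f := fun i => F n i (sample X n ω) ^ 2)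
      (fun i _ => sq_nonneg _) (Finset.mem_univ i)
  set τ := ∫ ω, ⟪ε 0 ω, y⟫_ℝ ^ 2 ∂P with hτ
  have hτ0 : 0 ≤ τ := integral_nonneg fun _ => sq_nonneg _
  have hbdd : BoundedInProbability P fun n ω => ∑ i, F n i (sample X n ω) * ⟪ε i ω, y⟫_ℝ := by
    refine .of_lintegral_sq_le (C := τ * (16 / lam j)) (fun n => ?_)
      (Eventually.of_forall fun n => ?_)
    · exact Finset.measurable_sum _ fun i _ => ((hF n i).comp (h.measurable_sample n)).mul
        ((h.measurable_ε i).inner_const)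
    · obtain ⟨h1, h2⟩ := h.integral_sum_mul_noise_sq y (hF n) (hFL n)
      rw [← ofReal_integral_eq_lintegral_ofReal h1.integrable_sq
        (Eventually.of_forall fun _ => sq_nonneg _), h2]
      refine ENNReal.ofReal_le_ofReal (mul_le_mul_of_nonneg_left ?_ hτ0)
      rw [← integral_finsetSum _ fun i _ => (hFL n i).integrable_sq]
      refine (integral_mono (integrable_finsetSum _ fun i _ => (hFL n i).integrable_sq)
        (integrable_const (16 / lam j)) fun ω => hFsq n (sample X n ω)).trans ?_
      simp
  refine hbdd.mono (c := 1) (h.tendsto_measure_inner_spectralCutInverse hE j)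
    (Eventually.of_forall fun n ω hω => ?_)
  simp only [Set.mem_ofPred_eq, not_lt] at hω
  have hmem : sample X n ω ∈ G n := hω
  rw [one_mul, Finset.mul_sum]
  refine le_of_eq (congrArg _ (Finset.sum_congr rfl fun i _ => ?_))
  rw [show F n i (sample X n ω) = (√n)⁻¹ * ⟪sample X n ω i, z n (sample X n ω)⟫_ℝ from
    Set.indicator_of_mem hmem _, mul_assoc]

/-- The error of the estimator in the direction `e_j`, tested against `y`, is of order `1 / √n`. -/
theorem boundedInProbability_error (h : IsRegressionSample P X ε lam e)
    (hE : IsEmpiricalEigensystem k lamHat eHat) (s : H →L[ℝ] H) (j : ℕ) (y : H) :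
    BoundedInProbability P fun n ω => √n * ⟪estimator (fun i : Fin n => s (X i ω) + ε i ω)
      (sample X n ω) (lamHat n (sample X n ω)) (eHat n (sample X n ω)) (e j) - s (e j), y⟫_ℝ := by
  have hbias : BoundedInProbability P fun n ω => √n * ⟪s (empCov (sample X n ω)
      (spectralCutInverse (lamHat n (sample X n ω)) (eHat n (sample X n ω)) (e j))) -
        s (e j), y⟫_ℝ := by
    refine (h.boundedInProbability_residual hE j).mono (c := ‖s‖ * ‖y‖) (B := fun _ => ∅)
      (by simp) (Eventually.of_forall fun n ω _ => ?_)
    rw [← map_sub, abs_mul, abs_mul, abs_norm, norm_sub_rev]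
    have h1 := abs_real_inner_le_norm (s (empCov (sample X n ω)
      (spectralCutInverse (lamHat n (sample X n ω)) (eHat n (sample X n ω)) (e j)) - e j)) y
    have h2 := s.le_opNorm (empCov (sample X n ω)
      (spectralCutInverse (lamHat n (sample X n ω)) (eHat n (sample X n ω)) (e j)) - e j)
    calc _ ≤ |√n| * (‖s‖ * ‖empCov (sample X n ω) (spectralCutInverse
            (lamHat n (sample X n ω)) (eHat n (sample X n ω)) (e j)) - e j‖ * ‖y‖) := by
          gcongr
          exact h1.trans (by gcongr)
      _ = _ := by ring
  refine (hbias.add (h.boundedInProbability_noise hE j y)).mono (c := 1) (B := fun _ => ∅)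
    (by simp) (Eventually.of_forall fun n ω _ => le_of_eq ?_)
  rw [one_mul, estimator_apply s (sample X n ω) (fun i : Fin n => ε i ω), add_sub_right_comm,
    inner_add_left, mul_add, real_inner_smul_left, sum_inner]
  simp only [real_inner_smul_left]
  rw [← mul_assoc √n]
  congr 3
  rcases eq_or_ne (n : ℝ) 0 with h0 | h0
  · simp [h0]
  · have : √(n : ℝ) ≠ 0 := by
      rw [Ne, Real.sqrt_eq_zero (Nat.cast_nonneg n)]; exact h0
    field_simp
    rw [Real.sq_sqrt (Nat.cast_nonneg n)]

end IsRegressionSample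

end ErrorAtBasisVectors

/-! ### Anti-concentration against an uncorrelated shift -/

section AntiConcentration

/-- A truncated second moment of the standard Gaussian law close to `1`. -/
lemma exists_integral_min_sq_gaussianReal {η : ℝ} (hη : 0 < η) :
    ∃ L : ℝ, 0 < L ∧ 1 - η < ∫ t, min (t ^ 2) (L ^ 2) ∂(gaussianReal 0 1) := by
  have hsq : Integrable (fun t : ℝ => t ^ 2) (gaussianReal 0 1) :=
    (memLp_id_gaussianReal (μ := 0) (v := 1) 2).integrable_sq
  have h1 : ∫ t, t ^ 2 ∂(gaussianReal 0 1) = 1 := by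
    have h2 := variance_fun_id_gaussianReal (μ := 0) (v := 1)
    rw [variance_eq_integral aemeasurable_id'] at h2
    simpa using h2
  have h3 : Tendsto (fun m : ℕ => ∫ t, min (t ^ 2) ((m : ℝ) ^ 2) ∂(gaussianReal 0 1)) atTop
      (𝓝 (∫ t, t ^ 2 ∂(gaussianReal 0 1))) := by
    refine tendsto_integral_of_dominated_convergence (fun t => t ^ 2) (fun m => ?_) hsq
      (fun m => Eventually.of_forall fun t => ?_) (Eventually.of_forall fun t => ?_)
    · exact (by fun_prop : Continuous fun t : ℝ => min (t ^ 2) ((m : ℝ) ^ 2)).aestronglyMeasurable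
    · rw [Real.norm_of_nonneg (by positivity)]
      exact min_le_left _ _
    · refine tendsto_const_nhds.congr' ?_
      filter_upwards [eventually_ge_atTop ⌈|t|⌉₊] with m hm
      have : |t| ≤ m := (Nat.le_ceil _).trans (by exact_mod_cast hm)
      rw [min_eq_left]
      rw [← sq_abs t]
      exact pow_le_pow_left₀ (abs_nonneg t) this 2
  rw [h1] at h3
  obtain ⟨m, hm, hm0⟩ := ((h3.eventually_const_lt (by linarith : 1 - η < 1)).and
    (eventually_gt_atTop 0)).exists
  exact ⟨m, by exact_mod_cast hm0, hm⟩

/-- The truncation of `b` to `[-L, L]`. -/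
noncomputable def clip (L b : ℝ) : ℝ := max (-L) (min b L)

lemma abs_clip_le {L : ℝ} (hL : 0 < L) (b : ℝ) : |clip L b| ≤ L := by
  unfold clip
  rw [abs_le]
  exact ⟨le_max_left _ _, max_le (by linarith) (min_le_right _ _)⟩

lemma measurable_clip (L : ℝ) : Measurable (clip L) :=
  measurable_const.max (measurable_id.min measurable_const)

/-- If `w + b` is small, then `w (w + clip L b)` is at most a multiple of the tail
`w² - min (w²) L²`, up to a small term: either `w` lies in `[-L, L]` and truncating does not
move `b` away from `-w`, or `w` contributes to the tail. -/
lemma mul_add_clip_le {L κ : ℝ} (hL : 0 < L) (hκ : 0 ≤ κ) (w b : ℝ) :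
    w * (w + clip L b) ≤ 3 / 2 * (w ^ 2 - min (w ^ 2) (L ^ 2)) + κ * |w| +
      (if κ < |w + b| then 2 * L ^ 2 else 0) := by
  have hclip := abs_clip_le hL b
  have h2 := abs_le.1 hclip
  split_ifs with hB
  · have h3 : w ^ 2 ≤ (w ^ 2 - min (w ^ 2) (L ^ 2)) + L ^ 2 := by
      linarith [min_le_right (w ^ 2) (L ^ 2)]
    have h4 : w * clip L b ≤ (w ^ 2 + L ^ 2) / 2 := by
      have : clip L b ^ 2 ≤ L ^ 2 := by
        rw [← sq_abs (clip L b)]; exact pow_le_pow_left₀ (abs_nonneg _) hclip 2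
      nlinarith [sq_nonneg (w - clip L b)]
    nlinarith [mul_nonneg hκ (abs_nonneg w)]
  · push Not at hB
    have hb := abs_le.1 hB
    rw [add_zero]
    rcases le_or_gt (w ^ 2) (L ^ 2) with hw | hw
    · -- here `w` is its own truncation
      rw [min_eq_left hw, sub_self, mul_zero, zero_add]
      have hwL := abs_le.1 (abs_le_of_sq_le_sq hw hL.le)
      have h5 : |w + clip L b| ≤ κ := by
        unfold clip
        rw [abs_le]
        constructor
        · rcases le_total b L with h | h
          · rw [min_eq_left h]; linarith [le_max_right (-L) b, hb.1]
          · rw [min_eq_right h]; linarith [le_max_right (-L) L, hwL.1]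
        · have : max (-L) (min b L) ≤ κ - w :=
            max_le (by linarith [hwL.2]) ((min_le_left _ _).trans (by linarith [hb.2]))
          linarith
      calc w * (w + clip L b) ≤ |w * (w + clip L b)| := le_abs_self _
        _ = |w + clip L b| * |w| := by rw [abs_mul, mul_comm]
        _ ≤ κ * |w| := by gcongr
    · rw [min_eq_right hw.le]
      have hwL : L < |w| := lt_of_pow_lt_pow_left₀ 2 (abs_nonneg w) (by rwa [sq_abs])
      have h5 : |w + clip L b| ≤ |w| - L + κ := by
        unfold clip
        rcases le_total 0 w with h0 | h0
        · rw [abs_of_nonneg h0] at hwL ⊢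
          rw [abs_le]
          constructor
          · linarith [le_max_left (-L) (min b L)]
          · have : max (-L) (min b L) ≤ κ - L :=
              max_le (by linarith) ((min_le_left _ _).trans (by linarith [hb.2]))
            linarith
        · rw [abs_of_nonpos h0] at hwL ⊢
          rw [abs_le]
          constructor
          · have : L - κ ≤ max (-L) (min b L) :=
              le_max_of_le_right (le_min (by linarith [hb.1]) (by linarith))
            linarith
          · have : max (-L) (min b L) ≤ L := max_le (by linarith) (min_le_right _ _)
            linarith
      calc w * (w + clip L b) ≤ |w * (w + clip L b)| := le_abs_self _
        _ = |w| * |w + clip L b| := abs_mul _ _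
        _ ≤ |w| * (|w| - L + κ) := by gcongr
        _ ≤ _ := by
          have : |w| ^ 2 = w ^ 2 := sq_abs w
          nlinarith

/-- Anti-concentration. A sequence `w n` of normalized variables with a Gaussian limit cannot be
close to `-b n`, if `w n` is uncorrelated with the truncations of `b n`: the probability that they
are at distance at least `1 / 4` is bounded below by a universal constant. In the application `b n`
is a function of the covariates, over which there is no control. -/
lemma exists_le_measure_abs_add :
    ∃ p L : ℝ, 0 < p ∧ 0 < L ∧ ∀ {Ω : Type*} [MeasurableSpace Ω] (P : Measure Ω)
      [IsProbabilityMeasure P] (w b : ℕ → Ω → ℝ), (∀ n, Measurable (b n)) →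
      (∀ n, Measurable (w n)) → (∀ n, MemLp (w n) 2 P) →
      (∀ᶠ n in atTop, ∫ ω, w n ω ^ 2 ∂P = 1) →
      (∀ n, ∫ ω, w n ω * clip L (b n ω) ∂P = 0) →
      TendstoInDistribution w atTop (id : ℝ → ℝ) (fun _ => P) (gaussianReal 0 1) →
      ∀ᶠ n in atTop, p ≤ P.real {ω | 1 / 4 < |w n ω + b n ω|} := by
  -- `E[w (w + clip L b)] = 1`, while `3 / 2 * (1 / 12) + 1 / 4 ≤ 1 / 2`: the event has to
  -- contribute at least `1 / 2`, hence to have probability at least `1 / (4 * L ^ 2)`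
  obtain ⟨L, hL, hLη⟩ := exists_integral_min_sq_gaussianReal (η := 1 / 12) (by norm_num)
  refine ⟨1 / (4 * L ^ 2), L, by positivity, hL, ?_⟩
  intro Ω _ P _ w b hb hw hw2 hw1 hwb hlim
  let φ : BoundedContinuousFunction ℝ ℝ := BoundedContinuousFunction.ofNormedAddCommGroup
    (fun t => min (t ^ 2) (L ^ 2)) (by fun_prop) (L ^ 2) (fun t => by
      rw [Real.norm_of_nonneg (by positivity)]
      exact min_le_right _ _)
  have h1 := ProbabilityMeasure.tendsto_iff_forall_integral_tendsto.1 hlim.tendsto φ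
  have h2 : ∀ n, ∫ t, φ t ∂(P.map (w n)) = ∫ ω, min (w n ω ^ 2) (L ^ 2) ∂P := fun n =>
    integral_map (hw n).aemeasurable φ.continuous.aestronglyMeasurable
  simp only [ProbabilityMeasure.coe_mk, h2, Measure.map_id] at h1
  filter_upwards [h1.eventually_const_lt hLη, hw1] with n h3 h4
  have hint : Integrable (fun ω => w n ω ^ 2) P := (hw2 n).integrable_sq
  have hwi : Integrable (w n) P := (hw2 n).integrable (by norm_num)
  have hmin : Integrable (fun ω => min (w n ω ^ 2) (L ^ 2)) P := by
    refine Integrable.of_bound (((hw n).pow_const 2).min measurable_const).aestronglyMeasurable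
      (L ^ 2) (Eventually.of_forall fun ω => ?_)
    rw [Real.norm_of_nonneg (by positivity)]
    exact min_le_right _ _
  have hcl : Integrable (fun ω => w n ω * clip L (b n ω)) P := by
    refine hwi.mul_bdd (c := L) ((measurable_clip L).comp (hb n)).aestronglyMeasurable
      (Eventually.of_forall fun ω => ?_)
    rw [Real.norm_eq_abs]
    exact abs_clip_le hL _
  have hBm : MeasurableSet {ω | 1 / 4 < |w n ω + b n ω|} :=
    measurableSet_lt measurable_const (measurable_abs.comp ((hw n).add (hb n)))
  have hite : ∀ ω, (if 1 / 4 < |w n ω + b n ω| then 2 * L ^ 2 else 0) =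
      {ω | 1 / 4 < |w n ω + b n ω|}.indicator (fun _ => 2 * L ^ 2) ω := fun ω => by
    simp [Set.indicator_apply]
  have hind : Integrable ({ω | 1 / 4 < |w n ω + b n ω|}.indicator fun _ : Ω => 2 * L ^ 2) P :=
    (integrable_const _).indicator hBm
  have habs : ∫ ω, |w n ω| ∂P ≤ 1 := by
    have h5 : ∫ ω, |w n ω| ∂P ≤ ∫ ω, (1 + w n ω ^ 2) / 2 ∂P := by
      refine integral_mono hwi.abs (((integrable_const 1).add hint).div_const 2) fun ω => ?_
      have := sq_nonneg (|w n ω| - 1)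
      have h6 := sq_abs (w n ω)
      simp only
      nlinarith
    rw [integral_div, integral_add (integrable_const 1) hint, h4] at h5
    simpa using h5
  have hmain : ∫ ω, w n ω * (w n ω + clip L (b n ω)) ∂P ≤
      ∫ ω, (3 / 2 * (w n ω ^ 2 - min (w n ω ^ 2) (L ^ 2)) + 1 / 4 * |w n ω| +
        {ω | 1 / 4 < |w n ω + b n ω|}.indicator (fun _ => 2 * L ^ 2) ω) ∂P := by
    refine integral_mono ?_ ((((hint.sub hmin).const_mul _).add (hwi.abs.const_mul _)).add hind)
      fun ω => ?_
    · refine (hint.add hcl).congr (Eventually.of_forall fun ω => ?_)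
      simp only [Pi.add_apply]
      ring
    · have := mul_add_clip_le hL (by norm_num : (0 : ℝ) ≤ 1 / 4) (w n ω) (b n ω)
      rw [hite] at this
      exact this
  have hleft : ∫ ω, w n ω * (w n ω + clip L (b n ω)) ∂P = 1 := by
    have : ∀ ω, w n ω * (w n ω + clip L (b n ω)) = w n ω ^ 2 + w n ω * clip L (b n ω) :=
      fun ω => by ring
    simp_rw [this]
    rw [integral_add hint hcl, h4, hwb, add_zero]
  have hright : ∫ ω, (3 / 2 * (w n ω ^ 2 - min (w n ω ^ 2) (L ^ 2)) + 1 / 4 * |w n ω| +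
        {ω | 1 / 4 < |w n ω + b n ω|}.indicator (fun _ => 2 * L ^ 2) ω) ∂P =
      3 / 2 * (1 - ∫ ω, min (w n ω ^ 2) (L ^ 2) ∂P) + 1 / 4 * ∫ ω, |w n ω| ∂P +
        P.real {ω | 1 / 4 < |w n ω + b n ω|} * (2 * L ^ 2) := by
    have i1 : Integrable (fun ω => 3 / 2 * (w n ω ^ 2 - min (w n ω ^ 2) (L ^ 2))) P :=
      (hint.sub hmin).const_mul _
    have i2 : Integrable (fun ω => 1 / 4 * |w n ω|) P := hwi.abs.const_mul _
    have i12 : Integrable (fun ω => 3 / 2 * (w n ω ^ 2 - min (w n ω ^ 2) (L ^ 2)) +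
        1 / 4 * |w n ω|) P := i1.add i2
    rw [integral_add i12 hind, integral_add i1 i2, integral_const_mul, integral_const_mul,
      integral_sub hint hmin, h4, integral_indicator_const _ hBm, smul_eq_mul]
  rw [hleft, hright] at hmain
  rw [div_le_iff₀ (by positivity)]
  nlinarith

end AntiConcentration

/-! ### The score in an eigendirection -/

section Score

variable {H : Type*} [NormedAddCommGroup H] [InnerProductSpace ℝ H] [CompleteSpace H]
  [MeasurableSpace H] [BorelSpace H] {Ω : Type*} [MeasurableSpace Ω]

/-- The normalized empirical covariance between the noises in the direction `y` and the covariates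
in the direction `u`. -/
noncomputable def score (X ε : ℕ → Ω → H) (u y : H) (n : ℕ) (ω : Ω) : ℝ :=
  ∑ i : Fin n, (√n)⁻¹ * ⟪X i ω, u⟫_ℝ * ⟪ε i ω, y⟫_ℝ

variable {P : Measure Ω} [IsProbabilityMeasure P] {X ε : ℕ → Ω → H} {lam : ℕ → ℝ}
  {e : HilbertBasis ℕ ℝ H} {k : ℕ → ℕ} {lamHat : (n : ℕ) → (Fin n → H) → Fin (k n) → ℝ}
  {eHat : (n : ℕ) → (Fin n → H) → Fin (k n) → H}

namespace IsRegressionSample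

/-- A noise that does not vanish has variance `1` in some direction, up to scaling. -/
lemma exists_integral_noise_sq_eq_one (h : IsRegressionSample P X ε lam e)
    (hε : ¬ (ε 0 =ᵐ[P] 0)) : ∃ y : H, ∫ ω, ⟪ε 0 ω, y⟫_ℝ ^ 2 ∂P = 1 := by
  have hint : ∀ y : H, Integrable (fun ω => ⟪ε 0 ω, y⟫_ℝ ^ 2) P := fun y =>
    (h.memLp_ε.inner_const y).integrable_sq
  obtain ⟨l, hl⟩ : ∃ l, ∫ ω, ⟪ε 0 ω, e l⟫_ℝ ^ 2 ∂P ≠ 0 := by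
    by_contra! hcon
    have h1 : ∀ᵐ ω ∂P, ∀ l, ⟪ε 0 ω, e l⟫_ℝ = 0 := by
      refine ae_all_iff.2 fun l => ?_
      filter_upwards [(integral_eq_zero_iff_of_nonneg (fun _ => sq_nonneg _) (hint (e l))).1
        (hcon l)] with ω hω
      exact pow_eq_zero_iff two_ne_zero |>.1 hω
    refine hε ?_
    filter_upwards [h1] with ω hω
    refine (map_eq_zero_iff e.repr e.repr.injective).1 ?_
    ext l
    rw [e.repr_apply_apply, real_inner_comm, hω l]
    rfl
  have hpos : 0 < ∫ ω, ⟪ε 0 ω, e l⟫_ℝ ^ 2 ∂P :=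
    lt_of_le_of_ne (integral_nonneg fun _ => sq_nonneg _) (Ne.symm hl)
  refine ⟨(√(∫ ω, ⟪ε 0 ω, e l⟫_ℝ ^ 2 ∂P))⁻¹ • e l, ?_⟩
  simp_rw [real_inner_smul_right, mul_pow, inv_pow, Real.sq_sqrt hpos.le]
  rw [integral_const_mul, inv_mul_cancel₀ hl]

variable {y : H}

lemma integral_normalized_coord_sq (h : IsRegressionSample P X ε lam e) (j i : ℕ) :
    ∫ ω, ⟪X i ω, (√(lam j))⁻¹ • e j⟫_ℝ ^ 2 ∂P = 1 := by
  have := secondCountableTopology_of_hilbertBasis e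
  have h1 := ((h.identDistrib_X i).comp (u := fun x => ⟪x, (√(lam j))⁻¹ • e j⟫_ℝ ^ 2)
    (measurable_id.inner_const.pow_const 2)).integral_eq
  simp only [Function.comp_def] at h1
  rw [h1]
  simp_rw [real_inner_smul_right, mul_pow, inv_pow, Real.sq_sqrt (h.lam_pos j).le]
  rw [integral_const_mul, h.integral_coord_sq, inv_mul_cancel₀ (h.lam_pos j).ne']

lemma memLp_normalized_coord (h : IsRegressionSample P X ε lam e) (i j : ℕ) :
    MemLp (fun ω => ⟪X i ω, (√(lam j))⁻¹ • e j⟫_ℝ) 2 P := by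
  simp_rw [real_inner_smul_right]
  exact (h.memLp_coord i j).const_mul _

lemma score_memLp_sq (h : IsRegressionSample P X ε lam e) (j : ℕ)
    (hy : ∫ ω, ⟪ε 0 ω, y⟫_ℝ ^ 2 ∂P = 1) (n : ℕ) :
    MemLp (score X ε ((√(lam j))⁻¹ • e j) y n) 2 P ∧
      (n ≠ 0 → ∫ ω, score X ε ((√(lam j))⁻¹ • e j) y n ω ^ 2 ∂P = 1) := by
  have := secondCountableTopology_of_hilbertBasis e
  obtain ⟨h1, h2⟩ := h.integral_sum_mul_noise_sq y (n := n)
    (F := fun i x => (√n)⁻¹ * ⟪x i, (√(lam j))⁻¹ • e j⟫_ℝ)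
    (fun i => ((measurable_pi_apply i).inner_const).const_mul _)
    (fun i => (h.memLp_normalized_coord i j).const_mul _)
  refine ⟨h1, fun hn => h2.trans ?_⟩
  simp_rw [mul_pow, integral_const_mul, h.integral_normalized_coord_sq, hy]
  have : (n : ℝ) ≠ 0 := by exact_mod_cast hn
  rw [inv_pow, Real.sq_sqrt (Nat.cast_nonneg n)]
  simp [this]

lemma measurable_score (h : IsRegressionSample P X ε lam e) (u y : H) (n : ℕ) :
    Measurable (score X ε u y n) := by
  have := secondCountableTopology_of_hilbertBasis e
  exact Finset.measurable_sum _ fun (i : Fin n) _ =>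
    (((h.measurable_X i).inner_const).const_mul _).mul ((h.measurable_ε i).inner_const)

/-- The score is uncorrelated with every bounded function of the covariates. -/
lemma integral_score_mul (h : IsRegressionSample P X ε lam e) (j : ℕ) {n : ℕ}
    {g : (Fin n → H) → ℝ} (hg : Measurable g) {L : ℝ} (hL : ∀ x, |g x| ≤ L) :
    ∫ ω, score X ε ((√(lam j))⁻¹ • e j) y n ω * g (sample X n ω) ∂P = 0 := by
  have := secondCountableTopology_of_hilbertBasis e
  set u := (√(lam j))⁻¹ • e j
  have hF : ∀ i : Fin n, Measurable fun x : Fin n → H => (√n)⁻¹ * ⟪x i, u⟫_ℝ * g x :=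
    fun i => (((measurable_pi_apply i).inner_const).const_mul _).mul hg
  have hFL : ∀ i : Fin n, MemLp (fun ω => (√n)⁻¹ * ⟪X i ω, u⟫_ℝ * g (sample X n ω)) 2 P :=
    fun i => by
    refine (((h.memLp_normalized_coord i j).const_mul ((√n)⁻¹)).norm.const_mul L).mono
      ((hF i).comp (h.measurable_sample n)).aestronglyMeasurable
      (Eventually.of_forall fun ω => ?_)
    rw [norm_mul, mul_comm]
    refine (mul_le_mul_of_nonneg_right ((Real.norm_eq_abs _).trans_le (hL _))
      (norm_nonneg _)).trans ?_
    exact le_of_le_of_eq (le_abs_self _) (Real.norm_eq_abs _).symm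
  have hint : ∀ i : Fin n, Integrable
      (fun ω => ((√n)⁻¹ * ⟪X i ω, u⟫_ℝ * g (sample X n ω)) * ⟪ε i ω, y⟫_ℝ) P := fun i => by
    refine (hFL i).integrable_mul (q := 2) ?_
    exact ((h.ident i).comp measurable_snd).symm.memLp_iff.1 h.memLp_ε |>.inner_const y
  have h1 : ∀ ω, score X ε u y n ω * g (sample X n ω) =
      ∑ i : Fin n, ((√n)⁻¹ * ⟪X i ω, u⟫_ℝ * g (sample X n ω)) * ⟪ε i ω, y⟫_ℝ := fun ω => by
    rw [score, Finset.sum_mul]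
    exact Finset.sum_congr rfl fun i _ => by ring
  simp_rw [h1]
  rw [integral_finsetSum _ fun i _ => hint i]
  exact Finset.sum_eq_zero fun i _ => h.integral_mul_noise y i (hF i)

/-- The score is asymptotically standard Gaussian. -/
lemma tendstoInDistribution_score (h : IsRegressionSample P X ε lam e) (j : ℕ)
    (hy : ∫ ω, ⟪ε 0 ω, y⟫_ℝ ^ 2 ∂P = 1) :
    TendstoInDistribution (score X ε ((√(lam j))⁻¹ • e j) y) atTop (id : ℝ → ℝ) (fun _ => P)
      (gaussianReal 0 1) := by
  have := secondCountableTopology_of_hilbertBasis e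
  set u := (√(lam j))⁻¹ • e j with hu
  have hm : Measurable fun p : H × H => ⟪p.1, u⟫_ℝ * ⟪p.2, y⟫_ℝ :=
    (measurable_fst.inner_const).mul (measurable_snd.inner_const)
  have h1 := tendstoInDistribution_inv_sqrt_mul_sum (P := P) (P' := gaussianReal 0 1)
    (Y := (id : ℝ → ℝ)) (X := fun i ω => ⟪X i ω, u⟫_ℝ * ⟪ε i ω, y⟫_ℝ) HasLaw.id ?_ ?_
    (h.indep.comp (fun _ => fun p : H × H => ⟪p.1, u⟫_ℝ * ⟪p.2, y⟫_ℝ) fun _ => hm)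
    (fun i => (h.ident i).comp hm)
  · have h2 : score X ε u y = fun (n : ℕ) ω => (√n)⁻¹ * ∑ i ∈ Finset.range n,
        ⟪X i ω, u⟫_ℝ * ⟪ε i ω, y⟫_ℝ := by
      funext n ω
      rw [score, Finset.sum_range, Finset.mul_sum]
      exact Finset.sum_congr rfl fun i _ => mul_assoc _ _ _
    rw [h2]
    exact h1
  · exact h.integral_mul_noise y (n := 1) 0 (F := fun x => ⟪x 0, u⟫_ℝ)
      ((measurable_pi_apply _).inner_const)
  · have h3 := (h.score_memLp_sq j hy 1).2 one_ne_zero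
    simpa [score] using h3

end IsRegressionSample

end Score

/-! ### The operator norm of the error is not of order `1 / √n` -/

section NotTight

variable {H : Type*} [NormedAddCommGroup H] [InnerProductSpace ℝ H] [CompleteSpace H]
  [MeasurableSpace H] [BorelSpace H] {Ω : Type*} [MeasurableSpace Ω]
  {P : Measure Ω} [IsProbabilityMeasure P] {X ε : ℕ → Ω → H} {lam : ℕ → ℝ}
  {e : HilbertBasis ℕ ℝ H} {k : ℕ → ℕ} {lamHat : (n : ℕ) → (Fin n → H) → Fin (k n) → ℝ}
  {eHat : (n : ℕ) → (Fin n → H) → Fin (k n) → H}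

/-- The part of `u` that the spectral cut of the empirical covariance operator does not see. -/
noncomputable def cutResidual {n k : ℕ} (x : Fin n → H) (μ : Fin k → ℝ) (v : Fin k → H)
    (u : H) : H :=
  u - empCov x (spectralCutInverse μ v u)

namespace IsRegressionSample

variable {y : H}

lemma memLp_norm (h : IsRegressionSample P X ε lam e) (i : ℕ) :
    MemLp (fun ω => ‖X i ω‖) 2 P :=
  ((h.identDistrib_X i).symm.memLp_iff.1 h.memLp_X).norm

lemma integral_norm_sq (h : IsRegressionSample P X ε lam e) (i : ℕ) :
    ∫ ω, ‖X i ω‖ ^ 2 ∂P = ∫ ω, ‖X 0 ω‖ ^ 2 ∂P :=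
  ((h.identDistrib_X i).comp (u := fun x => ‖x‖ ^ 2) (measurable_norm.pow_const 2)).integral_eq

/-- The contribution to the noise of the part of `u` outside the range of the spectral cut is
negligible, as `k n` tends to infinity. -/
lemma tendsto_measure_noise_cutResidual (h : IsRegressionSample P X ε lam e)
    (hE : IsEmpiricalEigensystem k lamHat eHat) (u y : H) {δ : ℝ} (hδ : 0 < δ) :
    Tendsto (fun n => P {ω | δ ≤ |∑ i : Fin n, (√n)⁻¹ * ⟪X i ω, cutResidual (sample X n ω)
      (lamHat n (sample X n ω)) (eHat n (sample X n ω)) u⟫_ℝ * ⟪ε i ω, y⟫_ℝ|}) atTop (𝓝 0) := by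
  have := secondCountableTopology_of_hilbertBasis e
  set m := ∫ ω, ‖X 0 ω‖ ^ 2 ∂P with hm
  set τ := ∫ ω, ⟪ε 0 ω, y⟫_ℝ ^ 2 ∂P with hτ
  have hτ0 : 0 ≤ τ := integral_nonneg fun _ => sq_nonneg _
  have hlim : Tendsto (fun n => ENNReal.ofReal (τ * ((k n : ℝ)⁻¹ * m * ‖u‖ ^ 2) / δ ^ 2)) atTop
      (𝓝 0) := by
    rw [← ENNReal.ofReal_zero]
    refine ENNReal.tendsto_ofReal ?_
    have h1 : Tendsto (fun n => ((k n : ℝ))⁻¹) atTop (𝓝 0) :=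
      tendsto_inv_atTop_zero.comp (tendsto_natCast_atTop_atTop.comp hE.tendsto_k)
    simpa using ((((h1.mul_const m).mul_const (‖u‖ ^ 2)).const_mul τ).div_const (δ ^ 2))
  refine tendsto_of_tendsto_of_tendsto_of_le_of_le' tendsto_const_nhds hlim
    (Eventually.of_forall fun _ => zero_le) ?_
  filter_upwards [hE.tendsto_k.eventually_gt_atTop 0, eventually_gt_atTop 0] with n hk hn
  obtain ⟨l, hl⟩ := hE.exists_smallest hk
  have hnn : (0 : ℝ) < n := by exact_mod_cast hn
  have hkk : (0 : ℝ) < k n := by exact_mod_cast hk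
  let w : (Fin n → H) → H := fun x => cutResidual x (lamHat n x) (eHat n x) u
  have hw : Measurable w := measurable_const.sub
    (IsEmpiricalEigensystem.measurable_empCov n
      (hE.measurable_spectralCutInverse n measurable_const))
  have hwu : ∀ x, ‖w x‖ ≤ ‖u‖ := fun x => (hE.leading n x).norm_residual_le u
  let F : Fin n → (Fin n → H) → ℝ := fun i x => (√n)⁻¹ * ⟪x i, w x⟫_ℝ
  have hF : ∀ i, Measurable (F i) := fun i => ((measurable_pi_apply i).inner hw).const_mul _
  have hFL : ∀ i, MemLp (fun ω => F i fun l => X l ω) 2 P := fun i => by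
    refine ((h.memLp_norm i).const_mul ((√n)⁻¹ * ‖u‖)).mono
      ((hF i).comp (h.measurable_sample n)).aestronglyMeasurable (Eventually.of_forall fun ω => ?_)
    rw [norm_mul, norm_mul, norm_mul, norm_norm, norm_norm, mul_assoc]
    refine mul_le_mul_of_nonneg_left ?_ (norm_nonneg _)
    refine (norm_inner_le_norm _ _).trans ?_
    rw [mul_comm]
    exact mul_le_mul_of_nonneg_right (hwu _) (norm_nonneg _)
  have hFsq : ∀ x, ∑ i, F i x ^ 2 ≤ (k n : ℝ)⁻¹ * ((n : ℝ)⁻¹ * ∑ i, ‖x i‖ ^ 2) * ‖u‖ ^ 2 :=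
    fun x => by
    have h1 : ∑ i, F i x ^ 2 = ⟪empCov x (w x), w x⟫_ℝ := by
      rw [inner_empCov_self, Finset.mul_sum]
      refine Finset.sum_congr rfl fun i _ => ?_
      rw [mul_pow, inv_pow, Real.sq_sqrt (Nat.cast_nonneg n)]
    have h2 := (hE.leading n x).inner_empCov_residual_le (hl x) u
    have h3 := (hE.leading n x).mul_eigenvalue_le (hl x)
    have h4 : lamHat n x l ≤ (k n : ℝ)⁻¹ * ((n : ℝ)⁻¹ * ∑ i, ‖x i‖ ^ 2) := by
      rw [inv_mul_eq_div, le_div_iff₀ hkk, mul_comm]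
      exact h3
    rw [h1]
    refine h2.trans (mul_le_mul h4 (pow_le_pow_left₀ (norm_nonneg _) (hwu x) 2) (sq_nonneg _)
      (by positivity))
  obtain ⟨h1, h2⟩ := h.integral_sum_mul_noise_sq y hF hFL
  refine measure_lt_abs_le (f := fun ω => ∑ i : Fin n, F i (sample X n ω) * ⟪ε i ω, y⟫_ℝ)
    (Finset.measurable_sum _ fun i _ => ((hF i).comp (h.measurable_sample n)).mul
        ((h.measurable_ε i).inner_const)) hδ ?_
  rw [← ofReal_integral_eq_lintegral_ofReal h1.integrable_sq
    (Eventually.of_forall fun _ => sq_nonneg _), h2]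
  refine ENNReal.ofReal_le_ofReal (mul_le_mul_of_nonneg_left ?_ hτ0)
  rw [← integral_finsetSum _ fun i _ => (hFL i).integrable_sq]
  have hsq : ∀ i : Fin n, Integrable (fun ω => ‖X i ω‖ ^ 2) P :=
    fun i => (h.memLp_norm i).integrable_sq
  refine (integral_mono (integrable_finsetSum _ fun i _ => (hFL i).integrable_sq)
    ((((integrable_finsetSum _ fun i _ => hsq i).const_mul ((n : ℝ)⁻¹)).const_mul
      ((k n : ℝ)⁻¹)).mul_const (‖u‖ ^ 2)) fun ω => hFsq (sample X n ω)).trans (le_of_eq ?_)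
  rw [integral_mul_const, integral_const_mul, integral_const_mul,
    integral_finsetSum _ fun i _ => hsq i]
  simp_rw [h.integral_norm_sq]
  rw [← hm, Finset.sum_const, Finset.card_univ, Fintype.card_fin, nsmul_eq_mul,
    inv_mul_cancel_left₀ hnn.ne']

/-- With probability tending to one, `Γ_n e_j` is at most twice as large as `Γ e_j`. -/
lemma tendsto_measure_norm_empCov (h : IsRegressionSample P X ε lam e) (j : ℕ) :
    Tendsto (fun n => P {ω | 2 * lam j < ‖empCov (sample X n ω) (e j)‖}) atTop (𝓝 0) := by
  have hl := h.lam_pos j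
  have hc : Tendsto (fun n : ℕ => (√(n : ℝ))⁻¹) atTop (𝓝 0) :=
    tendsto_inv_atTop_zero.comp (Real.tendsto_sqrt_atTop.comp tendsto_natCast_atTop_atTop)
  have hB := (h.tendsto_measure_sum_coord_sq j (δ := lam j / 2) (by positivity)).add
    ((h.boundedInProbability_cross j).tendsto_measure_mul id tendsto_id hc
      (δ := lam j / 2) (by positivity))
  rw [add_zero] at hB
  refine tendsto_of_tendsto_of_tendsto_of_le_of_le' tendsto_const_nhds hB
    (Eventually.of_forall fun _ => zero_le) ?_
  filter_upwards [eventually_gt_atTop 0] with n hn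
  refine (measure_mono fun ω hω => ?_).trans (measure_union_le _ _)
  by_contra hcon
  simp only [Set.mem_union, Set.mem_ofPred_eq, not_or, not_le, id] at hcon hω
  obtain ⟨h1, h2⟩ := hcon
  have hnn : 0 < √(n : ℝ) := Real.sqrt_pos.2 (by exact_mod_cast hn)
  rw [inv_mul_cancel_left₀ hnn.ne', abs_norm] at h2
  rw [empCov_eq_add_removeDirection] at hω
  have h3 := norm_add_le (((n : ℝ)⁻¹ * ∑ i, ⟪sample X n ω i, e j⟫_ℝ ^ 2) • e j)
    ((n : ℝ)⁻¹ • ∑ i, ⟪sample X n ω i, e j⟫_ℝ • removeDirection (e j) (sample X n ω) i)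
  rw [norm_smul, e.orthonormal.1 j, mul_one, Real.norm_of_nonneg (by positivity)] at h3
  have h4 := (abs_lt.1 h1).2
  linarith

/-- The error of the estimator is not of order `1 / √n` in operator norm, whatever the
deterministic centering. Applied to `Γ_n e_j`, which has norm about `λ_j`, the rescaled error is the
score in the direction `e_j`, of size `√λ_j`, plus a function of the covariates; by
anti-concentration the latter cannot compensate the former. -/
theorem not_boundedInProbability_norm (h : IsRegressionSample P X ε lam e)
    (hE : IsEmpiricalEigensystem k lamHat eHat) (hε : ¬ (ε 0 =ᵐ[P] 0)) (s : H →L[ℝ] H)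
    (C : ℕ → H →L[ℝ] H) :
    ¬ BoundedInProbability P fun n ω => √n * ‖estimator (fun i : Fin n => s (X i ω) + ε i ω)
      (sample X n ω) (lamHat n (sample X n ω)) (eHat n (sample X n ω)) - C n‖ := by
  have := secondCountableTopology_of_hilbertBasis e
  intro hbdd
  obtain ⟨y, hy⟩ := h.exists_integral_noise_sq_eq_one hε
  obtain ⟨p, L, hp, hL, hanti⟩ := exists_le_measure_abs_add
  have hp4 : 0 < ENNReal.ofReal (p / 4) := ENNReal.ofReal_pos.2 (by positivity)
  obtain ⟨K, hK0, hK⟩ := hbdd _ hp4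
  -- a direction in which the covariate is so small that `K` times its norm is negligible
  obtain ⟨j, hj⟩ : ∃ j, K * (2 * √(lam j)) * ‖y‖ ≤ 1 / 8 := by
    have h1 : Tendsto (fun j => K * (2 * √(lam j)) * ‖y‖) atTop (𝓝 0) := by
      have := ((h.summable_lam.tendsto_atTop_zero.sqrt.const_mul 2).const_mul K).mul_const ‖y‖
      simpa using this
    exact (h1.eventually_le_const (by norm_num : (0 : ℝ) < 1 / 8)).exists
  have hl := h.lam_pos j
  have hsl : 0 < √(lam j) := Real.sqrt_pos.2 hl
  set u := (√(lam j))⁻¹ • e j with hu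
  -- the part of the rescaled error at `Γ_n u` that depends on the covariates only
  let g : (n : ℕ) → (Fin n → H) → ℝ := fun n x => √n * ⟪s (empCov x
    (spectralCutInverse (lamHat n x) (eHat n x) (empCov x u))) - C n (empCov x u), y⟫_ℝ
  have hg : ∀ n, Measurable (g n) := fun n => by
    have h1 : Measurable fun x : Fin n → H => empCov x u :=
      IsEmpiricalEigensystem.measurable_empCov n measurable_const
    have h2 := IsEmpiricalEigensystem.measurable_empCov n (hE.measurable_spectralCutInverse n h1)
    exact ((s.continuous.measurable.comp h2).sub
      ((C n).continuous.measurable.comp h1)).inner_const.const_mul _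
  have hev := hanti P (score X ε u y) (fun n ω => g n (sample X n ω))
    (fun n => (hg n).comp (h.measurable_sample n)) (fun n => h.measurable_score u y n)
    (fun n => (h.score_memLp_sq j hy n).1)
    ((eventually_ne_atTop 0).mono fun n hn => (h.score_memLp_sq j hy n).2 hn)
    (fun n => h.integral_score_mul j ((measurable_clip L).comp (hg n))
      fun x => abs_clip_le hL _)
    (h.tendstoInDistribution_score j hy)
  have hev1 := (h.tendsto_measure_norm_empCov j).eventually_le_const hp4
  have hev2 := (h.tendsto_measure_noise_cutResidual hE u y
    (by norm_num : (0 : ℝ) < 1 / 8)).eventually_le_const hp4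
  obtain ⟨n, h1, h2, h3, h4, hn⟩ := (hev.and (hK.and (hev1.and (hev2.and
    (eventually_ne_atTop 0))))).exists
  set Sh : Ω → H →L[ℝ] H := fun ω => estimator (fun i : Fin n => s (X i ω) + ε i ω)
      (sample X n ω) (lamHat n (sample X n ω)) (eHat n (sample X n ω)) with hSh
  set r : Ω → ℝ := fun ω => ∑ i : Fin n, (√n)⁻¹ * ⟪X i ω, cutResidual (sample X n ω)
      (lamHat n (sample X n ω)) (eHat n (sample X n ω)) u⟫_ℝ * ⟪ε i ω, y⟫_ℝ with hr
  -- `T† T u` is `u` up to the cut residual, so that the noise part of the error at `T u` is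
  -- the score minus a remainder
  have hdec : ∀ ω, score X ε u y n ω + g n (sample X n ω) =
      √n * ⟪(Sh ω - C n) (empCov (sample X n ω) u), y⟫_ℝ + r ω := fun ω => by
    have hs : √(n : ℝ) * (n : ℝ)⁻¹ = (√n)⁻¹ := by
      have hnn : (0 : ℝ) < n := by exact_mod_cast Nat.pos_of_ne_zero hn
      have := Real.sqrt_pos.2 hnn
      field_simp
      exact Real.sq_sqrt hnn.le
    rw [sub_apply, hSh]
    simp only
    rw [estimator_apply s (sample X n ω) (fun i : Fin n => ε i ω),
      (hE.leading n (sample X n ω)).spectralCutInverse_empCov, add_sub_right_comm, inner_add_left,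
      mul_add, real_inner_smul_left, sum_inner, ← mul_assoc, hs]
    simp only [g, (hE.leading n (sample X n ω)).spectralCutInverse_empCov]
    rw [add_comm, add_assoc]
    congr 1
    rw [score, hr, Finset.mul_sum, ← Finset.sum_add_distrib]
    refine Finset.sum_congr rfl fun i _ => ?_
    rw [real_inner_smul_left, cutResidual, inner_sub_right]
    ring
  have hsub : {ω | 1 / 4 < |score X ε u y n ω + g n (sample X n ω)|} ⊆
      ({ω | K < |√n * ‖Sh ω - C n‖|} ∪
        {ω | 2 * lam j < ‖empCov (sample X n ω) (e j)‖}) ∪ {ω | 1 / 8 ≤ |r ω|} := by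
    intro ω hω
    by_contra hcon
    simp only [Set.mem_union, Set.mem_ofPred_eq, not_or, not_le, not_lt] at hcon hω
    obtain ⟨⟨c1, c2⟩, c3⟩ := hcon
    rw [hdec] at hω
    have hTu : ‖empCov (sample X n ω) u‖ ≤ 2 * √(lam j) := by
      rw [hu, map_smul, norm_smul, Real.norm_of_nonneg (by positivity), inv_mul_le_iff₀ hsl]
      nlinarith [Real.mul_self_sqrt hl.le]
    have h5 : |√n * ⟪(Sh ω - C n) (empCov (sample X n ω) u), y⟫_ℝ| ≤
        K * (2 * √(lam j)) * ‖y‖ := by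
      rw [abs_mul, abs_of_nonneg (Real.sqrt_nonneg _)]
      calc _ ≤ √n * (‖Sh ω - C n‖ * ‖empCov (sample X n ω) u‖ * ‖y‖) := by
            gcongr
            exact (abs_real_inner_le_norm _ _).trans
              (mul_le_mul_of_nonneg_right (ContinuousLinearMap.le_opNorm _ _) (norm_nonneg _))
        _ = (√n * ‖Sh ω - C n‖) * ‖empCov (sample X n ω) u‖ * ‖y‖ := by ring
        _ ≤ _ := by
            have := (le_abs_self _).trans c1
            gcongr
    have h6 := abs_add_le (√n * ⟪(Sh ω - C n) (empCov (sample X n ω) u), y⟫_ℝ) (r ω)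
    linarith
  have h7 : P {ω | 1 / 4 < |score X ε u y n ω + g n (sample X n ω)|} ≤
      ENNReal.ofReal (p / 4) + ENNReal.ofReal (p / 4) + ENNReal.ofReal (p / 4) :=
    (measure_mono hsub).trans ((measure_union_le _ _).trans
      (add_le_add ((measure_union_le _ _).trans (add_le_add h2 h3)) h4))
  rw [← ENNReal.ofReal_add (by positivity) (by positivity),
    ← ENNReal.ofReal_add (by positivity) (by positivity)] at h7
  have h8 := ENNReal.toReal_le_of_le_ofReal (by positivity) h7
  have h9 : p ≤ P.real {ω | 1 / 4 < |score X ε u y n ω + g n (sample X n ω)|} := h1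
  rw [Measure.real] at h9
  linarith

end IsRegressionSample

end NotTight

/-! ### Limits in distribution -/

section ConvergenceInDistribution

variable {Ω Ω' : Type*} [MeasurableSpace Ω] {P : Measure Ω} [IsProbabilityMeasure P]
  [MeasurableSpace Ω'] {P' : Measure Ω'} [IsProbabilityMeasure P']

/-- A sequence that converges in distribution is tight. -/
lemma BoundedInProbability.of_tendstoInDistribution {E : Type*} [NormedAddCommGroup E]
    [MeasurableSpace E] [OpensMeasurableSpace E] {f : ℕ → Ω → E} {Z : Ω' → E}
    (h : TendstoInDistribution f atTop Z (fun _ => P) P') :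
    BoundedInProbability P fun n ω => ‖f n ω‖ := by
  intro p hp
  have hZ := h.aemeasurable_limit
  have hS : ∀ m : ℕ, IsClosed {x : E | (m : ℝ) ≤ ‖x‖} := fun m =>
    isClosed_le continuous_const continuous_norm
  have hlim : Tendsto (fun m : ℕ => P'.map Z {x : E | (m : ℝ) ≤ ‖x‖}) atTop (𝓝 0) := by
    have : IsProbabilityMeasure (P'.map Z) := Measure.isProbabilityMeasure_map hZ
    have h1 := tendsto_measure_iInter_atTop (μ := P'.map Z)
      (s := fun m : ℕ => {x : E | (m : ℝ) ≤ ‖x‖})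
      (fun m => (hS m).measurableSet.nullMeasurableSet)
      (fun a b hab x (hx : (b : ℝ) ≤ ‖x‖) => (Nat.cast_le.2 hab).trans hx) ⟨0, measure_ne_top _ _⟩
    have h2 : ⋂ m : ℕ, {x : E | (m : ℝ) ≤ ‖x‖} = ∅ := by
      refine Set.eq_empty_of_forall_notMem fun x hx => ?_
      obtain ⟨m, hm⟩ := exists_nat_gt ‖x‖
      exact absurd (Set.mem_iInter.1 hx m) (not_le.2 hm)
    rwa [h2, measure_empty] at h1
  obtain ⟨m, hm, hm0⟩ := ((hlim.eventually_lt_const hp).and (eventually_gt_atTop 0)).exists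
  refine ⟨m, by exact_mod_cast hm0, ?_⟩
  have h3 := ProbabilityMeasure.limsup_measure_closed_le_of_tendsto h.tendsto (hS m)
  filter_upwards [eventually_lt_of_limsup_lt (h3.trans_lt hm)] with n hn
  rw [ProbabilityMeasure.coe_mk, Measure.map_apply_of_aemeasurable (h.forall_aemeasurable n)
    (hS m).measurableSet] at hn
  refine le_trans (measure_mono fun ω hω => ?_) hn.le
  rw [Set.mem_ofPred_eq, abs_norm] at hω
  exact hω.le

/-- A limit in distribution of deterministic real numbers is deterministic. -/
lemma exists_ae_eq_const_of_tendstoInDistribution {d : ℕ → ℝ} {Z : Ω' → ℝ}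
    (h : TendstoInDistribution (fun n (_ : Ω) => d n) atTop Z (fun _ => P) P') :
    ∃ c, Z =ᵐ[P'] (fun _ => c) ∧ ((∀ n, d n = 0) → c = 0) := by
  have hZ := h.aemeasurable_limit
  have harc : ∀ t, ‖Real.arctan t‖ ≤ Real.pi / 2 := fun t => by
    rw [Real.norm_eq_abs, abs_le]
    exact ⟨(Real.neg_pi_div_two_lt_arctan t).le, (Real.arctan_lt_pi_div_two t).le⟩
  let φ : BoundedContinuousFunction ℝ ℝ := BoundedContinuousFunction.ofNormedAddCommGroup
    Real.arctan Real.continuous_arctan (Real.pi / 2) harc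
  -- the mean and the second moment of the compactified limit are limits of those of a constant
  have hmom : ∀ ψ : BoundedContinuousFunction ℝ ℝ,
      Tendsto (fun n => ψ (d n)) atTop (𝓝 (∫ ω, ψ (Z ω) ∂P')) := fun ψ => by
    have h1 := ProbabilityMeasure.tendsto_iff_forall_integral_tendsto.1 h.tendsto ψ
    have h2 : ∀ n, ∫ t, ψ t ∂(P.map fun _ : Ω => d n) = ψ (d n) := fun n => by
      rw [integral_map aemeasurable_const ψ.continuous.aestronglyMeasurable]
      simp
    simp only [ProbabilityMeasure.coe_mk, h2] at h1
    rwa [integral_map hZ ψ.continuous.aestronglyMeasurable] at h1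
  have hm1 := hmom φ
  have hm2 := tendsto_nhds_unique (hmom (φ * φ)) (hm1.mul hm1)
  set m := ∫ ω, φ (Z ω) ∂P' with hm
  have hφm : AEMeasurable (fun ω => φ (Z ω)) P' :=
    φ.continuous.measurable.comp_aemeasurable hZ
  have hφi : Integrable (fun ω => φ (Z ω)) P' :=
    Integrable.of_bound hφm.aestronglyMeasurable (Real.pi / 2)
      (Eventually.of_forall fun ω => harc _)
  have hφi2 : Integrable (fun ω => φ (Z ω) * φ (Z ω)) P' :=
    hφi.mul_bdd (c := Real.pi / 2) hφm.aestronglyMeasurable (Eventually.of_forall fun ω => harc _)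
  have hvar : ∫ ω, (φ (Z ω) - m) ^ 2 ∂P' = 0 := by
    have h1 : ∀ ω, (φ (Z ω) - m) ^ 2 = φ (Z ω) * φ (Z ω) - 2 * m * φ (Z ω) + m ^ 2 :=
      fun ω => by ring
    have i1 : Integrable (fun ω => 2 * m * φ (Z ω)) P' := hφi.const_mul _
    have i2 : Integrable (fun ω => φ (Z ω) * φ (Z ω) - 2 * m * φ (Z ω)) P' := hφi2.sub i1
    simp_rw [h1]
    rw [integral_add i2 (integrable_const _), integral_sub hφi2 i1, integral_const_mul, ← hm]
    simp only [BoundedContinuousFunction.mul_apply] at hm2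
    rw [hm2]
    simp
    ring
  have hsq : Integrable (fun ω => (φ (Z ω) - m) ^ 2) P' := by
    refine (((hφi2.sub (hφi.const_mul (2 * m))).add (integrable_const (m ^ 2)))).congr
      (Eventually.of_forall fun ω => ?_)
    simp only [Pi.add_apply, Pi.sub_apply]
    ring
  refine ⟨Real.tan m, ?_, fun hd => ?_⟩
  · filter_upwards [(integral_eq_zero_iff_of_nonneg (fun _ => sq_nonneg _) hsq).1 hvar] with ω hω
    have h1 : Real.arctan (Z ω) = m := sub_eq_zero.1 (pow_eq_zero_iff two_ne_zero |>.1 hω)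
    rw [← h1, Real.tan_arctan]
  · have h1 : m = 0 := by
      refine tendsto_nhds_unique hm1 ?_
      simp_rw [hd]
      have : φ 0 = 0 := Real.arctan_zero
      rw [this]
      exact tendsto_const_nhds
    rw [h1, Real.tan_zero]

end ConvergenceInDistribution

/-! ### Limits of normalized errors -/

section LimitOfEstimator

variable {H : Type*} [NormedAddCommGroup H] [InnerProductSpace ℝ H] [CompleteSpace H]
  [MeasurableSpace H] [BorelSpace H] {Ω Ω' : Type*} [MeasurableSpace Ω] [MeasurableSpace Ω']
  {P : Measure Ω} [IsProbabilityMeasure P] {P' : Measure Ω'} [IsProbabilityMeasure P']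
  {X ε : ℕ → Ω → H} {lam : ℕ → ℝ}
  {e : HilbertBasis ℕ ℝ H} {k : ℕ → ℕ} {lamHat : (n : ℕ) → (Fin n → H) → Fin (k n) → ℝ}
  {eHat : (n : ℕ) → (Fin n → H) → Fin (k n) → H}

lemma ext_of_inner_hilbertBasis (e : HilbertBasis ℕ ℝ H) {A B : H →L[ℝ] H}
    (h : ∀ j l, ⟪A (e j), e l⟫_ℝ = ⟪B (e j), e l⟫_ℝ) : A = B := by
  refine ContinuousLinearMap.ext_on (s := Set.range e)
    (Submodule.dense_iff_topologicalClosure_eq_top.2 e.dense_span) ?_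
  rintro _ ⟨j, rfl⟩
  refine e.repr.injective ?_
  ext l
  rw [e.repr_apply_apply, e.repr_apply_apply, real_inner_comm, h, real_inner_comm]

/-- A limit in distribution, for the operator norm, of normalized errors is deterministic; it is
zero if the centering is the parameter itself. -/
theorem IsRegressionSample.exists_ae_eq_const (h : IsRegressionSample P X ε lam e)
    (hE : IsEmpiricalEigensystem k lamHat eHat) (hε : ¬ (ε 0 =ᵐ[P] 0)) (s : H →L[ℝ] H)
    (C : ℕ → H →L[ℝ] H) (α : ℕ → ℝ) {Z : Ω' → H →L[ℝ] H}
    (hZ : TendstoInDistribution (fun n ω => α n •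
      (estimator (fun i : Fin n => s (X i ω) + ε i ω) (sample X n ω) (lamHat n (sample X n ω))
        (eHat n (sample X n ω)) - C n)) atTop Z (fun _ => P) P') :
    ∃ c, Z =ᵐ[P'] (fun _ => c) ∧ ((∀ n, C n = s) → c = 0) := by
  set Sh : ℕ → Ω → H →L[ℝ] H := fun n ω => estimator (fun i : Fin n => s (X i ω) + ε i ω)
    (sample X n ω) (lamHat n (sample X n ω)) (eHat n (sample X n ω)) with hSh
  have hfreq : ∀ m : ℕ, ∃ᶠ n in atTop, |α n| < 1 / ((m : ℝ) + 1) * √(n : ℝ) := by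
    -- otherwise tightness of the converging sequence makes the error of order `1 / √n`
    intro m hm
    refine h.not_boundedInProbability_norm hE hε s C ?_
    refine (BoundedInProbability.of_tendstoInDistribution hZ).mono (c := m + 1) (B := fun _ => ∅)
      (by simp) (hm.mono fun n hn ω _ => ?_)
    rw [not_lt, one_div, inv_mul_le_iff₀ (by positivity)] at hn
    rw [abs_mul, abs_norm, abs_norm, norm_smul, abs_of_nonneg (Real.sqrt_nonneg _),
      Real.norm_eq_abs, ← mul_assoc]
    exact mul_le_mul_of_nonneg_right hn (norm_nonneg _)
  obtain ⟨φ, hφ, hφα⟩ := extraction_forall_of_frequently hfreq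
  have hφ0 : ∀ n, 0 < √(φ n : ℝ) := fun n =>
    pos_of_mul_pos_right ((abs_nonneg _).trans_lt (hφα n)) (by positivity)
  have hratio : Tendsto (fun n => α (φ n) * (√(φ n))⁻¹) atTop (𝓝 0) := by
    refine squeeze_zero_norm (fun n => ?_) tendsto_one_div_add_atTop_nhds_zero_nat
    rw [norm_mul, Real.norm_eq_abs, norm_inv, Real.norm_of_nonneg (hφ0 n).le, ← div_eq_mul_inv,
      div_le_iff₀ (hφ0 n)]
    exact (hφα n).le
  -- along the subsequence, the coordinates of the limit are limits of deterministic numbers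
  have hcoord : ∀ j l, ∃ c, (fun ω => ⟪Z ω (e j), e l⟫_ℝ) =ᵐ[P'] (fun _ => c) ∧
      ((∀ n, C n = s) → c = 0) := by
    intro j l
    have hcont : Continuous fun A : H →L[ℝ] H => ⟪A (e j), e l⟫_ℝ := by fun_prop
    have h1 := hZ.continuous_comp hcont
    have h2 : TendstoInDistribution (fun n ω => ⟪(α (φ n) • (Sh (φ n) ω - C (φ n))) (e j), e l⟫_ℝ)
        atTop (fun ω => ⟪Z ω (e j), e l⟫_ℝ) (fun _ => P) P' :=
      ⟨fun n => h1.forall_aemeasurable (φ n), h1.aemeasurable_limit,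
        h1.tendsto.comp hφ.tendsto_atTop⟩
    have h3 : TendstoInDistribution
        (fun n (_ : Ω) => α (φ n) * ⟪(s - C (φ n)) (e j), e l⟫_ℝ)
        atTop (fun ω => ⟪Z ω (e j), e l⟫_ℝ) (fun _ => P) P' := by
      refine tendstoInDistribution_of_tendstoInMeasure_sub _ _ h2 ?_ fun n => aemeasurable_const
      rw [tendstoInMeasure_iff_norm]
      intro δ hδ
      refine ((h.boundedInProbability_error hE s j (e l)).tendsto_measure_mul φ
        hφ.tendsto_atTop hratio hδ).congr fun n => ?_
      congr 1
      ext ω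
      rw [Set.mem_ofPred_eq, Set.mem_ofPred_eq]
      rw [mul_assoc, inv_mul_cancel_left₀ (hφ0 n).ne']
      simp only [Pi.sub_apply, Pi.zero_apply, sub_zero, smul_apply, sub_apply,
        real_inner_smul_left, inner_sub_left, Real.norm_eq_abs, hSh]
      rw [abs_sub_comm]
      ring_nf
    obtain ⟨c, hc, hc0⟩ := exists_ae_eq_const_of_tendstoInDistribution h3
    exact ⟨c, hc, fun hC => hc0 fun n => by simp [hC]⟩
  choose c hc hc0 using hcoord
  have hall : ∀ᵐ ω ∂P', ∀ j l, ⟪Z ω (e j), e l⟫_ℝ = c j l :=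
    ae_all_iff.2 fun j => ae_all_iff.2 fun l => hc j l
  obtain ⟨ω₀, hω₀⟩ := hall.exists
  refine ⟨Z ω₀, ?_, fun hC => ?_⟩
  · filter_upwards [hall] with ω hω
    exact ext_of_inner_hilbertBasis e fun j l => by rw [hω, hω₀]
  · exact ext_of_inner_hilbertBasis e fun j l => by rw [hω₀, hc0 j l hC]; simp

end LimitOfEstimator

/-! ### The Hilbert-Schmidt norm and the operator norm -/

section HilbertSchmidt

variable {H : Type*} [NormedAddCommGroup H] [InnerProductSpace ℝ H] [CompleteSpace H]

namespace HilbertSchmidt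

lemma toOp_injective : Function.Injective (toOp (H := H)) := Subtype.coe_injective

/-- The Hilbert-Schmidt norm dominates the operator norm. -/
lemma norm_toOp_le (T : HilbertSchmidt H) : ‖T.toOp‖ ≤ ‖T‖ := by
  rw [← LinearIsometryEquiv.norm_map ContinuousLinearMap.adjoint]
  refine ContinuousLinearMap.opNorm_le_bound _ (norm_nonneg _) fun z => ?_
  refine le_of_sq_le_sq ?_ (by positivity)
  set b := chosenBasis H
  have h1 := b.hasSum_inner_mul_inner (ContinuousLinearMap.adjoint T.toOp z)
    (ContinuousLinearMap.adjoint T.toOp z)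
  rw [real_inner_self_eq_norm_sq] at h1
  have h2 : Summable fun i => ‖T.toOp (b i)‖ ^ 2 := T.2
  rw [mul_pow, norm_sq_eq, ← tsum_mul_right]
  refine hasSum_le (fun i => ?_) h1 (h2.mul_right _).hasSum
  rw [ContinuousLinearMap.adjoint_inner_left, ContinuousLinearMap.adjoint_inner_right,
    real_inner_comm, ← sq, ← mul_pow, ← sq_abs]
  exact pow_le_pow_left₀ (abs_nonneg _) (abs_real_inner_le_norm _ _) 2

lemma continuous_toOp : Continuous (toOp (H := H)) :=
  AddMonoidHomClass.continuous_of_bound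
    ({ toFun := toOp, map_zero' := rfl, map_add' := fun _ _ => rfl } :
      HilbertSchmidt H →+ (H →L[ℝ] H)) 1 fun T => (norm_toOp_le T).trans_eq (one_mul _).symm

end HilbertSchmidt

end HilbertSchmidt

/-! ### Truncation levels -/

/-- The growth condition makes the truncation levels negligible compared with the sample size. -/
lemma tendsto_natCast_div_of_mul_log {k : ℕ → ℕ} (hk : Tendsto k atTop atTop)
    (hkn : Tendsto (fun n : ℕ => ((k n : ℝ) * Real.log (k n)) ^ 2 / n) atTop (𝓝 0)) :
    Tendsto (fun n : ℕ => (k n : ℝ) / n) atTop (𝓝 0) := by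
  refine tendsto_of_tendsto_of_tendsto_of_le_of_le' tendsto_const_nhds hkn
    (Eventually.of_forall fun n => by positivity) ?_
  filter_upwards [hk.eventually_ge_atTop 3] with n hn
  have h3 : (3 : ℝ) ≤ k n := by exact_mod_cast hn
  have h1 : 1 ≤ Real.log (k n) := by
    rw [Real.le_log_iff_exp_le (by linarith)]
    exact Real.exp_one_lt_d9.le.trans (by linarith)
  refine div_le_div_of_nonneg_right ?_ (Nat.cast_nonneg n)
  have h4 : (k n : ℝ) ≤ k n * Real.log (k n) := le_mul_of_one_le_right (by linarith) h1
  nlinarith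

end FunctionalRegression

theorem mainTheorem5
    -- the Hilbert space and the i.i.d. sample of covariates and noises
    {H : Type*} [NormedAddCommGroup H] [InnerProductSpace ℝ H] [CompleteSpace H]
    [MeasurableSpace H] [BorelSpace H]
    {Ω : Type*} [MeasurableSpace Ω] (P : Measure Ω) [IsProbabilityMeasure P]
    (X ε : ℕ → Ω → H)
    (hXm : ∀ i, Measurable (X i)) (hεm : ∀ i, Measurable (ε i))
    (hindep : iIndepFun (fun i ω => (X i ω, ε i ω)) P)
    (hident : ∀ i, IdentDistrib (fun ω => (X i ω, ε i ω)) (fun ω => (X 0 ω, ε 0 ω)) P P)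
    -- the covariate: centered, square integrable, and the eigenelements of its covariance operator
    (hX2 : MemLp (X 0) 2 P) (hX0 : ∫ ω, X 0 ω ∂P = 0)
    (lam : ℕ → ℝ) (e : HilbertBasis ℕ ℝ H)
    (heig : ∀ j, FunctionalRegression.covOp P (X 0) (e j) = lam j • e j)
    (hlam_pos : ∀ j, 0 < lam j) (hlam_anti : Antitone lam)
    (hlam_convex : FunctionalRegression.EventuallyConvex lam)
    -- the normalized coefficients of the covariate: independent, with Bernstein moments
    (hξ_indep : iIndepFun (fun (j : ℕ) ω => ⟪X 0 ω, e j⟫_ℝ / √(lam j)) P)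
    (hbern : FunctionalRegression.BernsteinMoments P
      (fun j ω => ⟪X 0 ω, e j⟫_ℝ / √(lam j)))
    -- the noise: conditionally centered, square integrable, homoscedastic, and not zero
    (hε2 : MemLp (ε 0) 2 P)
    (hε0 : P[ε 0 | MeasurableSpace.comap (X 0) inferInstance] =ᵐ[P] 0)
    (hεvar : ∀ y : H, P[fun ω => ⟪ε 0 ω, y⟫_ℝ ^ 2 | MeasurableSpace.comap (X 0) inferInstance]
      =ᵐ[P] fun _ => ∫ ω, ⟪ε 0 ω, y⟫_ℝ ^ 2 ∂P)
    (hε_ne : ¬ (ε 0 =ᵐ[P] 0))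
    -- the Hilbert-Schmidt parameter and the responses `Y = S X + ε`
    (S : FunctionalRegression.HilbertSchmidt H)
    (Y : ℕ → Ω → H) (hY : ∀ i ω, Y i ω = S.toOp (X i ω) + ε i ω)
    -- the truncation levels
    (k : ℕ → ℕ) (hk : Tendsto k atTop atTop)
    (hkn : Tendsto (fun n : ℕ => ((k n : ℝ) * Real.log (k n)) ^ 2 / n) atTop (𝓝 0))
    -- the first `k n` eigenelements of the empirical covariance operator of `x_1, …, x_n`
    (lamHat : (n : ℕ) → (Fin n → H) → Fin (k n) → ℝ)
    (eHat : (n : ℕ) → (Fin n → H) → Fin (k n) → H)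
    (hHat : ∀ n x,
      FunctionalRegression.IsLeadingEigensystem (FunctionalRegression.empCov x)
        (lamHat n x) (eHat n x))
    (hHat_meas : ∀ n j, Measurable fun x => eHat n x j)
    -- the estimator
    (Shat : ℕ → Ω → FunctionalRegression.HilbertSchmidt H)
    (hShat : ∀ n ω, Shat n ω = FunctionalRegression.estimatorHS
      (fun i : Fin n => Y i ω) (fun i : Fin n => X i ω)
      (lamHat n fun i => X i ω) (eHat n fun i => X i ω))
    -- the normalizing sequence and the probability space of the limit
    (α : ℕ → ℝ)
    {Ω' : Type*} [MeasurableSpace Ω'] (P' : Measure Ω') [IsProbabilityMeasure P'] :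
    -- for the Hilbert-Schmidt norm
    ((∀ Z : Ω' → FunctionalRegression.HilbertSchmidt H, ¬ (Z =ᵐ[P'] 0) →
        ¬ TendstoInDistribution (fun n ω => α n • (Shat n ω - S)) atTop Z (fun _ => P) P') ∧
      (∀ (C : ℕ → FunctionalRegression.HilbertSchmidt H)
        (Z : Ω' → FunctionalRegression.HilbertSchmidt H), (¬ ∃ c, Z =ᵐ[P'] fun _ => c) →
        ¬ TendstoInDistribution (fun n ω => α n • (Shat n ω - C n)) atTop Z
          (fun _ => P) P')) ∧
    -- for the operator norm
    ((∀ Z : Ω' → H →L[ℝ] H, ¬ (Z =ᵐ[P'] 0) →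
        ¬ TendstoInDistribution (fun n ω => α n • ((Shat n ω).toOp - S.toOp)) atTop Z
          (fun _ => P) P') ∧
      (∀ (C : ℕ → H →L[ℝ] H) (Z : Ω' → H →L[ℝ] H), (¬ ∃ c, Z =ᵐ[P'] fun _ => c) →
        ¬ TendstoInDistribution (fun n ω => α n • ((Shat n ω).toOp - C n)) atTop Z
          (fun _ => P) P')) := by
  have h : FunctionalRegression.IsRegressionSample P X ε lam e :=
    ⟨hXm, hεm, hindep, hident, hX2, hX0, heig, hlam_pos, hξ_indep, hε2, hε0, hεvar⟩
  have hE : FunctionalRegression.IsEmpiricalEigensystem k lamHat eHat :=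
    ⟨hk, FunctionalRegression.tendsto_natCast_div_of_mul_log hk hkn, hHat, hHat_meas⟩
  have hop : ∀ n ω, (Shat n ω).toOp = FunctionalRegression.estimator
      (fun i : Fin n => S.toOp (X i ω) + ε i ω) (FunctionalRegression.sample X n ω)
      (lamHat n (FunctionalRegression.sample X n ω))
      (eHat n (FunctionalRegression.sample X n ω)) := fun n ω => by
    rw [hShat]
    simp only [hY]
    rfl
  have core : ∀ (C : ℕ → H →L[ℝ] H) (Z : Ω' → H →L[ℝ] H),
      TendstoInDistribution (fun n ω => α n • ((Shat n ω).toOp - C n)) atTop Z (fun _ => P) P' →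
      ∃ c, Z =ᵐ[P'] (fun _ => c) ∧ ((∀ n, C n = S.toOp) → c = 0) := fun C Z hZ => by
    simp_rw [hop] at hZ
    exact h.exists_ae_eq_const hE hε_ne S.toOp C α hZ
  -- the inclusion of the Hilbert-Schmidt operators into the bounded operators is continuous
  have coreHS : ∀ (C : ℕ → FunctionalRegression.HilbertSchmidt H)
      (Z : Ω' → FunctionalRegression.HilbertSchmidt H),
      TendstoInDistribution (fun n ω => α n • (Shat n ω - C n)) atTop Z (fun _ => P) P' →
      ∃ c, Z =ᵐ[P'] (fun _ => c) ∧ ((∀ n, C n = S) → c = 0) := fun C Z hZ => by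
    obtain ⟨c, hc, hc0⟩ := core (fun n => (C n).toOp) (fun ω => (Z ω).toOp)
      (hZ.continuous_comp FunctionalRegression.HilbertSchmidt.continuous_toOp)
    obtain ⟨ω₀, hω₀⟩ := hc.exists
    refine ⟨Z ω₀, ?_, fun hC => ?_⟩
    · filter_upwards [hc] with ω hω
      exact FunctionalRegression.HilbertSchmidt.toOp_injective (hω.trans hω₀.symm)
    · exact FunctionalRegression.HilbertSchmidt.toOp_injective
        (hω₀.trans (hc0 fun n => by rw [hC n]))
  refine ⟨⟨fun Z hZ0 hZ => ?_, fun C Z hZc hZ => ?_⟩, fun Z hZ0 hZ => ?_, fun C Z hZc hZ => ?_⟩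
  · obtain ⟨c, hc, hc0⟩ := coreHS (fun _ => S) Z hZ
    rw [hc0 fun _ => rfl] at hc
    exact hZ0 hc
  · obtain ⟨c, hc, -⟩ := coreHS C Z hZ
    exact hZc ⟨c, hc⟩
  · obtain ⟨c, hc, hc0⟩ := core (fun _ => S.toOp) Z hZ
    rw [hc0 fun _ => rfl] at hc
    exact hZ0 hc
  · obtain ⟨c, hc, -⟩ := core C Z hZ
    exact hZc ⟨c, hc⟩
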